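/- **Setting.** Let $\Gamma\subset\mathbb R^2$ be a curve of length $L>0$ given by an arc length parameterization $\gamma\in C^2([0,L];\mathbb R^2)$ without self-intersections; $\Gamma$ may be closed ($\gamma(0)=\gamma(L)$, no other coincidence), in which case the first two derivatives of $\gamma$ at $0$ and $L$ agree. Let $K=\max|\gamma''|$. For a parameterization $\eta$ let $M_\eta(m)$ be the largest constant with $M_\eta(m)|s-s'|\le|\eta(s)-\eta(s')|$ for all $s,s'\in[0,L]$, $|s-s'|\le m$. Put $M=\min\{M_\gamma(L/2),M_{\tilde\gamma}(L/2)\}$ if $\Gamma$ is closed, where $\tilde\gamma$ is $\gamma$ with starting point shifted by $L/2$, and $M=M_\gamma(L)$ otherwise. Let $\sigma$ be the arc length measure on $\Gamma$. Let $\mathcal C_1$ be the convex hull of $\{x:\operatorname{dist}(x,\Gamma)\le1\}$, let $R$ be the infimum of the radii of the balls containing $\mathcal C_1$, and let $B_R$ be a (closed) ball of radius $R$ containing $\mathcal C_1$. For $\alpha>0$ let $H$ be the self-adjoint operator in $L^2(\mathbb R^2)$ associated with the form $\int\nabla\psi\cdot\nabla\overline\phi\,dx-\alpha\int_\Gamma\psi\overline\phi\,d\sigma$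 (with traces of $\psi,\phi$ on $\Gamma$) on $W^{1,2}(\mathbb R^2)$. Assume that the bottom of the spectrum of $H$ consists of two isolated eigenvalues $E_0<E_1<0$. Let $\psi_0,\psi_1$ be continuous real eigenfunctions for $E_0,E_1$ with $\|\psi_0\|_\infty=\|\psi_1\|_\infty=1$, and put $f=\psi_1/\psi_0$, $\kappa_0=\sqrt{-E_0}$, $\rho=\kappa_0R$. A point $y\in\mathbb R^2\setminus\Gamma$ is called admissible with unit vector $e$ if the ray $\{y-te:t\ge0\}$ meets $\Gamma$ and, for the smallest such $t=:d(y)$ and a parameter $s_y$ with $\gamma(s_y)=y-d(y)e$, the number $\cos\theta:=\langle e,\gamma'(s_y)\rangle$ satisfies $|\cos\theta|<1$. Put $\delta_0=\min\{\frac L2,\frac{M}{2K}\frac{1-|\cos\theta|}2\}$ (with $\delta_0=L/2$ if $K=0$) and $b_1=M\delta_0/2$. **Proposition 6.6.** There are functions $c_3=c_3(M,K)$ and $c_4=c_4(M)$ such that, for every curve $\Gamma$ as above and every admissible point $y$ with $|\cos\theta|\le\sqrt3/2$ and $d(y)\le\min\{1,b_1\}$, $$\frac1{2\pi}\int_\Gamma\frac{d\sigma(x)}{|y-x|}\le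 c_3+c_4\big(\log L+|\log d(y)|\big),$$ and, with $c_5=\max\{2c_4,\;c_3+c_4\log(\max\{1,L\})\}$, there is an absolute constant $\beta_0>0$ (independent of $\Gamma$, $\alpha$, the eigenvalues and the eigenfunctions) such that in every situation as above: $\psi_0$ has no zeros, $f$ is differentiable on $\mathbb R^2\setminus\Gamma$, $|\nabla f|$ is integrable on $B_R$, and $$\int_{B_R}|\nabla f(y)|\,dy\;\ge\;\frac{(\kappa_0\rho)^2\,\rho}{(\alpha c_5+1)^6(\kappa_0^2+1)^4\,\zeta(\kappa_0)}\,e^{-\beta_0\rho},$$ where $\zeta(\kappa_0)=1$ for $\kappa_0\ge\frac12$ and $\zeta(\kappa_0)=-\frac{\log\kappa_0}{\log2}$ for $\kappa_0<\frac12$. -/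

import Mathlib

open MeasureTheory Set Filter Topology
open scoped ContDiff

noncomputable section

namespace DeltaCurve

/-- The Euclidean plane. -/
abbrev Plane := EuclideanSpace ℝ (Fin 2)

/-! ### The curve and its geometric parameters -/

/-- A finite plane curve of class `C²` and of length `L`, parameterized by arc length on `[0, L]`,
without self-intersections. The curve may be closed (`γ 0 = γ L`); then the first two
derivatives of the parameterization agree at `0` and `L`. Values of `γ` outside `[0, L]` play
no role. -/
structure PlaneCurve where
  L : ℝ
  L_pos : 0 < L
  γ : ℝ → Plane
  contDiffOn : ContDiffOn ℝ 2 γ (Icc 0 L)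
  unit_speed : ∀ s ∈ Icc 0 L, ‖derivWithin γ (Icc 0 L) s‖ = 1
  simple : ∀ s ∈ Icc 0 L, ∀ t ∈ Icc 0 L, s < t → γ s = γ t → s = 0 ∧ t = L
  closed_smooth : γ 0 = γ L →
    derivWithin γ (Icc 0 L) 0 = derivWithin γ (Icc 0 L) L ∧
    iteratedDerivWithin 2 γ (Icc 0 L) 0 = iteratedDerivWithin 2 γ (Icc 0 L) L

namespace PlaneCurve

variable (Γ : PlaneCurve)

/-- The curve as a subset of the plane. -/
def carrier : Set Plane := Γ.γ '' Icc 0 Γ.L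

/-- The unit tangent vector at the parameter value `s`. -/
def tangent (s : ℝ) : Plane := derivWithin Γ.γ (Icc 0 Γ.L) s

/-- The maximal curvature of the curve. -/
def maxCurvature : ℝ :=
  sSup ((fun s => ‖iteratedDerivWithin 2 Γ.γ (Icc 0 Γ.L) s‖) '' Icc 0 Γ.L)

/-- For a parameterization `η` on `[0, L]`, the largest constant `M` such that
`M * |s - s'| ≤ |η s - η s'|` for all parameter values with `|s - s'| ≤ m`. -/
def chordArc (η : ℝ → Plane) (m : ℝ) : ℝ :=
  sSup {M : ℝ | ∀ s ∈ Icc 0 Γ.L, ∀ s' ∈ Icc 0 Γ.L, |s - s'| ≤ m → M * |s - s'| ≤ ‖η s - η s'‖}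

/-- The parameterization of a closed curve that is shifted by half of the length. -/
def shifted (s : ℝ) : Plane :=
  if s < Γ.L / 2 then Γ.γ (s + Γ.L / 2) else Γ.γ (s - Γ.L / 2)

open Classical in
/-- The injectivity constant `M` of the curve: for a closed curve the smaller one of the constants
of `γ` and of the shifted parameterization on arcs of length at most `L / 2`, for a curve that is
not closed the constant of `γ` on arcs of length at most `L`. -/
def injConst : ℝ :=
  if Γ.γ 0 = Γ.γ Γ.L then
    min (Γ.chordArc Γ.γ (Γ.L / 2)) (Γ.chordArc Γ.shifted (Γ.L / 2))
  else Γ.chordArc Γ.γ Γ.L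

/-- The convex hull of the closed `1`-neighbourhood of the curve. -/
def hull : Set Plane := convexHull ℝ (Metric.cthickening 1 Γ.carrier)

/-- The infimum of the radii of the balls that contain `hull`. -/
def radius : ℝ := sInf {r : ℝ | 0 < r ∧ ∃ x : Plane, Γ.hull ⊆ Metric.closedBall x r}

/-- The arc length measure on the curve, as a measure on the plane. -/
def sigma : Measure Plane := Measure.map Γ.γ (volume.restrict (Icc 0 Γ.L))

/-! ### Admissible points and the logarithmic bound -/

/-- `y` is an admissible point with respect to line segments parallel to the unit vector `e`
(only the direction of such a segment matters): the ray `y - t e`, `t ≥ 0`, hits the curve, `d` is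
the smallest parameter at which it does, the point hit is `γ s`, and the ray is not tangential to
the curve there. -/
structure IsAdmissible (e y : Plane) (s d : ℝ) : Prop where
  norm_dir : ‖e‖ = 1
  notMem : y ∉ Γ.carrier
  param_mem : s ∈ Icc 0 Γ.L
  first_hit : IsLeast {t : ℝ | 0 ≤ t ∧ y - t • e ∈ Γ.carrier} d
  hit_eq : Γ.γ s = y - d • e
  transversal : |inner ℝ e (Γ.tangent s)| < 1

open Classical in
/-- The length `δ₀ = min {L / 2, M / (2 K) * (1 - |cos θ|) / 2}`, where `c = cos θ`; for `K = 0`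
the second number is infinite. -/
def delta (c : ℝ) : ℝ :=
  if Γ.maxCurvature = 0 then Γ.L / 2
  else min (Γ.L / 2) (Γ.injConst / (2 * Γ.maxCurvature) * ((1 - |c|) / 2))

end PlaneCurve

/-- The functions `c₃ = c₃(M, K)` and `c₄ = c₄(M)` satisfy, for every curve and every admissible
point `y` whose distance `d` from the curve along the ray is at most `min {1, M δ₀ / 2}` and whose
ray meets the curve at an angle with `|cos θ| ≤ √3 / 2`, the bound
`(2π)⁻¹ ∫_Γ |y - x|⁻¹ dσ(x) ≤ c₃ + c₄ (log L + |log d|)`. -/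
def IsLogBound (c₃ : ℝ → ℝ → ℝ) (c₄ : ℝ → ℝ) : Prop :=
  ∀ (Γ : PlaneCurve) (e y : Plane) (s d : ℝ), Γ.IsAdmissible e y s d →
    |inner ℝ e (Γ.tangent s)| ≤ √3 / 2 →
    d ≤ min 1 (Γ.injConst * Γ.delta (inner ℝ e (Γ.tangent s)) / 2) →
    1 / (2 * Real.pi) * ∫ x, 1 / ‖y - x‖ ∂Γ.sigma ≤
      c₃ Γ.injConst Γ.maxCurvature + c₄ Γ.injConst * (Real.log Γ.L + |Real.log d|)

/-- `c₅ = max {2 c₄, c₃ + c₄ log (max {1, L})}`. -/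
def c5 (c₃ : ℝ → ℝ → ℝ) (c₄ : ℝ → ℝ) (Γ : PlaneCurve) : ℝ :=
  max (2 * c₄ Γ.injConst)
    (c₃ Γ.injConst Γ.maxCurvature + c₄ Γ.injConst * Real.log (max 1 Γ.L))

/-! ### The operator `-Δ - α δ(x - Γ)`

The operator is real, so we work in the real Hilbert space `L²(ℝ²; ℝ)`; its real spectrum, its
eigenvalues and its real eigenfunctions are those of the operator in `L²(ℝ²; ℂ)`. -/

/-- `G` is the weak gradient of `u`. -/
def IsWeakGradient (u : Plane → ℝ) (G : Plane → Plane) : Prop :=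
  ∀ η : Plane → ℝ, ContDiff ℝ ∞ η → HasCompactSupport η →
    ∫ x, u x • gradient η x = - ∫ x, η x • G x

/-- `g ∈ L²(σ)` is the trace on the curve of the function `u ∈ W^{1,2}` with weak gradient `G`:
the limit of the restrictions of test functions which converge to `u` in `W^{1,2}`. -/
def IsTrace (Γ : PlaneCurve) (u : Plane → ℝ) (G : Plane → Plane) (g : Plane → ℝ) : Prop :=
  MemLp g 2 Γ.sigma ∧
  ∃ v : ℕ → Plane → ℝ, (∀ n, ContDiff ℝ ∞ (v n) ∧ HasCompactSupport (v n)) ∧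
    Tendsto (fun n => eLpNorm (fun x => v n x - u x) 2 volume) atTop (𝓝 0) ∧
    Tendsto (fun n => eLpNorm (fun x => gradient (v n) x - G x) 2 volume) atTop (𝓝 0) ∧
    Tendsto (fun n => eLpNorm (fun x => v n x - g x) 2 Γ.sigma) atTop (𝓝 0)

/-- `u` belongs to `W^{1,2}(ℝ²)`, with weak gradient `G` and trace `g`. -/
structure IsFormElement (Γ : PlaneCurve) (u : Plane → ℝ) (G : Plane → Plane) (g : Plane → ℝ) :
    Prop where
  memLp : MemLp u 2 volume
  memLp_grad : MemLp G 2 volume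
  weakGradient : IsWeakGradient u G
  trace : IsTrace Γ u G g

/-- The form `∫ ∇ψ ∇φ dx - α ∫ (Iψ) (Iφ) dσ`, in terms of the gradients `G`, `G'` and of the
traces `g`, `g'` of `ψ` and `φ`. -/
def form (Γ : PlaneCurve) (α : ℝ) (G : Plane → Plane) (g : Plane → ℝ) (G' : Plane → Plane)
    (g' : Plane → ℝ) : ℝ :=
  (∫ x, inner ℝ (G x) (G' x)) - α * ∫ x, g x * g' x ∂Γ.sigma

/-- `ψ` is in the domain of the operator `H` associated with the form, and `H ψ = h`. -/
def HamiltonianMaps (Γ : PlaneCurve) (α : ℝ) (ψ h : Plane → ℝ) : Prop :=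
  MemLp h 2 volume ∧ ∃ G g, IsFormElement Γ ψ G g ∧
    ∀ φ G' g', IsFormElement Γ φ G' g' → form Γ α G g G' g' = ∫ x, h x * φ x

/-- `ψ` is a (real) eigenfunction of `H` with eigenvalue `E`. -/
def IsEigenfunction (Γ : PlaneCurve) (α E : ℝ) (ψ : Plane → ℝ) : Prop :=
  ¬ (ψ =ᵐ[volume] 0) ∧ HamiltonianMaps Γ α ψ (fun x => E * ψ x)

/-- `E` is in the resolvent set of `H`: for every `g ∈ L²` the equation `(H - E) ψ = g` has exactly
one solution, and the solution operator is bounded. -/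
def InResolventSet (Γ : PlaneCurve) (α E : ℝ) : Prop :=
  ∃ C : ℝ, ∀ g : Plane → ℝ, MemLp g 2 volume →
    ∃ ψ : Plane → ℝ, HamiltonianMaps Γ α ψ (fun x => g x + E * ψ x) ∧
      eLpNorm ψ 2 volume ≤ ENNReal.ofReal C * eLpNorm g 2 volume ∧
      ∀ ψ' : Plane → ℝ, HamiltonianMaps Γ α ψ' (fun x => g x + E * ψ' x) → ψ' =ᵐ[volume] ψ

/-- The spectrum of `H`. -/
def hSpectrum (Γ : PlaneCurve) (α : ℝ) : Set ℝ := {E | ¬ InResolventSet Γ α E}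

/-- The bottom of the spectrum of `H` consists of the two isolated (negative) eigenvalues
`E₀ < E₁`. -/
structure TwoLowestEigenvalues (Γ : PlaneCurve) (α E₀ E₁ : ℝ) : Prop where
  lt : E₀ < E₁
  neg : E₁ < 0
  eigenvalue₀ : ∃ ψ, IsEigenfunction Γ α E₀ ψ
  eigenvalue₁ : ∃ ψ, IsEigenfunction Γ α E₁ ψ
  bottom : ∃ ε > 0, hSpectrum Γ α ∩ Iio (E₁ + ε) = {E₀, E₁}

/-- `ζ(κ) = 1` for `κ ≥ 1/2` and `ζ(κ) = - log κ / log 2` for `κ < 1/2`. -/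
def zeta (κ : ℝ) : ℝ := if 1 / 2 ≤ κ then 1 else - Real.log κ / Real.log 2

end DeltaCurve

end

open MeasureTheory Set Filter Topology
open scoped ContDiff

noncomputable section

namespace DeltaCurve

/-! ### Extending the parameterization to the whole line -/

section

namespace PlaneCurve

variable (Γ : PlaneCurve)

/-! Write `M` for the injectivity constant, `R` for the radius and `A = α c₅ + 1`. A continuous
eigenfunction `ψ` with eigenvalue `-κ²` has its own restriction as trace on the curve
(`trace_ae_eq`), so it satisfies `-Δψ + κ²ψ = αψσ` in the sense of distributions. Testing this with
the heat kernel and integrating over time gives `ψ(x) = α ∫ ψ(z) G(x - z) dσ(z)`, where `G` is the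
Green function of `-Δ + κ²` (`IsDistSolution.eq_integral_green`). The estimates of the
eigenfunctions follow from this formula, from elementary bounds for `G`, and from the chord-arc
inequality, which compares integrals over `Γ` of decreasing functions of the distance with integrals
over `[0, L]` (`lintegral_antitone_le`).

Ground state: since `E₀` is the best lower bound of the form, `|ψ₀|` solves the same equation
(`IsEigenfunction.isDistSolution_abs`), and the formula makes it strictly positive. Its maximum `1`
is attained at a point of `Γ`. The singularity of `G` is integrable along `Γ`, so at least half of
this value is contributed by points that are not too close. This bounds `∫ |ψ₀| dσ` from below, and
a lower bound for `G` then gives `|ψ₀| ≥ m`, with `m` a constant times `√(κ₀/A) exp(-3κ₀R)`, on the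
ball `B_R` (`IsDistSolution.le_of_nonneg`).

Excited state: with the right sign, `v = ±ψ₁` equals `1` at some `x₁ ∈ Γ`. If `v` were positive on
`Γ`, the formula would make it nonnegative everywhere, against its orthogonality to `ψ₀`; so `v(x₂)
≤ 0` for some `x₂ ∈ Γ` (`IsDistSolution.exists_nonpos`). Moreover `v` is Hölder continuous with
exponent `1/2` and constant `A√R` (`IsDistSolution.abs_sub_le`). Put `d = m/(4A√R)`. On the discs of
radius `d²` around `x₁` and `x₂` the quotient `v/|ψ₀|` is at least `3/4` and at most `1/4`,
respectively. Almost every line parallel to `x₁ - x₂` meets `Γ` finitely often. The fundamental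
theorem of calculus on the segments between the discs, integrated over these lines, yields `∫ |∇f| ≥
(1/2)(2d²) = d²` (`PlaneCurve.le_lintegral_fderiv`), which is a constant times `κ₀
exp(-6κ₀R)/(A³R)`. For large `β₀` this dominates the asserted bound (`bound_le`).

The logarithmic bound is a separate matter. Transversality and the smallness of `d(y)` keep all of
`Γ` at distance at least `d(y)/4` from `y` (`IsAdmissible.le_norm`), so the integrand may be cut off
there and the integral is logarithmic. The constants in it may be enlarged at will, and `c₄` is
taken so large that `α c₅` dominates the Hölder constant and the constant needed for `m`. This
choice is the only link between the two assertions. -/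

lemma uniqueDiffOn_Icc' : UniqueDiffOn ℝ (Icc 0 Γ.L) := uniqueDiffOn_Icc Γ.L_pos

lemma continuousOn_param : ContinuousOn Γ.γ (Icc 0 Γ.L) := Γ.contDiffOn.continuousOn

lemma hasDerivWithinAt_param {s : ℝ} (hs : s ∈ Icc 0 Γ.L) :
    HasDerivWithinAt Γ.γ (Γ.tangent s) (Icc 0 Γ.L) s :=
  ((Γ.contDiffOn.differentiableOn (by norm_num)) s hs).hasDerivWithinAt

lemma hasDerivAt_param {s : ℝ} (hs : s ∈ Ioo 0 Γ.L) : HasDerivAt Γ.γ (Γ.tangent s) s :=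
  (Γ.hasDerivWithinAt_param (Ioo_subset_Icc_self hs)).hasDerivAt (Icc_mem_nhds hs.1 hs.2)

lemma contDiffOn_tangent : ContDiffOn ℝ 1 Γ.tangent (Icc 0 Γ.L) :=
  Γ.contDiffOn.derivWithin Γ.uniqueDiffOn_Icc' (by norm_num)

lemma continuousOn_tangent : ContinuousOn Γ.tangent (Icc 0 Γ.L) :=
  Γ.contDiffOn_tangent.continuousOn

lemma norm_tangent {s : ℝ} (hs : s ∈ Icc 0 Γ.L) : ‖Γ.tangent s‖ = 1 := Γ.unit_speed s hs

lemma iteratedDerivWithin_two_eq {s : ℝ} :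
    iteratedDerivWithin 2 Γ.γ (Icc 0 Γ.L) s = derivWithin Γ.tangent (Icc 0 Γ.L) s := by
  rw [iteratedDerivWithin_succ]
  congr 1
  ext t
  simp [iteratedDerivWithin_one, tangent]

lemma hasDerivWithinAt_tangent {s : ℝ} (hs : s ∈ Icc 0 Γ.L) :
    HasDerivWithinAt Γ.tangent (iteratedDerivWithin 2 Γ.γ (Icc 0 Γ.L) s) (Icc 0 Γ.L) s := by
  rw [iteratedDerivWithin_two_eq]
  exact ((Γ.contDiffOn_tangent.differentiableOn (by norm_num)) s hs).hasDerivWithinAt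

lemma norm_curvature_le {s : ℝ} (hs : s ∈ Icc 0 Γ.L) :
    ‖iteratedDerivWithin 2 Γ.γ (Icc 0 Γ.L) s‖ ≤ Γ.maxCurvature := by
  have hc : ContinuousOn (fun s => ‖iteratedDerivWithin 2 Γ.γ (Icc 0 Γ.L) s‖) (Icc 0 Γ.L) :=
    (Γ.contDiffOn.continuousOn_iteratedDerivWithin (by norm_num) Γ.uniqueDiffOn_Icc').norm
  exact le_csSup (isCompact_Icc.bddAbove_image hc) (mem_image_of_mem _ hs)

lemma zero_mem : (0 : ℝ) ∈ Icc 0 Γ.L := ⟨le_rfl, Γ.L_pos.le⟩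

lemma length_mem : Γ.L ∈ Icc 0 Γ.L := ⟨Γ.L_pos.le, le_rfl⟩

lemma maxCurvature_nonneg : 0 ≤ Γ.maxCurvature :=
  (norm_nonneg _).trans (Γ.norm_curvature_le Γ.zero_mem)

lemma hasDerivWithinAt_tangent_Ici {s : ℝ} (hs : s ∈ Ico 0 Γ.L) :
    HasDerivWithinAt Γ.tangent (iteratedDerivWithin 2 Γ.γ (Icc 0 Γ.L) s) (Ici s) s := by
  refine (Γ.hasDerivWithinAt_tangent (Ico_subset_Icc_self hs)).mono_of_mem_nhdsWithin ?_
  exact mem_of_superset (Icc_mem_nhdsGE hs.2) (Icc_subset_Icc_left hs.1)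

lemma norm_tangent_sub_le {s t : ℝ} (hs : s ∈ Icc 0 Γ.L) (ht : t ∈ Icc 0 Γ.L) :
    ‖Γ.tangent s - Γ.tangent t‖ ≤ Γ.maxCurvature * |s - t| := by
  have := (convex_Icc 0 Γ.L).norm_image_sub_le_of_norm_hasDerivWithin_le
    (fun x hx => Γ.hasDerivWithinAt_tangent hx) (fun x hx => Γ.norm_curvature_le hx) ht hs
  simpa using this

lemma norm_param_sub_le {s t : ℝ} (hs : s ∈ Icc 0 Γ.L) (ht : t ∈ Icc 0 Γ.L) :
    ‖Γ.γ s - Γ.γ t‖ ≤ |s - t| := by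
  have := (convex_Icc 0 Γ.L).norm_image_sub_le_of_norm_hasDerivWithin_le
    (fun x hx => Γ.hasDerivWithinAt_param hx) (fun x hx => (Γ.norm_tangent hx).le) ht hs
  simpa using this

/-- A function that is an affine function up to an error controlled by a Lipschitz derivative. -/
lemma norm_sub_sub_smul_le {P T : ℝ → Plane} {K : ℝ} (hP : ∀ s, HasDerivAt P (T s) s)
    (hK : 0 ≤ K) (hT : ∀ s t, ‖T s - T t‖ ≤ K * |s - t|) (s t : ℝ) :
    ‖P (s + t) - P s - t • T s‖ ≤ K * t ^ 2 := by
  have key := (convex_uIcc s (s + t)).norm_image_sub_le_of_norm_hasDerivWithin_le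
    (f := fun x => P x - x • T s) (f' := fun x => T x - T s) (C := K * |t|)
    (fun x _ => ?_) (fun x hx => ?_) (left_mem_uIcc) (right_mem_uIcc)
  · have e : P (s + t) - (s + t) • T s - (P s - s • T s) = P (s + t) - P s - t • T s := by
      rw [add_smul]; abel
    rw [e] at key
    refine key.trans (le_of_eq ?_)
    rw [add_sub_cancel_left, Real.norm_eq_abs, mul_assoc, ← sq, sq_abs]
  · have := (hP x).sub ((hasDerivAt_id x).smul_const (T s))
    simpa using! this.hasDerivWithinAt
  · refine (hT x s).trans ?_
    have := abs_sub_left_of_mem_uIcc hx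
    rw [add_sub_cancel_left] at this
    exact mul_le_mul_of_nonneg_left this hK

/-- Continuation by constants: `projIcc` is 1-Lipschitz, so the Lipschitz constant of the tangent
survives. -/
lemma exists_tangent_extension : ∃ T : ℝ → Plane,
    (∀ s t, ‖T s - T t‖ ≤ Γ.maxCurvature * |s - t|) ∧ (∀ s ∈ Icc 0 Γ.L, T s = Γ.tangent s) := by
  refine ⟨fun s => Γ.tangent (projIcc 0 Γ.L Γ.L_pos.le s), fun s t => ?_, fun s hs => ?_⟩
  · refine (Γ.norm_tangent_sub_le (Subtype.mem _) (Subtype.mem _)).trans ?_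
    have := Γ.maxCurvature_nonneg
    exact mul_le_mul_of_nonneg_left (abs_projIcc_sub_projIcc Γ.L_pos.le) this
  · simp only [projIcc_of_mem Γ.L_pos.le hs]

/-- Periodic continuation through the circle of length `L`. The Lipschitz bound uses right
derivatives only: every point has a right neighbourhood inside a single period, so the junctions
need no separate treatment. -/
lemma exists_extension_of_eq (h : Γ.γ 0 = Γ.γ Γ.L) : ∃ T : ℝ → Plane,
    (∀ s t, ‖T s - T t‖ ≤ Γ.maxCurvature * |s - t|) ∧ (∀ s ∈ Icc 0 Γ.L, T s = Γ.tangent s) ∧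
    ∀ s, T (s + Γ.L) = T s := by
  have : Fact (0 < Γ.L) := ⟨Γ.L_pos⟩
  have hT0 : Γ.tangent 0 = Γ.tangent Γ.L := (Γ.closed_smooth h).1
  have hcont : Continuous (AddCircle.liftIco Γ.L 0 Γ.tangent) :=
    AddCircle.liftIco_zero_continuous hT0 Γ.continuousOn_tangent
  set T : ℝ → Plane := fun s => AddCircle.liftIco Γ.L 0 Γ.tangent (s : AddCircle Γ.L) with hTdef
  have hTc : Continuous T := hcont.comp (AddCircle.continuous_mk' Γ.L)
  have hIco : ∀ s ∈ Ico 0 Γ.L, T s = Γ.tangent s := fun s hs =>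
    AddCircle.liftIco_zero_coe_apply hs
  have hper : ∀ s, T (s + Γ.L) = T s := fun s => by simp [hTdef]
  have hIcc : ∀ s ∈ Icc 0 Γ.L, T s = Γ.tangent s := by
    intro s hs
    rcases eq_or_lt_of_le hs.2 with h' | h'
    · have := hper 0
      rw [zero_add, hIco 0 ⟨le_rfl, Γ.L_pos⟩, hT0] at this
      rw [h', this]
    · exact hIco s ⟨hs.1, h'⟩
  have hper' : ∀ (n : ℤ) (s : ℝ), T (s - n * Γ.L) = T s := by
    intro n s
    have : Function.Periodic T Γ.L := hper
    exact this.sub_int_mul_eq n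
  have hder : ∀ x, ∃ v : Plane, HasDerivWithinAt T v (Ici x) x ∧ ‖v‖ ≤ Γ.maxCurvature := by
    intro x
    set n : ℤ := ⌊x / Γ.L⌋ with hn
    have h1 : (n : ℝ) * Γ.L ≤ x := by
      have := Int.floor_le (x / Γ.L)
      rwa [le_div_iff₀ Γ.L_pos] at this
    have h2 : x < n * Γ.L + Γ.L := by
      have := Int.lt_floor_add_one (x / Γ.L)
      rw [div_lt_iff₀ Γ.L_pos] at this
      linarith
    have hy : x - n * Γ.L ∈ Ico 0 Γ.L := ⟨by linarith, by linarith⟩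
    refine ⟨_, ?_, Γ.norm_curvature_le (Ico_subset_Icc_self hy)⟩
    have hd := Γ.hasDerivWithinAt_tangent_Ici hy
    have hd2 : HasDerivWithinAt (fun y => Γ.tangent (y - n * Γ.L))
        (iteratedDerivWithin 2 Γ.γ (Icc 0 Γ.L) (x - n * Γ.L)) (Ici x) x :=
      by
        have := hd.scomp x ((hasDerivWithinAt_id x (Ici x)).sub_const (n * Γ.L))
          (fun y hy' => sub_le_sub_right hy' _)
        simpa using! this
    refine hd2.congr_of_eventuallyEq ?_ ?_
    · have : Ico x (n * Γ.L + Γ.L) ∈ 𝓝[≥] x := Ico_mem_nhdsGE h2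
      filter_upwards [this] with y hy'
      rw [← hper' n y, hIco]
      exact ⟨by linarith [hy'.1], by linarith [hy'.2]⟩
    · rw [← hper' n x, hIco _ hy]
  choose v hv hvK using hder
  have hle : ∀ s t, s ≤ t → ‖T t - T s‖ ≤ Γ.maxCurvature * (t - s) := fun s t hst =>
    norm_image_sub_le_of_norm_deriv_right_le_segment hTc.continuousOn
      (fun x _ => hv x) (fun x _ => hvK x) t ⟨hst, le_rfl⟩
  refine ⟨T, fun s t => ?_, hIcc, hper⟩
  rcases le_total s t with hst | hst
  · rw [norm_sub_rev, abs_sub_comm, abs_of_nonneg (by linarith : (0 : ℝ) ≤ t - s)]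
    exact hle s t hst
  · rw [abs_of_nonneg (by linarith : (0 : ℝ) ≤ s - t)]
    exact hle t s hst

/-- A curve is part of a `C^{1,1}` parameterized curve over the line, periodic if `Γ` is closed. -/
lemma exists_extension : ∃ P T : ℝ → Plane, (∀ s, HasDerivAt P (T s) s) ∧
    (∀ s t, ‖T s - T t‖ ≤ Γ.maxCurvature * |s - t|) ∧ (∀ s ∈ Icc 0 Γ.L, P s = Γ.γ s) ∧
    (∀ s ∈ Icc 0 Γ.L, T s = Γ.tangent s) ∧ (Γ.γ 0 = Γ.γ Γ.L → ∀ s, P (s + Γ.L) = P s) := by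
  obtain ⟨T, hLip, hT, hper⟩ : ∃ T : ℝ → Plane,
      (∀ s t, ‖T s - T t‖ ≤ Γ.maxCurvature * |s - t|) ∧ (∀ s ∈ Icc 0 Γ.L, T s = Γ.tangent s) ∧
      (Γ.γ 0 = Γ.γ Γ.L → ∀ s, T (s + Γ.L) = T s) := by
    by_cases h : Γ.γ 0 = Γ.γ Γ.L
    · obtain ⟨T, h1, h2, h3⟩ := Γ.exists_extension_of_eq h
      exact ⟨T, h1, h2, fun _ => h3⟩
    · obtain ⟨T, h1, h2⟩ := Γ.exists_tangent_extension
      exact ⟨T, h1, h2, fun h' => absurd h' h⟩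
  have hc : Continuous T := by
    have : LipschitzWith (Real.toNNReal Γ.maxCurvature) T := by
      refine LipschitzWith.of_dist_le_mul fun s t => ?_
      rw [dist_eq_norm, Real.dist_eq, Real.coe_toNNReal _ Γ.maxCurvature_nonneg]
      exact hLip s t
    exact this.continuous
  have hP : ∀ s, HasDerivAt (fun s => Γ.γ 0 + ∫ x in (0 : ℝ)..s, T x) (T s) s := fun s =>
    (hc.integral_hasStrictDerivAt 0 s).hasDerivAt.const_add _
  have heq : ∀ s ∈ Icc 0 Γ.L, Γ.γ 0 + ∫ x in (0 : ℝ)..s, T x = Γ.γ s := by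
    intro s hs
    have : ∫ x in (0 : ℝ)..s, T x = Γ.γ s - Γ.γ 0 := by
      refine intervalIntegral.integral_eq_sub_of_hasDerivAt_of_le hs.1
        (Γ.continuousOn_param.mono (Icc_subset_Icc_right hs.2)) (fun x hx => ?_)
        (hc.intervalIntegrable _ _)
      have hx' : x ∈ Ioo 0 Γ.L := ⟨hx.1, hx.2.trans_le hs.2⟩
      rw [hT x (Ioo_subset_Icc_self hx')]
      exact Γ.hasDerivAt_param hx'
    rw [this]; abel
  refine ⟨_, T, hP, hLip, heq, hT, fun h s => ?_⟩
  -- Periodicity of the primitive means that `T` has integral zero over a period; this is `γ 0 = γ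
  -- L`.
  have h0 : ∫ x in (0 : ℝ)..Γ.L, T x = 0 := by
    have := heq Γ.L Γ.length_mem
    rw [← h] at this
    simpa using this
  have hpT : Function.Periodic T Γ.L := hper h
  have h1 : ∫ x in s..(s + Γ.L), T x = 0 := by
    rw [hpT.intervalIntegral_add_eq s 0, zero_add, h0]
  have h2 : (∫ x in (0 : ℝ)..(s + Γ.L), T x) = (∫ x in (0 : ℝ)..s, T x) + ∫ x in s..(s + Γ.L), T x :=
    (intervalIntegral.integral_add_adjacent_intervals (hc.intervalIntegrable _ _)
      (hc.intervalIntegrable _ _)).symm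
  simp only [h2, h1, add_zero]

/-! ### The injectivity constant -/

/-- Each competing constant is at most the quotient of chord and arc for the given pair, hence so is
their supremum. -/
lemma chordArc_mul_le (η : ℝ → Plane) (m : ℝ) {s s' : ℝ} (hs : s ∈ Icc 0 Γ.L)
    (hs' : s' ∈ Icc 0 Γ.L) (h : |s - s'| ≤ m) :
    Γ.chordArc η m * |s - s'| ≤ ‖η s - η s'‖ := by
  rcases eq_or_ne s s' with rfl | hne
  · simp
  · have hpos : 0 < |s - s'| := abs_pos.2 (sub_ne_zero.2 hne)
    rw [← le_div_iff₀ hpos]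
    refine csSup_le ⟨0, fun s _ s' _ _ => by simp⟩ fun M hM => ?_
    rw [le_div_iff₀ hpos]
    exact hM s hs s' hs' h

lemma bddAbove_chordArc (η : ℝ → Plane) {m : ℝ} (hm : 0 < m) :
    BddAbove {M : ℝ | ∀ s ∈ Icc 0 Γ.L, ∀ s' ∈ Icc 0 Γ.L, |s - s'| ≤ m →
      M * |s - s'| ≤ ‖η s - η s'‖} := by
  have h0 : 0 < min m Γ.L := lt_min hm Γ.L_pos
  refine ⟨‖η (min m Γ.L) - η 0‖ / min m Γ.L, fun M hM => ?_⟩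
  rw [le_div_iff₀ h0]
  have := hM (min m Γ.L) ⟨h0.le, min_le_right _ _⟩ 0 Γ.zero_mem
    (by rw [sub_zero, abs_of_pos h0]; exact min_le_left _ _)
  rwa [sub_zero, abs_of_pos h0] at this

lemma chordArc_param_le_one {m : ℝ} (hm : 0 < m) : Γ.chordArc Γ.γ m ≤ 1 := by
  have h0 : 0 < min m Γ.L := lt_min hm Γ.L_pos
  have hmem : min m Γ.L ∈ Icc 0 Γ.L := ⟨h0.le, min_le_right _ _⟩
  have h1 := Γ.chordArc_mul_le Γ.γ m hmem Γ.zero_mem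
    (by rw [sub_zero, abs_of_pos h0]; exact min_le_left _ _)
  have h2 := Γ.norm_param_sub_le hmem Γ.zero_mem
  rw [sub_zero, abs_of_pos h0] at h1 h2
  nlinarith

/-- Near the diagonal the curve follows its tangent and chords are at least half as long as arcs;
away from it, injectivity and compactness give a positive minimum of the chord length. The shift `a`
is `0` for `γ` and `L / 2` for the shifted parameterization. -/
lemma chordArc_pos {P T : ℝ → Plane} {K m a : ℝ} (hP : ∀ s, HasDerivAt P (T s) s) (hK : 0 ≤ K)
    (hT : ∀ s t, ‖T s - T t‖ ≤ K * |s - t|) (η : ℝ → Plane)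
    (hη : ∀ s ∈ Icc 0 Γ.L, η s = P (s + a)) (hunit : ∀ s ∈ Icc 0 Γ.L, ‖T (s + a)‖ = 1)
    (hm : 0 < m) (hinj : ∀ s ∈ Icc 0 Γ.L, ∀ s' ∈ Icc 0 Γ.L, |s - s'| ≤ m → η s = η s' → s = s') :
    0 < Γ.chordArc η m := by
  have hPc : Continuous P := continuous_iff_continuousAt.2 fun s => (hP s).continuousAt
  -- Chosen so that `K δ ≤ 1/2`: the deviation from the tangent is then at most half of the arc.
  set δ : ℝ := 1 / (2 * (K + 1)) with hδ
  have hδpos : 0 < δ := by positivity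
  have hloc : ∀ s ∈ Icc 0 Γ.L, ∀ s' ∈ Icc 0 Γ.L, |s - s'| ≤ δ → 1 / 2 * |s - s'| ≤ ‖η s - η s'‖ := by
    intro s hs s' hs' h
    have h1 := norm_sub_sub_smul_le hP hK hT (s' + a) (s - s')
    rw [show s' + a + (s - s') = s + a by ring, ← hη s hs, ← hη s' hs'] at h1
    have h2 : ‖(s - s') • T (s' + a)‖ = |s - s'| := by
      rw [norm_smul, hunit s' hs', mul_one, Real.norm_eq_abs]
    have h3 := norm_sub_norm_le ((s - s') • T (s' + a)) (η s - η s')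
    rw [h2, norm_sub_rev ((s - s') • T (s' + a))] at h3
    have h4 : K * (s - s') ^ 2 ≤ 1 / 2 * |s - s'| := by
      rw [← sq_abs, sq, ← mul_assoc]
      gcongr
      calc K * |s - s'| ≤ K * δ := by gcongr
        _ ≤ 1 / 2 := by
          rw [hδ, mul_one_div, div_le_div_iff₀ (by positivity) (by norm_num)]; linarith
    linarith
  set C : Set (ℝ × ℝ) := (Icc 0 Γ.L ×ˢ Icc 0 Γ.L) ∩ {p | δ ≤ |p.1 - p.2| ∧ |p.1 - p.2| ≤ m} with hC
  have hCc : IsCompact C := by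
    refine (isCompact_Icc.prod isCompact_Icc).inter_right ?_
    have hc : Continuous fun p : ℝ × ℝ => |p.1 - p.2| := by fun_prop
    exact (isClosed_le continuous_const hc).inter (isClosed_le hc continuous_const)
  obtain ⟨c, hc, hcC⟩ : ∃ c > 0, ∀ p ∈ C, c ≤ ‖η p.1 - η p.2‖ := by
    rcases C.eq_empty_or_nonempty with he | hne
    · exact ⟨1, one_pos, fun p hp => by simp [he] at hp⟩
    · obtain ⟨p, hp, hmin⟩ := hCc.exists_isMinOn hne
        (f := fun p : ℝ × ℝ => ‖P (p.1 + a) - P (p.2 + a)‖) (by fun_prop)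
      refine ⟨‖η p.1 - η p.2‖, ?_, fun q hq => ?_⟩
      · rw [gt_iff_lt, norm_pos_iff, sub_ne_zero]
        intro h
        have := hinj _ hp.1.1 _ hp.1.2 hp.2.2 h
        have h' := hp.2.1
        rw [this] at h'
        simp at h'
        linarith
      · rw [hη _ hp.1.1, hη _ hp.1.2, hη _ hq.1.1, hη _ hq.1.2]
        exact hmin hq
  have hmem : min (1 / 2) (c / m) ≤ Γ.chordArc η m := by
    refine le_csSup (Γ.bddAbove_chordArc η hm) fun s hs s' hs' h => ?_
    rcases le_total (|s - s'|) δ with h' | h'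
    · refine le_trans ?_ (hloc s hs s' hs' h')
      gcongr
      exact min_le_left _ _
    · refine le_trans ?_ (hcC (s, s') ⟨⟨hs, hs'⟩, h', h⟩)
      calc min (1 / 2) (c / m) * |s - s'| ≤ c / m * m := by
            gcongr
            exact min_le_right _ _
        _ = c := by field_simp
  exact lt_of_lt_of_le (by positivity) hmem

lemma injOn_half {s s' : ℝ} (hs : s ∈ Icc 0 Γ.L) (hs' : s' ∈ Icc 0 Γ.L)
    (hm : |s - s'| ≤ Γ.L / 2) (he : Γ.γ s = Γ.γ s') : s = s' := by
  have hL := Γ.L_pos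
  by_contra hne
  rcases lt_or_gt_of_ne hne with hlt | hlt
  · obtain ⟨h1, h2⟩ := Γ.simple s hs s' hs' hlt he
    rw [h1, h2, zero_sub, abs_neg, abs_of_pos hL] at hm
    linarith
  · obtain ⟨h1, h2⟩ := Γ.simple s' hs' s hs hlt he.symm
    rw [h1, h2, sub_zero, abs_of_pos hL] at hm
    linarith

lemma injConst_pos : 0 < Γ.injConst := by
  classical
  obtain ⟨P, T, hP, hT, hPγ, hTγ, hper⟩ := Γ.exists_extension
  have hK := Γ.maxCurvature_nonneg
  have hL := Γ.L_pos
  unfold injConst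
  split_ifs with h
  · refine lt_min ?_ ?_
    · refine Γ.chordArc_pos (a := 0) hP hK hT Γ.γ (fun s hs => by rw [add_zero, hPγ s hs])
        (fun s hs => by rw [add_zero, hTγ s hs, Γ.norm_tangent hs]) (by linarith) ?_
      intro s hs s' hs' hm he
      exact Γ.injOn_half hs hs' hm he
    · have hTper : ∀ s, T (s + Γ.L) = T s := fun s => by
        have h1 : HasDerivAt (fun x => P (x + Γ.L)) (T (s + Γ.L)) s :=
          (hP (s + Γ.L)).comp_add_const s Γ.L
        simp only [hper h] at h1
        exact h1.unique (hP s)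
      have hshift : ∀ s ∈ Icc 0 Γ.L, Γ.shifted s = P (s + Γ.L / 2) := by
        intro s hs
        unfold shifted
        split_ifs with hlt
        · rw [hPγ _ ⟨by linarith [hs.1], by linarith⟩]
        · rw [← hPγ _ ⟨by linarith, by linarith [hs.2]⟩, ← hper h]
          congr 1; ring
      refine Γ.chordArc_pos (a := Γ.L / 2) hP hK hT Γ.shifted hshift ?_ (by linarith) ?_
      · intro s hs
        rcases le_total (s + Γ.L / 2) Γ.L with h' | h'
        · have hmem : s + Γ.L / 2 ∈ Icc 0 Γ.L := ⟨by linarith [hs.1], h'⟩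
          rw [hTγ _ hmem, Γ.norm_tangent hmem]
        · have hmem : s - Γ.L / 2 ∈ Icc 0 Γ.L := ⟨by linarith [hs.1], by linarith [hs.2]⟩
          rw [show s + Γ.L / 2 = s - Γ.L / 2 + Γ.L by ring, hTper, hTγ _ hmem, Γ.norm_tangent hmem]
      · intro s hs s' hs' hm he
        have hm' := abs_le.1 hm
        unfold shifted at he
        split_ifs at he with h1 h2 h2
        · have := Γ.injOn_half (s := s + Γ.L / 2) (s' := s' + Γ.L / 2)
            ⟨by linarith [hs.1], by linarith⟩ ⟨by linarith [hs'.1], by linarith⟩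
            (by rwa [add_sub_add_right_eq_sub]) he
          linarith
        · obtain ⟨h3, h4⟩ := Γ.simple (s' - Γ.L / 2) ⟨by linarith, by linarith [hs'.2]⟩
            (s + Γ.L / 2) ⟨by linarith [hs.1], by linarith⟩ (by linarith [hs'.2, hs.1]) he.symm
          linarith
        · obtain ⟨h3, h4⟩ := Γ.simple (s - Γ.L / 2) ⟨by linarith, by linarith [hs.2]⟩
            (s' + Γ.L / 2) ⟨by linarith [hs'.1], by linarith⟩ (by linarith [hs'.1, hs.2]) he
          linarith
        · have := Γ.injOn_half (s := s - Γ.L / 2) (s' := s' - Γ.L / 2)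
            ⟨by linarith, by linarith [hs.2]⟩ ⟨by linarith, by linarith [hs'.2]⟩
            (by rwa [sub_sub_sub_cancel_right]) he
          linarith
  · refine Γ.chordArc_pos (a := 0) hP hK hT Γ.γ (fun s hs => by rw [add_zero, hPγ s hs])
      (fun s hs => by rw [add_zero, hTγ s hs, Γ.norm_tangent hs]) hL ?_
    intro s hs s' hs' _ he
    by_contra hne
    rcases lt_or_gt_of_ne hne with hlt | hlt
    · obtain ⟨h1, h2⟩ := Γ.simple s hs s' hs' hlt he
      exact h (by rw [← h1, ← h2, he])
    · obtain ⟨h1, h2⟩ := Γ.simple s' hs' s hs hlt he.symm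
      exact h (by rw [← h1, ← h2, he])

lemma injConst_le_one : Γ.injConst ≤ 1 := by
  unfold injConst
  split_ifs
  · exact (min_le_left _ _).trans (Γ.chordArc_param_le_one (by linarith [Γ.L_pos]))
  · exact Γ.chordArc_param_le_one Γ.L_pos

lemma injConst_mul_le_of_le_half {s s' : ℝ} (hs : s ∈ Icc 0 Γ.L) (hs' : s' ∈ Icc 0 Γ.L)
    (h : |s - s'| ≤ Γ.L / 2) : Γ.injConst * |s - s'| ≤ ‖Γ.γ s - Γ.γ s'‖ := by
  unfold injConst
  split_ifs
  · refine le_trans ?_ (Γ.chordArc_mul_le Γ.γ _ hs hs' h)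
    gcongr
    exact min_le_left _ _
  · exact Γ.chordArc_mul_le Γ.γ _ hs hs' (by linarith [Γ.L_pos])

/-- Moving the starting point by `L / 2` turns parameters more than `L / 2` apart into parameters at
distance `L - (s - s') < L / 2`. -/
lemma injConst_mul_le_of_half_lt (hcl : Γ.γ 0 = Γ.γ Γ.L) {s s' : ℝ} (hs : s ∈ Icc 0 Γ.L)
    (hs' : s' ∈ Icc 0 Γ.L) (h : Γ.L / 2 < s - s') :
    Γ.injConst * (Γ.L - (s - s')) ≤ ‖Γ.γ s - Γ.γ s'‖ := by
  have e1 : Γ.shifted (s - Γ.L / 2) = Γ.γ s := by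
    unfold shifted
    split_ifs with h1
    · congr 1; ring
    -- The second branch of `shifted` can occur only at `s = L`, where it yields `γ 0`.
    · have hsL : s = Γ.L := by linarith [hs.2]
      rw [hsL, ← hcl]; congr 1; ring
  have e2 : Γ.shifted (s' + Γ.L / 2) = Γ.γ s' := by
    unfold shifted
    rw [if_neg (by linarith [hs'.1])]
    congr 1; ring
  have hh : |s - Γ.L / 2 - (s' + Γ.L / 2)| = Γ.L - (s - s') := by
    rw [abs_sub_comm, abs_of_nonneg (by linarith [hs.2, hs'.1])]; ring
  have := Γ.chordArc_mul_le Γ.shifted (Γ.L / 2) (s := s - Γ.L / 2) (s' := s' + Γ.L / 2)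
    ⟨by linarith [hs'.1], by linarith [hs.2, Γ.L_pos]⟩
    ⟨by linarith [hs'.1, Γ.L_pos], by linarith [hs.2]⟩ (by rw [hh]; linarith)
  rw [hh, e1, e2] at this
  refine le_trans ?_ this
  unfold injConst
  rw [if_pos hcl]
  have h3 : 0 ≤ Γ.L - (s - s') := by linarith [hs.2, hs'.1]
  gcongr
  exact min_le_right _ _

/-- The chord-arc inequality in terms of the arc length distance. -/
lemma injConst_mul_min_le {s s' : ℝ} (hs : s ∈ Icc 0 Γ.L) (hs' : s' ∈ Icc 0 Γ.L) :
    Γ.injConst * min |s - s'| (Γ.L - |s - s'|) ≤ ‖Γ.γ s - Γ.γ s'‖ := by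
  have hM := Γ.injConst_pos
  rcases le_or_gt |s - s'| (Γ.L / 2) with h | h
  · refine le_trans ?_ (Γ.injConst_mul_le_of_le_half hs hs' h)
    gcongr
    exact min_le_left _ _
  by_cases hcl : Γ.γ 0 = Γ.γ Γ.L
  · refine le_trans (mul_le_mul_of_nonneg_left (min_le_right _ _) hM.le) ?_
    rcases le_total s s' with hle | hle
    · rw [abs_sub_comm, abs_of_nonneg (by linarith)] at h ⊢
      rw [norm_sub_rev]
      exact Γ.injConst_mul_le_of_half_lt hcl hs' hs h
    · rw [abs_of_nonneg (by linarith)] at h ⊢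
      exact Γ.injConst_mul_le_of_half_lt hcl hs hs' h
  · refine le_trans (mul_le_mul_of_nonneg_left (min_le_left _ _) hM.le) ?_
    unfold injConst
    rw [if_neg hcl]
    exact Γ.chordArc_mul_le Γ.γ _ hs hs'
      (abs_sub_le_of_nonneg_of_le hs.1 hs.2 hs'.1 hs'.2)

/-- Quantitative tangent approximation at a point of the curve. -/
lemma exists_tangent_approx {s s' : ℝ} (hs : s ∈ Icc 0 Γ.L) (hs' : s' ∈ Icc 0 Γ.L) :
    ∃ t : ℝ, Γ.injConst * |t| ≤ ‖Γ.γ s - Γ.γ s'‖ ∧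
      ‖Γ.γ s' - Γ.γ s - t • Γ.tangent s‖ ≤ Γ.maxCurvature * t ^ 2 := by
  obtain ⟨P, T, hP, hT, hPγ, hTγ, hper⟩ := Γ.exists_extension
  have hK := Γ.maxCurvature_nonneg
  have key := norm_sub_sub_smul_le hP hK hT s
  rw [hTγ s hs, hPγ s hs] at key
  have hM := Γ.injConst_pos
  have hmin := Γ.injConst_mul_min_le hs hs'
  by_cases h : Γ.injConst * |s - s'| ≤ ‖Γ.γ s - Γ.γ s'‖
  · refine ⟨s' - s, by rwa [abs_sub_comm], ?_⟩
    have := key (s' - s)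
    rwa [show s + (s' - s) = s' by ring, hPγ s' hs'] at this
  · have hcl : Γ.γ 0 = Γ.γ Γ.L := by
      by_contra hcl
      apply h
      unfold injConst
      rw [if_neg hcl]
      exact Γ.chordArc_mul_le Γ.γ _ hs hs' (abs_sub_le_of_nonneg_of_le hs.1 hs.2 hs'.1 hs'.2)
    have hd : Γ.injConst * (Γ.L - |s - s'|) ≤ ‖Γ.γ s - Γ.γ s'‖ := by
      rcases le_total |s - s'| (Γ.L - |s - s'|) with h' | h'
      · rw [min_eq_left h'] at hmin; exact absurd hmin h
      · rwa [min_eq_right h'] at hmin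
    rcases le_total s s' with hle | hle
    -- The short way from `s` to `s'` runs backwards through the starting point of the closed curve.
    · refine ⟨s' - s - Γ.L, ?_, ?_⟩
      · rw [abs_sub_comm s s', abs_of_nonneg (by linarith)] at hd
        rw [abs_sub_comm, abs_of_nonneg (by linarith [hs.1, hs'.2])]
        exact hd
      · have := key (s' - s - Γ.L)
        rwa [← hper hcl, show s + (s' - s - Γ.L) + Γ.L = s' by ring, hPγ s' hs'] at this
    · refine ⟨s' - s + Γ.L, ?_, ?_⟩
      · rw [abs_of_nonneg (by linarith)] at hd
        rw [abs_of_nonneg (by linarith [hs'.1, hs.2])]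
        convert hd using 2; ring
      · have := key (s' - s + Γ.L)
        rwa [show s + (s' - s + Γ.L) = s' + Γ.L by ring, hper hcl, hPγ s' hs'] at this

end PlaneCurve

end

section

namespace PlaneCurve

variable (Γ : PlaneCurve)

/-! ### The arc length measure -/

lemma aemeasurable_param : AEMeasurable Γ.γ (volume.restrict (Icc 0 Γ.L)) :=
  Γ.continuousOn_param.aemeasurable measurableSet_Icc

lemma lintegral_sigma {f : Plane → ENNReal} (hf : AEMeasurable f Γ.sigma) :
    ∫⁻ x, f x ∂Γ.sigma = ∫⁻ s in Icc 0 Γ.L, f (Γ.γ s) :=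
  lintegral_map' hf Γ.aemeasurable_param

lemma sigma_univ : Γ.sigma univ = ENNReal.ofReal Γ.L := by
  rw [sigma, Measure.map_apply_of_aemeasurable Γ.aemeasurable_param MeasurableSet.univ]
  simp

instance : IsFiniteMeasure Γ.sigma := ⟨by rw [sigma_univ]; exact ENNReal.ofReal_lt_top⟩

lemma isCompact_carrier : IsCompact Γ.carrier :=
  isCompact_Icc.image_of_continuousOn Γ.continuousOn_param

lemma ae_mem_carrier : ∀ᵐ x ∂Γ.sigma, x ∈ Γ.carrier := by
  refine (ae_map_iff Γ.aemeasurable_param Γ.isCompact_carrier.measurableSet).2 ?_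
  filter_upwards [ae_restrict_mem measurableSet_Icc] with s hs
  exact mem_image_of_mem _ hs

/-- `γ s₀` is a point of the curve nearest to `x`, so `‖γ s - γ s₀‖ ≤ 2 ‖x - γ s‖`; this costs the
factor `1/2`. -/
lemma exists_param_dist (x : Plane) : ∃ s₀ ∈ Icc 0 Γ.L, ∀ s ∈ Icc 0 Γ.L,
    Γ.injConst / 2 * min |s - s₀| (Γ.L - |s - s₀|) ≤ ‖x - Γ.γ s‖ := by
  obtain ⟨s₀, hs₀, hmin⟩ := isCompact_Icc.exists_isMinOn (nonempty_Icc.2 Γ.L_pos.le)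
    (f := fun s => ‖x - Γ.γ s‖) (continuousOn_const.sub Γ.continuousOn_param).norm
  refine ⟨s₀, hs₀, fun s hs => ?_⟩
  have h1 := Γ.injConst_mul_min_le hs hs₀
  have h2 : ‖x - Γ.γ s₀‖ ≤ ‖x - Γ.γ s‖ := hmin hs
  have h3 : ‖Γ.γ s - Γ.γ s₀‖ ≤ ‖x - Γ.γ s₀‖ + ‖x - Γ.γ s‖ := by
    have := norm_sub_le (x - Γ.γ s₀) (x - Γ.γ s)
    rwa [sub_sub_sub_cancel_left] at this
  linarith

/-- Integrals of decreasing functions of the distance, with respect to the arc length measure. -/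
lemma lintegral_antitone_le {F : ℝ → ENNReal} (hF : Antitone F) (x : Plane) :
    ∫⁻ z, F ‖x - z‖ ∂Γ.sigma ≤ 4 * ∫⁻ τ in Icc 0 Γ.L, F (Γ.injConst / 2 * τ) := by
  have hFm : Measurable F := hF.measurable
  have hM := Γ.injConst_pos
  rw [Γ.lintegral_sigma (by fun_prop)]
  obtain ⟨s₀, hs₀, h⟩ := Γ.exists_param_dist x
  set c := Γ.injConst / 2 with hc
  have hc0 : 0 < c := by positivity
  set g : ℝ → ENNReal := (Icc 0 Γ.L).indicator fun τ => F (c * τ) with hg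
  have hgm : Measurable g := (by fun_prop : Measurable fun τ => F (c * τ)).indicator measurableSet_Icc
  have hgI : ∫⁻ τ, g τ = ∫⁻ τ in Icc 0 Γ.L, F (c * τ) := lintegral_indicator measurableSet_Icc _
  have hgeq : ∀ τ, 0 ≤ τ → τ ≤ Γ.L → F (c * τ) = g τ := fun τ h0 h1 => by
    rw [hg, indicator_of_mem (show τ ∈ Icc 0 Γ.L from ⟨h0, h1⟩)]
  -- The minimum is `|s - s₀|` or `L - |s - s₀|`, and `s` lies before or after `s₀`. In each of the
  -- four cases it is a translate or a reflection of `s`, whence the factor `4`.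
  have hpt : ∀ s ∈ Icc 0 Γ.L, F ‖x - Γ.γ s‖ ≤
      (g (s - s₀) + g (s₀ - s)) + (g (Γ.L + s₀ - s) + g (s - (s₀ - Γ.L))) := by
    intro s hs
    have habs : |s - s₀| ≤ Γ.L := abs_sub_le_of_nonneg_of_le hs.1 hs.2 hs₀.1 hs₀.2
    have h1 : F ‖x - Γ.γ s‖ ≤ F (c * min |s - s₀| (Γ.L - |s - s₀|)) := hF (h s hs)
    refine h1.trans ?_
    rcases le_total s s₀ with hle | hle
    · have e : |s - s₀| = s₀ - s := by rw [abs_sub_comm, abs_of_nonneg (by linarith)]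
      rw [e] at habs ⊢
      rcases le_total (s₀ - s) (Γ.L - (s₀ - s)) with h' | h'
      · rw [min_eq_left h', hgeq _ (by linarith) habs]
        exact le_add_right le_add_self
      · rw [min_eq_right h', hgeq _ (by linarith) (by linarith),
          show Γ.L - (s₀ - s) = s - (s₀ - Γ.L) by ring]
        exact le_add_left le_add_self
    · have e : |s - s₀| = s - s₀ := by rw [abs_of_nonneg (by linarith)]
      rw [e] at habs ⊢
      rcases le_total (s - s₀) (Γ.L - (s - s₀)) with h' | h'
      · rw [min_eq_left h', hgeq _ (by linarith) habs]
        exact le_add_right le_self_add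
      · rw [min_eq_right h', hgeq _ (by linarith) (by linarith),
          show Γ.L - (s - s₀) = Γ.L + s₀ - s by ring]
        exact le_add_left le_self_add
  calc ∫⁻ s in Icc 0 Γ.L, F ‖x - Γ.γ s‖
      ≤ ∫⁻ s in Icc 0 Γ.L,
        ((g (s - s₀) + g (s₀ - s)) + (g (Γ.L + s₀ - s) + g (s - (s₀ - Γ.L)))) :=
        setLIntegral_mono' measurableSet_Icc hpt
    _ ≤ ∫⁻ s, ((g (s - s₀) + g (s₀ - s)) + (g (Γ.L + s₀ - s) + g (s - (s₀ - Γ.L)))) :=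
        setLIntegral_le_lintegral _ _
    _ = 4 * ∫⁻ τ in Icc 0 Γ.L, F (c * τ) := by
        rw [lintegral_add_left (by fun_prop), lintegral_add_left (by fun_prop),
          lintegral_add_left (by fun_prop), lintegral_sub_right_eq_self,
          lintegral_sub_left_eq_self, lintegral_sub_left_eq_self, lintegral_sub_right_eq_self, hgI]
        ring

/-- Half of the curve has a chord of length at least `M L / 2`, and a chord is at most a diameter `2
r`. -/
lemma injConst_mul_length_le {x₀ : Plane} {r : ℝ} (h : Γ.carrier ⊆ Metric.closedBall x₀ r) :
    Γ.injConst * Γ.L ≤ 4 * r := by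
  have hL := Γ.L_pos
  have hmem : Γ.L / 2 ∈ Icc 0 Γ.L := ⟨by linarith, by linarith⟩
  have h1 := Γ.injConst_mul_le_of_le_half hmem Γ.zero_mem
    (by rw [sub_zero, abs_of_pos (by linarith)])
  rw [sub_zero, abs_of_pos (by linarith)] at h1
  have h2 := h (mem_image_of_mem Γ.γ hmem)
  have h3 := h (mem_image_of_mem Γ.γ Γ.zero_mem)
  have h4 := dist_triangle_right (Γ.γ (Γ.L / 2)) (Γ.γ 0) x₀
  rw [Metric.mem_closedBall] at h2 h3
  rw [← dist_eq_norm] at h1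
  linarith

/-! ### The logarithmic bound -/

lemma norm_smul_sub_smul_ge {e v : Plane} (he : ‖e‖ = 1) (hv : ‖v‖ = 1) (d t : ℝ) :
    (1 - |inner ℝ e v|) * (d ^ 2 + t ^ 2) ≤ ‖d • e - t • v‖ ^ 2 := by
  rw [norm_sub_sq_real, norm_smul, norm_smul, he, hv, inner_smul_left, inner_smul_right]
  simp only [mul_one, Real.norm_eq_abs, sq_abs, conj_trivial]
  have h1 : 2 * (d * (t * inner ℝ e v)) ≤ |inner ℝ e v| * (d ^ 2 + t ^ 2) := by
    have h2 : 2 * |d * t| ≤ d ^ 2 + t ^ 2 := by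
      rw [abs_mul, ← sq_abs d, ← sq_abs t]
      nlinarith [sq_nonneg (|d| - |t|)]
    have h3 : d * (t * inner ℝ e v) ≤ |d * t| * |inner ℝ e v| := by
      rw [← abs_mul, mul_assoc]; exact le_abs_self _
    nlinarith [abs_nonneg (inner ℝ e v : ℝ)]
  linarith

lemma IsAdmissible.dist_pos {Γ : PlaneCurve} {e y : Plane} {s d : ℝ}
    (h : Γ.IsAdmissible e y s d) : 0 < d := by
  rcases eq_or_lt_of_le h.first_hit.1.1 with h0 | h0
  · have := h.first_hit.1.2
    rw [← h0, zero_smul, sub_zero] at this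
    exact absurd this h.notMem
  · exact h0

/-- A point `γ s'` closer to `y` than `d / 4` would have arc length distance `|t| ≤ 5d/(4M)` from
the point hit by the ray. By the choice of `δ₀` the curve leaves its tangent line there by at most
`(5/32)(1 - c)|t|`, where `c = |cos θ|`. The point of the tangent line at parameter `t`, however,
has squared distance at least `(1 - c)(d² + t²)` from `y`, which is too much. -/
lemma IsAdmissible.le_norm {Γ : PlaneCurve} {e y : Plane} {s d : ℝ} (h : Γ.IsAdmissible e y s d)
    (hc : |inner ℝ e (Γ.tangent s)| ≤ √3 / 2)
    (hd : d ≤ Γ.injConst * Γ.delta (inner ℝ e (Γ.tangent s)) / 2) {s' : ℝ}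
    (hs' : s' ∈ Icc 0 Γ.L) : d / 4 ≤ ‖y - Γ.γ s'‖ := by
  have hdpos := h.dist_pos
  have hM := Γ.injConst_pos
  have hM1 := Γ.injConst_le_one
  have hK := Γ.maxCurvature_nonneg
  set c := |inner ℝ e (Γ.tangent s)| with hcdef
  -- The final comparison needs `1 - c > 1/8 = 2 (1/4)²`.
  have hc1 : c < 7 / 8 := by
    have : √3 < 7 / 4 := by rw [Real.sqrt_lt' (by norm_num)]; norm_num
    linarith
  have hc0 : 0 ≤ c := abs_nonneg _
  by_contra! hlt
  obtain ⟨t, ht1, ht2⟩ := Γ.exists_tangent_approx h.param_mem hs'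
  have hy : Γ.γ s = y - d • e := h.hit_eq
  have hde : ‖d • e‖ = d := by rw [norm_smul, h.norm_dir, mul_one, Real.norm_of_nonneg hdpos.le]
  have h1 : ‖Γ.γ s - Γ.γ s'‖ ≤ d / 4 + d := by
    have : Γ.γ s - Γ.γ s' = (y - Γ.γ s') - d • e := by rw [hy]; abel
    rw [this]
    exact (norm_sub_le _ _).trans (by rw [hde]; linarith)
  have hMt : Γ.injConst * |t| ≤ 5 / 4 * d := by linarith
  have hδ : Γ.maxCurvature * |t| ≤ 5 / 32 * (1 - c) := by
    rcases eq_or_lt_of_le hK with h0 | h0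
    · rw [← h0, zero_mul]; nlinarith
    · have h2 : Γ.delta (inner ℝ e (Γ.tangent s)) ≤
          Γ.injConst / (2 * Γ.maxCurvature) * ((1 - c) / 2) := by
        unfold delta
        rw [if_neg h0.ne']
        exact min_le_right _ _
      have h3 : Γ.injConst * |t| ≤ 5 / 8 * (Γ.injConst *
          (Γ.injConst / (2 * Γ.maxCurvature) * ((1 - c) / 2))) := by
        have := mul_le_mul_of_nonneg_left h2 hM.le
        linarith
      have h4 : |t| ≤ 5 / 8 * (Γ.injConst / (2 * Γ.maxCurvature) * ((1 - c) / 2)) := by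
        refine le_of_mul_le_mul_left ?_ hM
        linarith
      calc Γ.maxCurvature * |t| ≤ Γ.maxCurvature *
            (5 / 8 * (Γ.injConst / (2 * Γ.maxCurvature) * ((1 - c) / 2))) := by gcongr
        _ = 5 / 32 * (1 - c) * Γ.injConst := by field_simp; ring
        _ ≤ 5 / 32 * (1 - c) * 1 := by
            refine mul_le_mul_of_nonneg_left hM1 (by linarith)
        _ = _ := mul_one _
  have hKt : Γ.maxCurvature * t ^ 2 ≤ 5 / 32 * (1 - c) * |t| := by
    rw [← sq_abs, sq, ← mul_assoc]
    exact mul_le_mul_of_nonneg_right hδ (abs_nonneg _)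
  have h5 : ‖d • e - t • Γ.tangent s‖ ≤ d / 4 + 5 / 32 * (1 - c) * |t| := by
    have : d • e - t • Γ.tangent s = (y - Γ.γ s') + (Γ.γ s' - Γ.γ s - t • Γ.tangent s) := by
      rw [hy]; abel
    rw [this]
    refine (norm_add_le _ _).trans ?_
    linarith
  have h6 := norm_smul_sub_smul_ge h.norm_dir (Γ.norm_tangent h.param_mem) d t
  rw [← hcdef] at h6
  have h7 : ‖d • e - t • Γ.tangent s‖ ^ 2 ≤ (d / 4 + 5 / 32 * (1 - c) * |t|) ^ 2 :=
    pow_le_pow_left₀ (norm_nonneg _) h5 2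
  rw [← sq_abs t] at h6
  have ht0 := abs_nonneg t
  have h8 : (d / 4 + 5 / 32 * (1 - c) * |t|) ^ 2 ≤
      2 * (d / 4) ^ 2 + 2 * (5 / 32 * (1 - c) * |t|) ^ 2 := by
    nlinarith [sq_nonneg (d / 4 - 5 / 32 * (1 - c) * |t|)]
  have h9 : (1 - c) ^ 2 * |t| ^ 2 ≤ (1 - c) * |t| ^ 2 := by
    have : (1 - c) ^ 2 ≤ 1 - c := by nlinarith
    gcongr
  nlinarith [mul_pos hdpos hdpos, sq_nonneg |t|]

lemma setLIntegral_inv_affine_le {a b l : ℝ} (ha : 0 < a) (hb : 0 < b) (hl : 0 ≤ l) :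
    ∫⁻ τ in Icc 0 l, ENNReal.ofReal (1 / (a + b * τ)) =
      ENNReal.ofReal (1 / b * Real.log ((a + b * l) / a)) := by
  have hpos : ∀ τ ∈ Icc 0 l, 0 < a + b * τ := fun τ hτ => by
    have := mul_nonneg hb.le hτ.1; linarith
  have hcont : ContinuousOn (fun τ => 1 / (a + b * τ)) (Icc 0 l) :=
    continuousOn_const.div (by fun_prop) fun τ hτ => (hpos τ hτ).ne'
  rw [← ofReal_integral_eq_lintegral_ofReal hcont.integrableOn_Icc
    ((ae_restrict_mem measurableSet_Icc).mono fun τ hτ => (one_div_pos.2 (hpos τ hτ)).le)]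
  congr 1
  rw [integral_Icc_eq_integral_Ioc, ← intervalIntegral.integral_of_le hl]
  have hder : ∀ τ ∈ uIcc 0 l, HasDerivAt (fun τ => 1 / b * Real.log (a + b * τ))
      (1 / (a + b * τ)) τ := by
    intro τ hτ
    rw [uIcc_of_le hl] at hτ
    have h1 : HasDerivAt (fun τ => a + b * τ) b τ := by
      simpa using ((hasDerivAt_id τ).const_mul b).const_add a
    have h2 := (h1.log (hpos τ hτ).ne').const_mul (1 / b)
    rwa [← mul_div_assoc, one_div_mul_cancel hb.ne'] at h2
  rw [intervalIntegral.integral_eq_sub_of_hasDerivAt hder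
    (by rw [← uIcc_of_le hl] at hcont; exact hcont.intervalIntegrable)]
  rw [mul_zero, add_zero, Real.log_div (hpos l ⟨hl, le_rfl⟩).ne' ha.ne']
  ring

lemma integral_sigma_le_of_lintegral_le {f : Plane → ℝ} {B : ℝ} (hf : ∀ x, 0 ≤ f x) (hB : 0 ≤ B)
    (h : ∫⁻ x, ENNReal.ofReal (f x) ∂Γ.sigma ≤ ENNReal.ofReal B) : ∫ x, f x ∂Γ.sigma ≤ B := by
  by_cases hm : AEStronglyMeasurable f Γ.sigma
  · rw [integral_eq_lintegral_of_nonneg_ae (Eventually.of_forall hf) hm]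
    exact ENNReal.toReal_le_of_le_ofReal hB h
  · rwa [integral_undef fun h => hm h.1]

/-- As `Γ` keeps the distance `d / 4` from `y`, the integrand may be replaced by the decreasing
function `1 / max (d / 4) r`, and the integral along the curve becomes elementary. The nonnegativity
in the second part is what allows larger constants afterwards. -/
lemma IsAdmissible.integral_le {Γ : PlaneCurve} {e y : Plane} {s d : ℝ}
    (h : Γ.IsAdmissible e y s d) (hc : |inner ℝ e (Γ.tangent s)| ≤ √3 / 2)
    (hd : d ≤ min 1 (Γ.injConst * Γ.delta (inner ℝ e (Γ.tangent s)) / 2)) :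
    1 / (2 * Real.pi) * ∫ x, 1 / ‖y - x‖ ∂Γ.sigma ≤
      16 / Γ.injConst * (2 + (Real.log Γ.L + |Real.log d|)) ∧
      0 ≤ Real.log Γ.L + |Real.log d| := by
  have hdpos := h.dist_pos
  have hM := Γ.injConst_pos
  have hM1 := Γ.injConst_le_one
  have hL := Γ.L_pos
  have hd1 : d ≤ 1 := hd.trans (min_le_left _ _)
  have hd2 := hd.trans (min_le_right _ _)
  set M := Γ.injConst with hMdef
  have hdML : d ≤ M * Γ.L / 4 := by
    have : Γ.delta (inner ℝ e (Γ.tangent s)) ≤ Γ.L / 2 := by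
      unfold delta
      split_ifs
      · exact le_rfl
      · exact min_le_left _ _
    nlinarith
  have hdL : d ≤ Γ.L / 4 := by nlinarith
  have hlog : |Real.log d| = - Real.log d := abs_of_nonpos (Real.log_nonpos hdpos.le hd1)
  have hlog' : Real.log Γ.L + |Real.log d| = Real.log (Γ.L / d) := by
    rw [hlog, Real.log_div hL.ne' hdpos.ne']; ring
  have hlog0 : 0 ≤ Real.log (Γ.L / d) :=
    Real.log_nonneg (by rw [le_div_iff₀ hdpos]; linarith)
  rw [hlog']
  refine ⟨?_, hlog0⟩
  have hle : ∫⁻ x, ENNReal.ofReal (1 / ‖y - x‖) ∂Γ.sigma ≤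
      ENNReal.ofReal (16 / M * (2 + Real.log (Γ.L / d))) := by
    set F : ℝ → ENNReal := fun r => ENNReal.ofReal (1 / max (d / 4) r) with hF
    have hFanti : Antitone F := by
      intro a b hab
      refine ENNReal.ofReal_le_ofReal ?_
      exact one_div_le_one_div_of_le (lt_max_of_lt_left (by linarith)) (max_le_max le_rfl hab)
    calc ∫⁻ x, ENNReal.ofReal (1 / ‖y - x‖) ∂Γ.sigma
        = ∫⁻ x, F ‖y - x‖ ∂Γ.sigma := by
          refine lintegral_congr_ae ?_
          filter_upwards [Γ.ae_mem_carrier] with x hx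
          obtain ⟨s', hs', rfl⟩ := hx
          simp only [hF]
          rw [max_eq_right (h.le_norm hc hd2 hs')]
      _ ≤ 4 * ∫⁻ τ in Icc 0 Γ.L, F (M / 2 * τ) := Γ.lintegral_antitone_le hFanti y
      _ ≤ 4 * ∫⁻ τ in Icc 0 Γ.L, ENNReal.ofReal (1 / (d / 8 + M / 4 * τ)) := by
          gcongr 4 * ?_
          refine setLIntegral_mono' measurableSet_Icc fun τ hτ => ENNReal.ofReal_le_ofReal ?_
          have h0 := mul_nonneg hM.le hτ.1
          refine one_div_le_one_div_of_le (by linarith) ?_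
          have h1 := le_max_left (d / 4) (M / 2 * τ)
          have h2 := le_max_right (d / 4) (M / 2 * τ)
          linarith
      _ = 4 * ENNReal.ofReal (1 / (M / 4) * Real.log ((d / 8 + M / 4 * Γ.L) / (d / 8))) := by
          rw [setLIntegral_inv_affine_le (by linarith) (by linarith) hL.le]
      _ ≤ 4 * ENNReal.ofReal (1 / (M / 4) * (2 + Real.log (Γ.L / d))) := by
          gcongr
          have h3 : (d / 8 + M / 4 * Γ.L) / (d / 8) ≤ 3 * (Γ.L / d) := by
            rw [div_le_iff₀ (by linarith)]
            field_simp
            nlinarith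
          calc Real.log ((d / 8 + M / 4 * Γ.L) / (d / 8)) ≤ Real.log (3 * (Γ.L / d)) :=
                Real.log_le_log (by positivity) h3
            _ = Real.log 3 + Real.log (Γ.L / d) :=
                Real.log_mul (by norm_num) (by positivity)
            _ ≤ 2 + Real.log (Γ.L / d) := by
                have := Real.log_le_sub_one_of_pos (show (0 : ℝ) < 3 by norm_num)
                linarith
      _ = ENNReal.ofReal (16 / M * (2 + Real.log (Γ.L / d))) := by
          rw [show (4 : ENNReal) = ENNReal.ofReal 4 by simp, ← ENNReal.ofReal_mul (by norm_num)]
          congr 1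
          field_simp
          norm_num
  have hint := Γ.integral_sigma_le_of_lintegral_le (fun x => by positivity) (by positivity) hle
  have hint0 : 0 ≤ ∫ x, 1 / ‖y - x‖ ∂Γ.sigma := integral_nonneg fun x => by positivity
  have hpi : 1 / (2 * Real.pi) ≤ 1 := by
    rw [div_le_one (by positivity)]; linarith [Real.pi_gt_three]
  calc 1 / (2 * Real.pi) * ∫ x, 1 / ‖y - x‖ ∂Γ.sigma ≤ 1 * ∫ x, 1 / ‖y - x‖ ∂Γ.sigma := by gcongr
    _ ≤ _ := by rwa [one_mul]

end PlaneCurve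

/-- The free parameter `A` is used in the main proof to make `c₄` dominate further constants. -/
lemma isLogBound_div {A : ℝ} (hA : 16 ≤ A) :
    IsLogBound (fun M _ => 2 * A / M) (fun M => A / M) := by
  intro Γ e y s d h hc hd
  obtain ⟨h1, h2⟩ := h.integral_le hc hd
  have hM := Γ.injConst_pos
  refine h1.trans ?_
  calc 16 / Γ.injConst * (2 + (Real.log Γ.L + |Real.log d|))
      ≤ A / Γ.injConst * (2 + (Real.log Γ.L + |Real.log d|)) := by gcongr
    _ = _ := by ring

end

section

/-! ### The Green function of `-Δ + κ²` in the plane -/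

/-- The heat kernel with killing rate `κ²` at time `t`, as a function of the squared distance. -/
def killedHeat (κ t q : ℝ) : ℝ := (4 * Real.pi * t)⁻¹ * Real.exp (-(κ ^ 2 * t) - q / (4 * t))

/-- The Green function of `-Δ + κ²` as a function of the squared distance. -/
def green (κ q : ℝ) : ℝ := ∫ t in Ioi (0 : ℝ), killedHeat κ t q

/-- The derivative of the Green function. -/
def greenDeriv (κ q : ℝ) : ℝ := ∫ t in Ioi (0 : ℝ), -((4 * t)⁻¹ * killedHeat κ t q)

lemma measurable_killedHeat (κ : ℝ) : Measurable fun p : ℝ × ℝ => killedHeat κ p.1 p.2 := by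
  unfold killedHeat; fun_prop

lemma measurable_killedHeat_left (κ q : ℝ) : Measurable fun t : ℝ => killedHeat κ t q := by
  unfold killedHeat; fun_prop

lemma killedHeat_pos {κ t q : ℝ} (ht : 0 < t) : 0 < killedHeat κ t q := by
  unfold killedHeat; positivity

lemma killedHeat_anti {κ t p q : ℝ} (ht : 0 < t) (hpq : p ≤ q) :
    killedHeat κ t q ≤ killedHeat κ t p := by
  unfold killedHeat; gcongr

lemma exp_neg_le_rpow {x b : ℝ} (hx : 0 < x) (hb : 0 ≤ b) (hb1 : b ≤ 1) :
    Real.exp (-x) ≤ x ^ (-b) := by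
  rw [Real.rpow_neg hx.le, Real.exp_neg]
  refine inv_anti₀ (by positivity) ?_
  calc x ^ b ≤ (1 + x) ^ b := by gcongr; linarith
    _ ≤ (1 + x) ^ (1 : ℝ) := Real.rpow_le_rpow_of_exponent_le (by linarith) hb1
    _ ≤ Real.exp x := by rw [Real.rpow_one]; linarith [Real.add_one_le_exp x]

lemma exp_neg_sq_le {x : ℝ} (hx : 0 < x) : Real.exp (-x) ≤ 2 / x ^ 2 := by
  rw [Real.exp_neg, ← one_div, div_le_div_iff₀ (Real.exp_pos _) (by positivity)]
  have := Real.quadratic_le_exp_of_nonneg hx.le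
  linarith

lemma integrableOn_exp_neg {κ : ℝ} (hκ : 0 < κ) :
    IntegrableOn (fun t => Real.exp (-(κ ^ 2 * t))) (Ioi 0) := by
  have := integrableOn_exp_mul_Ioi (a := -(κ ^ 2)) (by nlinarith) 0
  simpa [neg_mul] using this

lemma killedHeat_le {κ t q : ℝ} (ht : 0 < t) (hq : 0 < q) :
    killedHeat κ t q ≤ (Real.pi * q)⁻¹ * Real.exp (-(κ ^ 2 * t)) := by
  unfold killedHeat
  rw [sub_eq_add_neg, Real.exp_add]
  have h1 := exp_neg_le_rpow (x := q / (4 * t)) (by positivity) zero_le_one le_rfl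
  rw [Real.rpow_neg_one] at h1
  calc (4 * Real.pi * t)⁻¹ * (Real.exp (-(κ ^ 2 * t)) * Real.exp (-(q / (4 * t))))
      ≤ (4 * Real.pi * t)⁻¹ * (Real.exp (-(κ ^ 2 * t)) * (q / (4 * t))⁻¹) := by gcongr
    _ = _ := by field_simp

lemma integrableOn_killedHeat {κ q : ℝ} (hκ : 0 < κ) (hq : 0 < q) :
    IntegrableOn (fun t => killedHeat κ t q) (Ioi 0) := by
  refine Integrable.mono' ((integrableOn_exp_neg hκ).const_mul (Real.pi * q)⁻¹)
    (measurable_killedHeat_left κ q).aestronglyMeasurable ?_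
  filter_upwards [ae_restrict_mem measurableSet_Ioi] with t ht
  rw [Real.norm_of_nonneg (killedHeat_pos ht).le]
  exact killedHeat_le ht hq

lemma green_nonneg (κ q : ℝ) : 0 ≤ green κ q :=
  setIntegral_nonneg measurableSet_Ioi fun _ ht => (killedHeat_pos ht).le

lemma measurable_green (κ : ℝ) : Measurable (green κ) := by
  have h : StronglyMeasurable fun p : ℝ × ℝ => killedHeat κ p.2 p.1 :=
    ((measurable_killedHeat κ).comp measurable_swap).stronglyMeasurable
  exact (h.integral_prod_right (ν := volume.restrict (Ioi 0))).measurable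

lemma green_anti {κ p q : ℝ} (hκ : 0 < κ) (hp : 0 < p) (hpq : p ≤ q) : green κ q ≤ green κ p :=
  setIntegral_mono_on (integrableOn_killedHeat hκ (hp.trans_le hpq))
    (integrableOn_killedHeat hκ hp) measurableSet_Ioi fun _ ht => killedHeat_anti ht hpq

/-- The exponent `κ² t + r² / (4t)` is least at `t = r / (2κ)`. On the interval from there to twice
that time it is at most `3κr/2`; the length `r / (2κ)` of the interval cancels the prefactor. -/
lemma le_green {κ r : ℝ} (hκ : 0 < κ) (hr : 0 < r) :
    1 / (8 * Real.pi) * Real.exp (-(3 / 2 * (κ * r))) ≤ green κ (r ^ 2) := by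
  have hsub : Ioc (r / (2 * κ)) (r / κ) ⊆ Ioi 0 := fun t ht =>
    lt_trans (by positivity : (0 : ℝ) < r / (2 * κ)) ht.1
  have hle : r / (2 * κ) ≤ r / κ := by
    apply div_le_div_of_nonneg_left hr.le hκ; linarith
  have hint := integrableOn_killedHeat hκ (pow_pos hr 2)
  calc 1 / (8 * Real.pi) * Real.exp (-(3 / 2 * (κ * r)))
      = ∫ _ in Ioc (r / (2 * κ)) (r / κ),
          (4 * Real.pi * (r / κ))⁻¹ * Real.exp (-(3 / 2 * (κ * r))) := by
        rw [setIntegral_const, Real.volume_real_Ioc_of_le hle, smul_eq_mul]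
        field_simp
        ring
    _ ≤ ∫ t in Ioc (r / (2 * κ)) (r / κ), killedHeat κ t (r ^ 2) := by
        refine setIntegral_mono_on (integrableOn_const (by simp)) (hint.mono_set hsub)
          measurableSet_Ioc fun t ht => ?_
        have ht0 : 0 < t := hsub ht
        unfold killedHeat
        have h1 : κ ^ 2 * t ≤ κ * r := by
          have := (le_div_iff₀ hκ).1 ht.2
          nlinarith
        have h2 : r ^ 2 / (4 * t) ≤ κ * r / 2 := by
          rw [div_le_iff₀ (by positivity)]
          have := (div_lt_iff₀ (by positivity)).1 ht.1
          nlinarith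
        have h3 : Real.exp (-(3 / 2 * (κ * r))) ≤
            Real.exp (-(κ ^ 2 * t) - r ^ 2 / (4 * t)) := by
          apply Real.exp_le_exp.2; linarith
        have h4 : (4 * Real.pi * (r / κ))⁻¹ ≤ (4 * Real.pi * t)⁻¹ := by
          apply inv_anti₀ (by positivity)
          have := ht.2
          gcongr
        gcongr
    _ ≤ green κ (r ^ 2) := setIntegral_mono_set hint
        ((ae_restrict_mem measurableSet_Ioi).mono fun t ht => (killedHeat_pos ht).le)
        (Eventually.of_forall hsub)

lemma green_pos {κ q : ℝ} (hκ : 0 < κ) (hq : 0 < q) : 0 < green κ q := by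
  have := le_green hκ (Real.sqrt_pos.2 hq)
  rw [Real.sq_sqrt hq.le] at this
  exact lt_of_lt_of_le (by positivity) this

/-- The constant in the upper bound for the Green function. -/
def greenConst : ℝ := (4 * Real.pi)⁻¹ * 4 ^ (1 / 6 : ℝ) * Real.Gamma (1 / 6)

lemma greenConst_pos : 0 < greenConst := by
  unfold greenConst
  have := Real.Gamma_pos_of_pos (show (0 : ℝ) < 1 / 6 by norm_num)
  positivity

/-- The bound `exp(-x) ≤ x ^ (-1/6)` for `x = q / (4t)` leaves a Gamma integral. The logarithmic
singularity is replaced by the power `-1/3` of the distance, still integrable along a curve; this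
power leads to the square root of `κ / A` in `IsDistSolution.le_of_nonneg`. -/
lemma green_le {κ q : ℝ} (hκ : 0 < κ) (hq : 0 < q) :
    green κ q ≤ greenConst * (κ ^ 2 * q) ^ (-(1 / 6 : ℝ)) := by
  have hI := Real.integral_rpow_mul_exp_neg_mul_Ioi (a := 1 / 6) (r := κ ^ 2) (by norm_num)
    (by positivity)
  have hint : IntegrableOn (fun t : ℝ => t ^ ((1 / 6 : ℝ) - 1) * Real.exp (-(κ ^ 2 * t)))
      (Ioi 0) := by
    -- The integral of a nonintegrable function is `0` by convention, so a positive value proves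
    -- integrability.
    by_contra h
    rw [integral_undef h] at hI
    have := Real.Gamma_pos_of_pos (show (0 : ℝ) < 1 / 6 by norm_num)
    have : 0 < (1 / κ ^ 2) ^ (1 / 6 : ℝ) * Real.Gamma (1 / 6) := by positivity
    linarith
  have hpt : ∀ t ∈ Ioi (0 : ℝ), killedHeat κ t q ≤ (4 * Real.pi)⁻¹ * (4 / q) ^ (1 / 6 : ℝ) *
      (t ^ ((1 / 6 : ℝ) - 1) * Real.exp (-(κ ^ 2 * t))) := by
    intro t ht
    have ht0 : 0 < t := ht
    unfold killedHeat
    rw [sub_eq_add_neg, Real.exp_add]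
    have h1 := exp_neg_le_rpow (x := q / (4 * t)) (b := 1 / 6) (by positivity) (by norm_num)
      (by norm_num)
    have h2 : (q / (4 * t)) ^ (-(1 / 6 : ℝ)) = (4 / q) ^ (1 / 6 : ℝ) * t ^ (1 / 6 : ℝ) := by
      rw [Real.rpow_neg (by positivity), ← Real.inv_rpow (by positivity),
        ← Real.mul_rpow (by positivity) ht0.le]
      congr 1
      field_simp
    rw [h2] at h1
    rw [Real.rpow_sub ht0, Real.rpow_one]
    calc (4 * Real.pi * t)⁻¹ * (Real.exp (-(κ ^ 2 * t)) * Real.exp (-(q / (4 * t))))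
        ≤ (4 * Real.pi * t)⁻¹ * (Real.exp (-(κ ^ 2 * t)) *
          ((4 / q) ^ (1 / 6 : ℝ) * t ^ (1 / 6 : ℝ))) := by gcongr
      _ = _ := by field_simp
  calc green κ q ≤ ∫ t in Ioi (0 : ℝ), (4 * Real.pi)⁻¹ * (4 / q) ^ (1 / 6 : ℝ) *
      (t ^ ((1 / 6 : ℝ) - 1) * Real.exp (-(κ ^ 2 * t))) :=
        setIntegral_mono_on (integrableOn_killedHeat hκ hq) (hint.const_mul _) measurableSet_Ioi hpt
    _ = _ := by
        rw [integral_const_mul, hI, greenConst, Real.rpow_neg (by positivity),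
          Real.div_rpow (by norm_num) hq.le, Real.div_rpow (by norm_num) (by positivity),
          Real.mul_rpow (by positivity) hq.le, Real.one_rpow]
        field_simp

lemma integral_exp_neg_inv {q : ℝ} (hq : 0 < q) :
    IntegrableOn (fun t => q / (4 * t ^ 2) * Real.exp (-(q / (4 * t)))) (Ioi 0) ∧
    ∫ t in Ioi (0 : ℝ), q / (4 * t ^ 2) * Real.exp (-(q / (4 * t))) = 1 := by
  classical
  -- The integrand is the derivative of `exp(-q / (4t))`. At `t = 0` division by zero would give the
  -- value `1`; the limit is `0`.
  set f : ℝ → ℝ := Function.update (fun t => Real.exp (-(q / (4 * t)))) 0 0 with hf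
  have hf0 : f 0 = 0 := by simp [hf]
  have hinv : Tendsto (fun t : ℝ => q / (4 * t)) (𝓝[>] 0) atTop := by
    have : Tendsto (fun t : ℝ => q / 4 * t⁻¹) (𝓝[>] 0) atTop :=
      tendsto_inv_nhdsGT_zero.const_mul_atTop (by positivity)
    refine this.congr fun t => ?_
    rw [div_mul_eq_div_div, ← div_eq_mul_inv]
  have hcont : ContinuousWithinAt f (Ici 0) 0 := by
    rw [hf, continuousWithinAt_update_same, Ici_sdiff_left]
    exact Real.tendsto_exp_neg_atTop_nhds_zero.comp hinv
  have hder : ∀ t ∈ Ioi (0 : ℝ),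
      HasDerivAt f (q / (4 * t ^ 2) * Real.exp (-(q / (4 * t)))) t := by
    intro t ht
    have ht0 : (0 : ℝ) < t := ht
    have h1 : HasDerivAt (fun t : ℝ => -(q / (4 * t))) (q / (4 * t ^ 2)) t := by
      have h2 := (((hasDerivAt_id t).const_mul 4).inv (by simpa using ht0.ne')).const_mul q
      have h3 := h2.neg
      refine (h3.congr_deriv ?_).congr_of_eventuallyEq ?_
      · simp only [id]
        field_simp
      · exact Eventually.of_forall fun y => by simp [div_eq_mul_inv]
    have h2 := h1.exp
    rw [mul_comm]
    refine h2.congr_of_eventuallyEq ?_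
    filter_upwards [lt_mem_nhds ht0] with y hy
    rw [hf, Function.update_of_ne hy.ne']
  have hpos : ∀ t ∈ Ioi (0 : ℝ), 0 ≤ q / (4 * t ^ 2) * Real.exp (-(q / (4 * t))) := fun t _ => by
    positivity
  have hlim : Tendsto f atTop (𝓝 1) := by
    have h1 : Tendsto (fun t : ℝ => -(q / (4 * t))) atTop (𝓝 (-0)) :=
      (tendsto_const_nhds.div_atTop (tendsto_id.const_mul_atTop (by norm_num))).neg
    have h2 := (Real.continuous_exp.tendsto _).comp h1
    rw [neg_zero, Real.exp_zero] at h2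
    refine h2.congr' ?_
    filter_upwards [eventually_gt_atTop 0] with y hy
    rw [hf, Function.update_of_ne hy.ne']
    rfl
  refine ⟨integrableOn_Ioi_deriv_of_nonneg hcont hder hpos hlim, ?_⟩
  rw [integral_Ioi_of_hasDerivAt_of_nonneg hcont hder hpos hlim, hf0, sub_zero]

lemma hasDerivAt_green {κ q : ℝ} (hκ : 0 < κ) (hq : 0 < q) :
    HasDerivAt (green κ) (greenDeriv κ q) q := by
  have key := hasDerivAt_integral_of_dominated_loc_of_deriv_le (μ := volume.restrict (Ioi (0 : ℝ)))
    (F := fun q t => killedHeat κ t q) (F' := fun q t => -((4 * t)⁻¹ * killedHeat κ t q))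
    (x₀ := q) (s := Ioi (q / 2)) (bound := fun t => 8 / (Real.pi * q ^ 2) * Real.exp (-(κ ^ 2 * t)))
    (Ioi_mem_nhds (by linarith))
    (Eventually.of_forall fun q => (measurable_killedHeat_left κ q).aestronglyMeasurable)
    (integrableOn_killedHeat hκ hq)
    (Measurable.aestronglyMeasurable (by have := measurable_killedHeat_left κ q; fun_prop))
    ?_ ((integrableOn_exp_neg hκ).const_mul _) ?_
  · exact key.2
  · filter_upwards [ae_restrict_mem measurableSet_Ioi] with t ht x hx
    have ht0 : 0 < t := ht
    rw [norm_neg, norm_mul, Real.norm_of_nonneg (by positivity),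
      Real.norm_of_nonneg (killedHeat_pos ht).le]
    refine (mul_le_mul_of_nonneg_left (killedHeat_anti ht (le_of_lt hx)) (by positivity)).trans ?_
    unfold killedHeat
    rw [sub_eq_add_neg, Real.exp_add]
    have h1 := exp_neg_sq_le (x := q / 2 / (4 * t)) (by positivity)
    calc (4 * t)⁻¹ * ((4 * Real.pi * t)⁻¹ *
          (Real.exp (-(κ ^ 2 * t)) * Real.exp (-(q / 2 / (4 * t)))))
        ≤ (4 * t)⁻¹ * ((4 * Real.pi * t)⁻¹ *
          (Real.exp (-(κ ^ 2 * t)) * (2 / (q / 2 / (4 * t)) ^ 2))) := by gcongr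
      _ = _ := by field_simp; norm_num
  · filter_upwards [ae_restrict_mem measurableSet_Ioi] with t ht x _
    have ht0 : 0 < t := ht
    unfold killedHeat
    have h1 : HasDerivAt (fun x : ℝ => -(κ ^ 2 * t) - x / (4 * t)) (-(1 / (4 * t))) x :=
      ((hasDerivAt_id x).div_const (4 * t)).const_sub _
    refine (h1.exp.const_mul ((4 * Real.pi * t)⁻¹)).congr_deriv ?_
    ring

/-- Dropping the factor `exp(-κ² t)` leaves the explicit time integral `integral_exp_neg_inv`. The
result is the derivative of the logarithmic potential and does not involve `κ`. -/
lemma abs_greenDeriv_le {κ q : ℝ} (hq : 0 < q) :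
    |greenDeriv κ q| ≤ 1 / (4 * Real.pi * q) := by
  obtain ⟨h1, h2⟩ := integral_exp_neg_inv hq
  have h3 : 1 / (4 * Real.pi * q) = ∫ t in Ioi (0 : ℝ), 1 / (4 * Real.pi * q) *
      (q / (4 * t ^ 2) * Real.exp (-(q / (4 * t)))) := by
    rw [integral_const_mul, h2, mul_one]
  rw [h3, greenDeriv, ← Real.norm_eq_abs]
  refine norm_integral_le_of_norm_le (h1.const_mul _) ?_
  filter_upwards [ae_restrict_mem measurableSet_Ioi] with t ht
  have ht0 : 0 < t := ht
  rw [norm_neg, norm_mul, Real.norm_of_nonneg (by positivity),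
    Real.norm_of_nonneg (killedHeat_pos ht).le]
  unfold killedHeat
  have h4 : Real.exp (-(κ ^ 2 * t) - q / (4 * t)) ≤ Real.exp (-(q / (4 * t))) := by
    apply Real.exp_le_exp.2
    have : 0 ≤ κ ^ 2 * t := by positivity
    linarith
  calc (4 * t)⁻¹ * ((4 * Real.pi * t)⁻¹ * Real.exp (-(κ ^ 2 * t) - q / (4 * t)))
      ≤ (4 * t)⁻¹ * ((4 * Real.pi * t)⁻¹ * Real.exp (-(q / (4 * t)))) := by gcongr
    _ = _ := by field_simp

/-- By the derivative bound, `G + (4π)⁻¹ log q` is increasing in `q`. -/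
lemma green_sub_le_log {κ p q : ℝ} (hκ : 0 < κ) (hp : 0 < p) (hpq : p ≤ q) :
    green κ p - green κ q ≤ 1 / (4 * Real.pi) * Real.log (q / p) := by
  have hmono : MonotoneOn (fun q => green κ q + 1 / (4 * Real.pi) * Real.log q) (Ioi 0) := by
    have hd : ∀ x ∈ Ioi (0 : ℝ), HasDerivAt (fun q => green κ q + 1 / (4 * Real.pi) * Real.log q)
        (greenDeriv κ x + 1 / (4 * Real.pi) * x⁻¹) x := fun x hx =>
      (hasDerivAt_green hκ hx).add ((Real.hasDerivAt_log (ne_of_gt hx)).const_mul _)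
    refine monotoneOn_of_deriv_nonneg (convex_Ioi 0)
      (fun x hx => (hd x hx).continuousAt.continuousWithinAt)
      (fun x hx => (hd x (interior_subset hx)).differentiableAt.differentiableWithinAt) ?_
    intro x hx
    have hx0 : x ∈ Ioi (0 : ℝ) := interior_subset hx
    rw [(hd x hx0).deriv]
    have h1 := neg_le_of_abs_le (abs_greenDeriv_le (κ := κ) hx0)
    have h2 : 1 / (4 * Real.pi) * x⁻¹ = 1 / (4 * Real.pi * x) := by
      rw [one_div, one_div, mul_inv (4 * Real.pi)]
    linarith
  have := hmono hp (hp.trans_le hpq : (0 : ℝ) < q) hpq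
  simp only at this
  rw [Real.log_div (hp.trans_le hpq).ne' hp.ne']
  linarith

/-- With `s = √‖a‖ ≥ t = √‖b‖` one has `log (s / t) ≤ (s - t) / t` and `s - t ≤ √‖a - b‖`. Half a
power of the singularity is traded for Hölder continuity, uniformly in `κ`. -/
lemma abs_green_sub_green_le {κ : ℝ} (hκ : 0 < κ) {a b : Plane} (ha : a ≠ 0) (hb : b ≠ 0) :
    |green κ (‖a‖ ^ 2) - green κ (‖b‖ ^ 2)| ≤
      1 / Real.pi * √‖a - b‖ * ((√‖a‖)⁻¹ + (√‖b‖)⁻¹) := by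
  wlog hab : ‖b‖ ≤ ‖a‖ generalizing a b
  · rw [abs_sub_comm, norm_sub_rev, add_comm]
    exact this hb ha (le_of_not_ge hab)
  have hb0 : 0 < ‖b‖ := norm_pos_iff.2 hb
  have ha0 : 0 < ‖a‖ := norm_pos_iff.2 ha
  have hsq : ‖b‖ ^ 2 ≤ ‖a‖ ^ 2 := by gcongr
  rw [abs_sub_comm, abs_of_nonneg (by linarith [green_anti hκ (by positivity) hsq])]
  refine (green_sub_le_log hκ (by positivity) hsq).trans ?_
  set s := √‖a‖ with hs
  set t := √‖b‖ with ht
  have hs0 : 0 < s := Real.sqrt_pos.2 ha0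
  have ht0 : 0 < t := Real.sqrt_pos.2 hb0
  have hsa : ‖a‖ = s ^ 2 := (Real.sq_sqrt ha0.le).symm
  have htb : ‖b‖ = t ^ 2 := (Real.sq_sqrt hb0.le).symm
  have hts : t ≤ s := Real.sqrt_le_sqrt hab
  have h1 : Real.log (‖a‖ ^ 2 / ‖b‖ ^ 2) = 4 * Real.log (s / t) := by
    rw [hsa, htb, show ((s ^ 2) ^ 2 / (t ^ 2) ^ 2) = (s / t) ^ 4 by field_simp, Real.log_pow]
    norm_num
  have h2 : Real.log (s / t) ≤ (s - t) / t := by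
    have := Real.log_le_sub_one_of_pos (show 0 < s / t by positivity)
    have e : (s - t) / t = s / t - 1 := by field_simp
    linarith
  have h3 : s - t ≤ √‖a - b‖ := by
    apply Real.le_sqrt_of_sq_le
    have := norm_sub_norm_le a b
    nlinarith
  rw [h1]
  calc 1 / (4 * Real.pi) * (4 * Real.log (s / t))
      ≤ 1 / (4 * Real.pi) * (4 * (√‖a - b‖ / t)) := by
        gcongr
        exact h2.trans (by gcongr)
    _ = 1 / Real.pi * √‖a - b‖ * t⁻¹ := by field_simp
    _ ≤ _ := by
        gcongr
        have : 0 ≤ s⁻¹ := by positivity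
        linarith

/-- The derivative of `x ↦ green κ ‖x‖²`. -/
def greenFDeriv (κ : ℝ) (x : Plane) : Plane →L[ℝ] ℝ :=
  greenDeriv κ (‖x‖ ^ 2) • ((2 : ℝ) • innerSL ℝ x)

lemma hasFDerivAt_green {κ : ℝ} (hκ : 0 < κ) {x : Plane} (hx : x ≠ 0) :
    HasFDerivAt (fun x : Plane => green κ (‖x‖ ^ 2)) (greenFDeriv κ x) x := by
  have h1 : HasFDerivAt (fun x : Plane => ‖x‖ ^ 2) ((2 : ℝ) • innerSL ℝ x) x :=
    (hasStrictFDerivAt_norm_sq x).hasFDerivAt.congr_fderiv (by rw [two_smul, two_smul])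
  exact (hasDerivAt_green hκ (by positivity)).comp_hasFDerivAt x h1

lemma norm_greenFDeriv_le (κ : ℝ) (x : Plane) : ‖greenFDeriv κ x‖ ≤ 1 / ‖x‖ := by
  rcases eq_or_ne x 0 with rfl | hx
  · simp [greenFDeriv]
  have hx0 : 0 < ‖x‖ := norm_pos_iff.2 hx
  rw [greenFDeriv, norm_smul, norm_smul, innerSL_apply_norm, Real.norm_eq_abs]
  calc |greenDeriv κ (‖x‖ ^ 2)| * (‖(2 : ℝ)‖ * ‖x‖)
      ≤ 1 / (4 * Real.pi * ‖x‖ ^ 2) * (‖(2 : ℝ)‖ * ‖x‖) := by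
        gcongr
        exact abs_greenDeriv_le (by positivity)
    _ = 1 / (2 * Real.pi) * (1 / ‖x‖) := by
        rw [Real.norm_of_nonneg (by norm_num)]; field_simp; norm_num
    _ ≤ 1 * (1 / ‖x‖) := by
        gcongr
        rw [div_le_one (by positivity)]; linarith [Real.pi_gt_three]
    _ = _ := one_mul _

lemma measurable_greenDeriv (κ : ℝ) : Measurable (greenDeriv κ) := by
  have h : StronglyMeasurable fun p : ℝ × ℝ => -((4 * p.2)⁻¹ * killedHeat κ p.2 p.1) := by
    have := (measurable_killedHeat κ).comp measurable_swap
    simp only [Function.comp_def, Prod.fst_swap, Prod.snd_swap] at this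
    exact Measurable.stronglyMeasurable (by fun_prop)
  exact (h.integral_prod_right (ν := volume.restrict (Ioi 0))).measurable

lemma measurable_greenFDeriv (κ : ℝ) : Measurable (greenFDeriv κ) := by
  unfold greenFDeriv
  have := measurable_greenDeriv κ
  have h2 : Measurable fun x : Plane => innerSL ℝ x := (innerSL ℝ).continuous.measurable
  fun_prop

end

section

/-! ### Square integrals -/

section SquareIntegral

variable {X E : Type*} [MeasurableSpace X] {μ : Measure X} [NormedAddCommGroup E]

lemma eLpNorm_two_sq (f : X → E) : eLpNorm f 2 μ ^ 2 = ∫⁻ x, ‖f x‖ₑ ^ 2 ∂μ := by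
  rw [eLpNorm_eq_lintegral_rpow_enorm_toReal two_ne_zero ENNReal.ofNat_ne_top,
    ← ENNReal.rpow_natCast, ← ENNReal.rpow_mul]
  simp

lemma tendsto_lintegral_sq {ι : Type*} {l : Filter ι} {f : ι → X → E}
    (h : Tendsto (fun n => eLpNorm (f n) 2 μ) l (𝓝 0)) :
    Tendsto (fun n => ∫⁻ x, ‖f n x‖ₑ ^ 2 ∂μ) l (𝓝 0) := by
  have := (ENNReal.continuous_pow 2).tendsto 0 |>.comp h
  simpa [Function.comp_def, eLpNorm_two_sq] using this

lemma lintegral_sq_ne_top {f : X → E} (h : MemLp f 2 μ) : ∫⁻ x, ‖f x‖ₑ ^ 2 ∂μ ≠ ⊤ := by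
  rw [← eLpNorm_two_sq]
  exact ENNReal.pow_ne_top h.2.ne

lemma enorm_add_sq_le (a b : E) : ‖a + b‖ₑ ^ 2 ≤ 2 * ‖a‖ₑ ^ 2 + 2 * ‖b‖ₑ ^ 2 := by
  have h1 : ‖a + b‖ₑ ^ 2 ≤ (‖a‖ₑ + ‖b‖ₑ) ^ 2 := by gcongr; exact enorm_add_le a b
  refine h1.trans ?_
  rw [← mul_add]
  simp only [enorm]
  norm_cast
  exact add_sq_le

lemma lintegral_sq_eq_ofReal {f : X → E} (h : MemLp f 2 μ) :
    ∫⁻ x, ‖f x‖ₑ ^ 2 ∂μ = ENNReal.ofReal (∫ x, ‖f x‖ ^ 2 ∂μ) := by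
  rw [ofReal_integral_eq_lintegral_ofReal ((memLp_two_iff_integrable_sq_norm h.1).1 h)
    (Eventually.of_forall fun x => by positivity)]
  refine lintegral_congr fun x => ?_
  rw [← ofReal_norm, ENNReal.ofReal_pow (norm_nonneg _)]

/-- Continuity of the `L²` inner product. -/
lemma tendsto_integral_inner [InnerProductSpace ℝ E] {ι : Type*} {l : Filter ι}
    {u w : ι → X → E} {U W : X → E}
    (hu : ∀ n, MemLp (u n) 2 μ) (hU : MemLp U 2 μ) (hw : ∀ n, MemLp (w n) 2 μ) (hW : MemLp W 2 μ)
    (h : Tendsto (fun n => eLpNorm (fun x => u n x - U x) 2 μ) l (𝓝 0))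
    (h' : Tendsto (fun n => eLpNorm (fun x => w n x - W x) 2 μ) l (𝓝 0)) :
    Tendsto (fun n => ∫ x, inner ℝ (u n x) (w n x) ∂μ) l (𝓝 (∫ x, inner ℝ (U x) (W x) ∂μ)) := by
  have hconv : ∀ {u : ι → X → E} {U : X → E} (hu : ∀ n, MemLp (u n) 2 μ) (hU : MemLp U 2 μ),
      Tendsto (fun n => eLpNorm (fun x => u n x - U x) 2 μ) l (𝓝 0) →
      Tendsto (fun n => (hu n).toLp (u n)) l (𝓝 (hU.toLp U)) := by
    intro u U hu hU h
    exact (Lp.tendsto_Lp_iff_tendsto_eLpNorm'' u hu U hU).2 h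
  have key := (hconv hu hU h).inner (𝕜 := ℝ) (hconv hw hW h')
  have heq : ∀ {a b : X → E} (ha : MemLp a 2 μ) (hb : MemLp b 2 μ),
      inner ℝ (ha.toLp a) (hb.toLp b) = ∫ x, inner ℝ (a x) (b x) ∂μ := by
    intro a b ha hb
    rw [L2.inner_def]
    refine integral_congr_ae ?_
    filter_upwards [ha.coeFn_toLp, hb.coeFn_toLp] with x h1 h2
    rw [h1, h2]
  simpa only [heq] using key

lemma integrable_inner_of_memLp [InnerProductSpace ℝ E] {a b : X → E} (ha : MemLp a 2 μ)
    (hb : MemLp b 2 μ) : Integrable (fun x => inner ℝ (a x) (b x)) μ := by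
  refine (L2.integrable_inner (𝕜 := ℝ) (ha.toLp a) (hb.toLp b)).congr ?_
  filter_upwards [ha.coeFn_toLp, hb.coeFn_toLp] with x h1 h2
  rw [h1, h2]

lemma tendsto_integral_mul {ι : Type*} {l : Filter ι}
    {u w : ι → X → ℝ} {U W : X → ℝ}
    (hu : ∀ n, MemLp (u n) 2 μ) (hU : MemLp U 2 μ) (hw : ∀ n, MemLp (w n) 2 μ) (hW : MemLp W 2 μ)
    (h : Tendsto (fun n => eLpNorm (fun x => u n x - U x) 2 μ) l (𝓝 0))
    (h' : Tendsto (fun n => eLpNorm (fun x => w n x - W x) 2 μ) l (𝓝 0)) :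
    Tendsto (fun n => ∫ x, u n x * w n x ∂μ) l (𝓝 (∫ x, U x * W x ∂μ)) := by
  have := tendsto_integral_inner hw hW hu hU h' h
  simpa using this

end SquareIntegral

/-! ### Test functions -/

/-- Smooth functions with compact support. -/
abbrev IsTestFunction (v : Plane → ℝ) : Prop := ContDiff ℝ ∞ v ∧ HasCompactSupport v

lemma continuous_gradient {v : Plane → ℝ} (hv : ContDiff ℝ ∞ v) : Continuous (gradient v) :=
  (InnerProductSpace.toDual ℝ Plane).symm.continuous.comp
    (hv.continuous_fderiv (by norm_num))

lemma hasCompactSupport_gradient {v : Plane → ℝ} (hv : HasCompactSupport v) :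
    HasCompactSupport (gradient v) :=
  (hv.fderiv (𝕜 := ℝ)).comp_left (g := (InnerProductSpace.toDual ℝ Plane).symm) (map_zero _)

lemma IsTestFunction.memLp {v : Plane → ℝ} (hv : IsTestFunction v) (μ : Measure Plane)
    [IsFiniteMeasureOnCompacts μ] : MemLp v 2 μ :=
  hv.1.continuous.memLp_of_hasCompactSupport hv.2

lemma IsTestFunction.memLp_gradient {v : Plane → ℝ} (hv : IsTestFunction v) :
    MemLp (gradient v) 2 volume :=
  (continuous_gradient hv.1).memLp_of_hasCompactSupport (hasCompactSupport_gradient hv.2)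

lemma inner_gradient {v : Plane → ℝ} (x y : Plane) :
    inner ℝ (gradient v x) y = fderiv ℝ v x y := by
  rw [gradient, InnerProductSpace.toDual_symm_apply]

lemma norm_gradient (v : Plane → ℝ) (x : Plane) : ‖gradient v x‖ = ‖fderiv ℝ v x‖ := by
  rw [gradient, LinearIsometryEquiv.norm_map]

/-! ### Rotated coordinates -/

/-- The rotation of a vector by a right angle. -/
def perp (τ : Plane) : Plane := !₂[-(τ 1), τ 0]

lemma norm_sq_eq (x : Plane) : ‖x‖ ^ 2 = x 0 ^ 2 + x 1 ^ 2 := by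
  rw [EuclideanSpace.norm_sq_eq]; simp

lemma inner_eq (x y : Plane) : inner ℝ x y = x 0 * y 0 + x 1 * y 1 := by
  simp [PiLp.inner_apply, mul_comm]

lemma norm_perp (τ : Plane) : ‖perp τ‖ = ‖τ‖ := by
  rw [← sq_eq_sq₀ (norm_nonneg _) (norm_nonneg _), norm_sq_eq, norm_sq_eq]
  simp [perp]; ring

lemma eq_frame {τ : Plane} (hτ : ‖τ‖ = 1) (x : Plane) :
    x = (inner ℝ τ x : ℝ) • τ + (inner ℝ (perp τ) x : ℝ) • perp τ := by
  have h : τ 0 ^ 2 + τ 1 ^ 2 = 1 := by rw [← norm_sq_eq, hτ]; norm_num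
  ext i
  fin_cases i
  · simp [inner_eq, perp]; linear_combination -(x 0) * h
  · simp [inner_eq, perp]; linear_combination -(x 1) * h

/-- The coordinates with respect to `τ` and its rotation, as a linear isometry. -/
def frameIsometry {τ : Plane} (hτ : ‖τ‖ = 1) : Plane ≃ₗᵢ[ℝ] Plane :=
  LinearIsometry.toLinearIsometryEquiv
    { toFun := fun x => x 0 • τ + x 1 • perp τ
      map_add' := fun x y => by simp only [PiLp.add_apply, add_smul]; abel
      map_smul' := fun c x => by simp [mul_smul]
      norm_map' := fun x => by
        have h : τ 0 ^ 2 + τ 1 ^ 2 = 1 := by rw [← norm_sq_eq, hτ]; norm_num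
        rw [← sq_eq_sq₀ (norm_nonneg _) (norm_nonneg _)]
        simp only [LinearMap.coe_mk, AddHom.coe_mk]
        rw [norm_sq_eq, norm_sq_eq]
        simp [perp]; linear_combination (x 0 ^ 2 + x 1 ^ 2) * h } rfl

lemma measurePreserving_frame {τ : Plane} (hτ : ‖τ‖ = 1) :
    MeasurePreserving (fun p : ℝ × ℝ => p.1 • τ + p.2 • perp τ) (volume.prod volume) volume := by
  have h1 := (volume_preserving_finTwoArrow ℝ).symm
  have h2 := PiLp.volume_preserving_toLp (Fin 2)
  have h3 := (frameIsometry hτ).measurePreserving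
  exact h3.comp (h2.comp h1)

lemma lintegral_frame {τ : Plane} (hτ : ‖τ‖ = 1) {F : Plane → ENNReal} (hF : Measurable F) :
    ∫⁻ a : ℝ, ∫⁻ b : ℝ, F (a • τ + b • perp τ) = ∫⁻ x, F x := by
  rw [← (measurePreserving_frame hτ).lintegral_comp hF, lintegral_prod _ (by fun_prop)]

/-! ### Short arcs -/

namespace PlaneCurve

variable (Γ : PlaneCurve)

/-- An arc that is so short that the tangent hardly changes. -/
structure IsShortArc (a b : ℝ) : Prop where
  left : 0 ≤ a
  le : a ≤ b
  right : b ≤ Γ.L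
  tangent : ∀ s ∈ Icc a b, ‖Γ.tangent s - Γ.tangent a‖ ≤ 1 / 2

variable {Γ}

lemma IsShortArc.subset {a b : ℝ} (h : Γ.IsShortArc a b) : Icc a b ⊆ Icc 0 Γ.L :=
  Icc_subset_Icc h.left h.right

lemma IsShortArc.norm_tangent {a b : ℝ} (h : Γ.IsShortArc a b) : ‖Γ.tangent a‖ = 1 :=
  Γ.norm_tangent (h.subset (left_mem_Icc.2 h.le))

/-- In coordinates along the initial tangent `τ` and its normal, `(s, t) ↦ γ s + t n` is injective
with Jacobian `⟨τ, γ' s⟩ ≥ 1/2`. Its image covers part of the plane once, and the Jacobian costs the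
factor `2`. -/
lemma IsShortArc.lintegral_le {a b : ℝ} (h : Γ.IsShortArc a b) {F : Plane → ENNReal}
    (hF : Measurable F) :
    ∫⁻ s in Icc a b, ∫⁻ t : ℝ, F (Γ.γ s + t • perp (Γ.tangent a)) ≤ 2 * ∫⁻ x, F x := by
  set τ := Γ.tangent a with hτ
  have hτ1 : ‖τ‖ = 1 := h.norm_tangent
  set φ : ℝ → ℝ := fun s => inner ℝ τ (Γ.γ s) with hφ
  set Φ : ℝ → ENNReal := fun r => ∫⁻ t : ℝ, F (r • τ + t • perp τ) with hΦ
  have hinner : ∀ s ∈ Icc a b, 1 / 2 ≤ (inner ℝ τ (Γ.tangent s) : ℝ) := by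
    intro s hs
    have h1 : (inner ℝ τ (Γ.tangent s) : ℝ) = 1 + inner ℝ τ (Γ.tangent s - τ) := by
      rw [inner_sub_right, real_inner_self_eq_norm_sq, hτ1]; ring
    have h2 := abs_real_inner_le_norm τ (Γ.tangent s - τ)
    rw [hτ1, one_mul] at h2
    have h3 := (abs_le.1 (h2.trans (h.tangent s hs))).1
    linarith
  have hder : ∀ s ∈ Icc a b, HasDerivWithinAt φ (inner ℝ τ (Γ.tangent s)) (Icc a b) s := by
    intro s hs
    have h1 := (Γ.hasDerivWithinAt_param (h.subset hs)).mono h.subset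
    exact ((innerSL ℝ τ).hasFDerivAt.comp_hasDerivWithinAt s h1)
  have hinj : InjOn φ (Icc a b) := by
    refine StrictMonoOn.injOn ?_
    refine strictMonoOn_of_deriv_pos (convex_Icc a b)
      (fun s hs => (hder s hs).continuousWithinAt) fun s hs => ?_
    have hs' := interior_subset hs
    rw [((hder s hs').hasDerivAt (mem_interior_iff_mem_nhds.1 hs)).deriv]
    linarith [hinner s hs']
  have hin : ∀ s, ∫⁻ t : ℝ, F (Γ.γ s + t • perp τ) = Φ (φ s) := by
    intro s
    have := eq_frame hτ1 (Γ.γ s)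
    have h2 : ∀ t : ℝ, Γ.γ s + t • perp τ = φ s • τ + (t + inner ℝ (perp τ) (Γ.γ s)) • perp τ := by
      intro t
      conv_lhs => rw [this]
      rw [add_smul]; abel
    simp only [h2, hΦ]
    exact lintegral_add_right_eq_self (μ := volume) (fun t => F (φ s • τ + t • perp τ)) _
  calc ∫⁻ s in Icc a b, ∫⁻ t : ℝ, F (Γ.γ s + t • perp τ)
      = ∫⁻ s in Icc a b, Φ (φ s) := by simp only [hin]
    _ ≤ ∫⁻ s in Icc a b, 2 * (ENNReal.ofReal |inner ℝ τ (Γ.tangent s)| * Φ (φ s)) := by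
        refine setLIntegral_mono' measurableSet_Icc fun s hs => ?_
        rw [← mul_assoc]
        have h2 : ∀ r : ℝ, 1 / 2 ≤ r → (1 : ENNReal) ≤ 2 * ENNReal.ofReal |r| := fun r hr => by
          rw [show (2 : ENNReal) = ENNReal.ofReal 2 by simp, ← ENNReal.ofReal_mul (by norm_num),
            ← ENNReal.ofReal_one]
          exact ENNReal.ofReal_le_ofReal (by linarith [le_abs_self r])
        exact le_mul_of_one_le_left zero_le (h2 _ (hinner s hs))
    _ = 2 * ∫⁻ s in Icc a b, ENNReal.ofReal |inner ℝ τ (Γ.tangent s)| * Φ (φ s) :=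
        lintegral_const_mul' _ _ (by simp)
    _ = 2 * ∫⁻ r in φ '' Icc a b, Φ r := by
        rw [lintegral_image_eq_lintegral_abs_deriv_mul measurableSet_Icc hder hinj]
    _ ≤ 2 * ∫⁻ r, Φ r := by
        gcongr
        exact Measure.restrict_le_self
    _ = 2 * ∫⁻ x, F x := by rw [hΦ, lintegral_frame hτ1 hF]

/-- The fundamental theorem of calculus along the normal segment, followed by the Cauchy-Schwarz
inequality. -/
lemma enorm_sub_sq_le {v : Plane → ℝ} (hv : ContDiff ℝ ∞ v) (x : Plane) {n : Plane}
    (hn : ‖n‖ = 1) {h ε : ℝ} (h0 : 0 ≤ h) (hε : h ≤ ε) :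
    ‖v x - v (x + h • n)‖ₑ ^ 2 ≤ ENNReal.ofReal ε * ∫⁻ t : ℝ, ‖gradient v (x + t • n)‖ₑ ^ 2 := by
  have hder : ∀ t, HasDerivAt (fun t : ℝ => v (x + t • n)) (fderiv ℝ v (x + t • n) n) t := by
    intro t
    have h1 : HasDerivAt (fun t : ℝ => x + t • n) n t := by
      simpa using ((hasDerivAt_id t).smul_const n).const_add x
    exact ((hv.differentiable (by norm_num)) _).hasFDerivAt.comp_hasDerivAt t h1
  have hcont : Continuous fun t : ℝ => fderiv ℝ v (x + t • n) n := by
    have := hv.continuous_fderiv (by norm_num)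
    fun_prop
  have hgc := continuous_gradient hv
  have hFTC : v (x + h • n) - v x = ∫ t in Ioc 0 h, fderiv ℝ v (x + t • n) n := by
    rw [← intervalIntegral.integral_of_le h0,
      intervalIntegral.integral_eq_sub_of_hasDerivAt (fun t _ => hder t)
      (hcont.intervalIntegrable _ _)]
    simp
  have h1 : ‖v x - v (x + h • n)‖ₑ ≤ ∫⁻ t in Ioc 0 h, ‖gradient v (x + t • n)‖ₑ := by
    rw [← enorm_neg, neg_sub, hFTC]
    refine (enorm_integral_le_lintegral_enorm _).trans (lintegral_mono fun t => ?_)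
    rw [← ofReal_norm, ← ofReal_norm]
    refine ENNReal.ofReal_le_ofReal ?_
    rw [norm_gradient]
    exact (ContinuousLinearMap.le_opNorm _ _).trans (by rw [hn, mul_one])
  have h2 : ∫⁻ t in Ioc 0 h, ‖gradient v (x + t • n)‖ₑ ≤
      (∫⁻ t in Ioc 0 h, ‖gradient v (x + t • n)‖ₑ ^ (2 : ℝ)) ^ (1 / 2 : ℝ) *
      (∫⁻ t in Ioc 0 h, (1 : ENNReal) ^ (2 : ℝ)) ^ (1 / 2 : ℝ) := by
    have := ENNReal.lintegral_mul_le_Lp_mul_Lq (volume.restrict (Ioc 0 h))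
      Real.HolderConjugate.two_two (f := fun t => ‖gradient v (x + t • n)‖ₑ) (g := fun _ => 1)
      (by fun_prop) (by fun_prop)
    simpa using this
  calc ‖v x - v (x + h • n)‖ₑ ^ 2 ≤
      ((∫⁻ t in Ioc 0 h, ‖gradient v (x + t • n)‖ₑ ^ (2 : ℝ)) ^ (1 / 2 : ℝ) *
      (∫⁻ t in Ioc 0 h, (1 : ENNReal) ^ (2 : ℝ)) ^ (1 / 2 : ℝ)) ^ 2 := by
        gcongr
        exact h1.trans h2
    _ = (∫⁻ t in Ioc 0 h, ‖gradient v (x + t • n)‖ₑ ^ 2) * ENNReal.ofReal h := by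
        rw [mul_pow, ← ENNReal.rpow_natCast, ← ENNReal.rpow_natCast, ← ENNReal.rpow_mul,
          ← ENNReal.rpow_mul]
        simp
    _ ≤ ENNReal.ofReal ε * ∫⁻ t : ℝ, ‖gradient v (x + t • n)‖ₑ ^ 2 := by
        rw [mul_comm]
        gcongr
        exact Measure.restrict_le_self

/-- Test functions hardly change under small normal translations of an arc. -/
lemma IsShortArc.lintegral_sub_le {a b : ℝ} (h : Γ.IsShortArc a b) {v : Plane → ℝ}
    (hv : ContDiff ℝ ∞ v) (ε : ℝ) :
    ∫⁻ s in Icc a b, ∫⁻ t in Ioc 0 ε,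
      ‖v (Γ.γ s) - v (Γ.γ s + t • perp (Γ.tangent a))‖ₑ ^ 2 ≤
      2 * ENNReal.ofReal ε ^ 2 * ∫⁻ x, ‖gradient v x‖ₑ ^ 2 := by
  set n := perp (Γ.tangent a) with hn
  have hn1 : ‖n‖ = 1 := by rw [hn, norm_perp, h.norm_tangent]
  have hgc := continuous_gradient hv
  calc ∫⁻ s in Icc a b, ∫⁻ t in Ioc 0 ε, ‖v (Γ.γ s) - v (Γ.γ s + t • n)‖ₑ ^ 2
      ≤ ∫⁻ s in Icc a b, ∫⁻ _ in Ioc 0 ε,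
          (ENNReal.ofReal ε * ∫⁻ t : ℝ, ‖gradient v (Γ.γ s + t • n)‖ₑ ^ 2) := by
        refine lintegral_mono fun s => setLIntegral_mono' measurableSet_Ioc fun t ht => ?_
        exact enorm_sub_sq_le hv _ hn1 ht.1.le ht.2
    _ = ENNReal.ofReal ε ^ 2 * ∫⁻ s in Icc a b, ∫⁻ t : ℝ, ‖gradient v (Γ.γ s + t • n)‖ₑ ^ 2 := by
        rw [← lintegral_const_mul' _ _ (by simp)]
        refine lintegral_congr fun s => ?_
        rw [setLIntegral_const, Real.volume_Ioc, sub_zero]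
        ring
    _ ≤ ENNReal.ofReal ε ^ 2 * (2 * ∫⁻ x, ‖gradient v x‖ₑ ^ 2) := by
        gcongr
        exact h.lintegral_le (F := fun x => ‖gradient v x‖ₑ ^ 2) (by fun_prop)
    _ = _ := by ring

lemma IsShortArc.lintegral_strip_le {a b : ℝ} (h : Γ.IsShortArc a b) {F : Plane → ENNReal}
    (hF : Measurable F) (ε : ℝ) :
    ∫⁻ s in Icc a b, ∫⁻ t in Ioc 0 ε, F (Γ.γ s + t • perp (Γ.tangent a)) ≤ 2 * ∫⁻ x, F x := by
  refine le_trans (lintegral_mono fun s => ?_) (h.lintegral_le hF)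
  exact setLIntegral_le_lintegral _ _

variable (Γ)

/-- With more than `2KL` equal arcs the tangent turns by at most `K L / n ≤ 1/2` on each. -/
lemma exists_shortArcs : ∃ (n : ℕ) (a : ℕ → ℝ),
    (∀ i < n, Γ.IsShortArc (a i) (a (i + 1))) ∧ Icc 0 Γ.L ⊆ ⋃ i : Fin n, Icc (a i) (a (i + 1)) := by
  obtain ⟨n, hn⟩ := exists_nat_gt (max 1 (2 * (Γ.maxCurvature * Γ.L)))
  have hn1 : (1 : ℝ) < n := (le_max_left _ _).trans_lt hn
  have hn2 : 2 * (Γ.maxCurvature * Γ.L) < n := (le_max_right _ _).trans_lt hn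
  have hn0 : (0 : ℝ) < n := by linarith
  have hL := Γ.L_pos
  have hK := Γ.maxCurvature_nonneg
  have hstep : ∀ i : ℕ, ((i + 1 : ℕ) : ℝ) * (Γ.L / n) = i * (Γ.L / n) + Γ.L / n := fun i => by
    push_cast; ring
  have hnL : (n : ℝ) * (Γ.L / n) = Γ.L := by field_simp
  have hq : 0 < Γ.L / n := by positivity
  refine ⟨n, fun i => i * (Γ.L / n), fun i hi => ?_, fun s hs => ?_⟩
  · have hle : ((i + 1 : ℕ) : ℝ) * (Γ.L / n) ≤ Γ.L := by
      calc ((i + 1 : ℕ) : ℝ) * (Γ.L / n) ≤ n * (Γ.L / n) := by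
            gcongr
            exact_mod_cast hi
        _ = Γ.L := hnL
    have h0 : 0 ≤ (i : ℝ) * (Γ.L / n) := by positivity
    have hst := hstep i
    refine ⟨h0, by linarith, hle, fun s hs => ?_⟩
    refine (Γ.norm_tangent_sub_le ⟨by linarith [hs.1], by linarith [hs.2]⟩
      ⟨h0, by linarith⟩).trans ?_
    have h2 : |s - i * (Γ.L / n)| ≤ Γ.L / n := by
      rw [abs_of_nonneg (by linarith [hs.1])]; linarith [hs.2]
    calc Γ.maxCurvature * |s - i * (Γ.L / n)| ≤ Γ.maxCurvature * (Γ.L / n) := by gcongr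
      _ ≤ 1 / 2 := by
        rw [← mul_div_assoc, div_le_div_iff₀ hn0 (by norm_num)]; linarith
  · rw [mem_iUnion]
    -- At `s = L` the floor of `s / (L / n)` would be `n`, one beyond the last arc.
    rcases eq_or_lt_of_le hs.2 with h | h
    · have hn' : n - 1 < n := by
        have : 0 < n := by exact_mod_cast hn0
        omega
      have hn'' : n - 1 + 1 = n := by omega
      refine ⟨⟨n - 1, hn'⟩, ?_⟩
      simp only
      have := hstep (n - 1)
      rw [hn''] at this ⊢
      rw [h]
      exact ⟨by linarith, by linarith⟩
    · have hfl0 : 0 ≤ s / (Γ.L / n) := div_nonneg hs.1 hq.le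
      have h1 := Nat.floor_le hfl0
      have h2 := Nat.lt_floor_add_one (s / (Γ.L / n))
      rw [le_div_iff₀ hq] at h1
      rw [div_lt_iff₀ hq] at h2
      have h3 : ⌊s / (Γ.L / n)⌋₊ < n := by
        have h4 : (⌊s / (Γ.L / n)⌋₊ : ℝ) * (Γ.L / n) < n * (Γ.L / n) := by
          rw [hnL]; linarith
        exact_mod_cast lt_of_mul_lt_mul_right h4 hq.le
      exact ⟨⟨_, h3⟩, h1, by push_cast; exact h2.le⟩

end PlaneCurve

end

/-! ### Traces of continuous functions and the trace inequality -/

section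

namespace PlaneCurve

variable (Γ : PlaneCurve)

/-- A continuous extension of the parameterization, constant on both sides. -/
def clamped (s : ℝ) : Plane := Γ.γ (projIcc 0 Γ.L Γ.L_pos.le s)

lemma continuous_clamped : Continuous Γ.clamped :=
  Γ.continuousOn_param.comp_continuous (continuous_subtype_val.comp continuous_projIcc)
    fun s => (projIcc 0 Γ.L Γ.L_pos.le s).2

lemma clamped_of_mem {s : ℝ} (hs : s ∈ Icc 0 Γ.L) : Γ.clamped s = Γ.γ s := by
  rw [clamped, projIcc_of_mem Γ.L_pos.le hs]

lemma setLIntegral_shortArc_le {a b : ℝ} (h : Γ.IsShortArc a b) {f : Plane → ENNReal}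
    (hf : AEMeasurable f Γ.sigma) : ∫⁻ s in Icc a b, f (Γ.γ s) ≤ ∫⁻ x, f x ∂Γ.sigma := by
  rw [Γ.lintegral_sigma hf]
  exact lintegral_mono_set h.subset

lemma lintegral_sigma_le_sum {n : ℕ} {a : ℕ → ℝ}
    (h : Icc 0 Γ.L ⊆ ⋃ i : Fin n, Icc (a i) (a (i + 1))) {f : Plane → ENNReal}
    (hf : AEMeasurable f Γ.sigma) :
    ∫⁻ x, f x ∂Γ.sigma ≤ ∑ i : Fin n, ∫⁻ s in Icc (a i) (a (i + 1)), f (Γ.γ s) := by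
  rw [Γ.lintegral_sigma hf, ← tsum_fintype (L := .unconditional _)]
  exact (lintegral_mono_set h).trans (lintegral_iUnion_le _ _)

variable {Γ}

/-- The value on the arc is compared with `ψ` at the points of a normal segment of length `ε`,
averaged over the segment. It serves for the trace `g` of `ψ` and, with `g = 0`, for the trace
inequality. Only the terms with `ψ` have to be measurable. -/
lemma IsShortArc.ofReal_mul_lintegral_le {a b : ℝ} (h : Γ.IsShortArc a b) (g : Plane → ℝ)
    {ψ : Plane → ℝ} (hψ : Continuous ψ) (ε : ℝ) :
    ENNReal.ofReal ε * ∫⁻ s in Icc a b, ‖g (Γ.γ s) - ψ (Γ.γ s)‖ₑ ^ 2 ≤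
      2 * (∫⁻ s in Icc a b, ∫⁻ t in Ioc 0 ε,
        ‖g (Γ.γ s) - ψ (Γ.γ s + t • perp (Γ.tangent a))‖ₑ ^ 2) +
      2 * (∫⁻ s in Icc a b, ∫⁻ t in Ioc 0 ε,
        ‖ψ (Γ.γ s) - ψ (Γ.γ s + t • perp (Γ.tangent a))‖ₑ ^ 2) := by
  set n := perp (Γ.tangent a)
  -- Outside `[0, L]` nothing is known about `γ`; the clamped parameterization is continuous
  -- everywhere and makes the integrands jointly measurable.
  have hc := Γ.continuous_clamped
  have hcong : ∀ F : Plane → ENNReal, ∫⁻ s in Icc a b, F (Γ.γ s) =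
      ∫⁻ s in Icc a b, F (Γ.clamped s) := fun F =>
    setLIntegral_congr_fun measurableSet_Icc fun s hs => by
      simp only [Γ.clamped_of_mem (h.subset hs)]
  rw [hcong fun x => ‖g x - ψ x‖ₑ ^ 2,
    hcong fun x => ∫⁻ t : ℝ in Ioc 0 ε, ‖g x - ψ (x + t • n)‖ₑ ^ 2,
    hcong fun x => ∫⁻ t : ℝ in Ioc 0 ε, ‖ψ x - ψ (x + t • n)‖ₑ ^ 2]
  have hm1 : ∀ s, Measurable fun t : ℝ => 2 * ‖ψ (Γ.clamped s) - ψ (Γ.clamped s + t • n)‖ₑ ^ 2 :=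
    fun s => by
      have : Continuous fun t : ℝ => ψ (Γ.clamped s) - ψ (Γ.clamped s + t • n) := by fun_prop
      have := this.measurable
      fun_prop
  have hm2 : Measurable fun s => ∫⁻ t : ℝ in Ioc 0 ε,
      2 * ‖ψ (Γ.clamped s) - ψ (Γ.clamped s + t • n)‖ₑ ^ 2 := by
    have : Continuous fun p : ℝ × ℝ => ψ (Γ.clamped p.1) - ψ (Γ.clamped p.1 + p.2 • n) := by
      fun_prop
    have := this.measurable
    exact Measurable.lintegral_prod_right'
      (f := fun p : ℝ × ℝ => 2 * ‖ψ (Γ.clamped p.1) - ψ (Γ.clamped p.1 + p.2 • n)‖ₑ ^ 2)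
      (by fun_prop)
  have hin : ∀ s, ENNReal.ofReal ε * ‖g (Γ.clamped s) - ψ (Γ.clamped s)‖ₑ ^ 2 ≤
      (∫⁻ t : ℝ in Ioc 0 ε, 2 * ‖g (Γ.clamped s) - ψ (Γ.clamped s + t • n)‖ₑ ^ 2) +
      ∫⁻ t : ℝ in Ioc 0 ε, 2 * ‖ψ (Γ.clamped s) - ψ (Γ.clamped s + t • n)‖ₑ ^ 2 := by
    intro s
    rw [← lintegral_add_right _ (hm1 s)]
    calc ENNReal.ofReal ε * ‖g (Γ.clamped s) - ψ (Γ.clamped s)‖ₑ ^ 2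
        = ∫⁻ _ : ℝ in Ioc 0 ε, ‖g (Γ.clamped s) - ψ (Γ.clamped s)‖ₑ ^ 2 := by
          rw [setLIntegral_const, Real.volume_Ioc, sub_zero, mul_comm]
      _ ≤ _ := by
          refine lintegral_mono fun t => ?_
          have := enorm_add_sq_le (g (Γ.clamped s) - ψ (Γ.clamped s + t • n))
            (-(ψ (Γ.clamped s) - ψ (Γ.clamped s + t • n)))
          rw [enorm_neg] at this
          convert this using 3
          ring
  rw [← lintegral_const_mul' _ _ (by simp)]
  calc ∫⁻ s in Icc a b, ENNReal.ofReal ε * ‖g (Γ.clamped s) - ψ (Γ.clamped s)‖ₑ ^ 2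
      ≤ ∫⁻ s in Icc a b, ((∫⁻ t : ℝ in Ioc 0 ε,
          2 * ‖g (Γ.clamped s) - ψ (Γ.clamped s + t • n)‖ₑ ^ 2) +
        ∫⁻ t : ℝ in Ioc 0 ε, 2 * ‖ψ (Γ.clamped s) - ψ (Γ.clamped s + t • n)‖ₑ ^ 2) :=
        lintegral_mono hin
    _ = _ := by
        rw [lintegral_add_right _ hm2]
        simp only [lintegral_const_mul' (2 : ENNReal) _ (by simp : (2 : ENNReal) ≠ ⊤)]

/-- The difference is split at `v (γ s)` and at `v` of the translated point, where `v` is a test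
function close to `ψ`. The three errors are the distance of `g` and `v` on the curve, the variation
of `v` along normals, and the distance of `v` and `ψ` in the plane. -/
lemma IsShortArc.lintegral_sub_approx_le {a b : ℝ} (h : Γ.IsShortArc a b) (g : Plane → ℝ)
    {ψ v : Plane → ℝ} (hψ : Continuous ψ) (hv : ContDiff ℝ ∞ v) (ε : ℝ) :
    ∫⁻ s in Icc a b, ∫⁻ t in Ioc 0 ε, ‖g (Γ.γ s) - ψ (Γ.γ s + t • perp (Γ.tangent a))‖ₑ ^ 2 ≤
      2 * (ENNReal.ofReal ε * ∫⁻ s in Icc a b, ‖g (Γ.γ s) - v (Γ.γ s)‖ₑ ^ 2) +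
      (4 * (2 * ENNReal.ofReal ε ^ 2 * ∫⁻ x, ‖gradient v x‖ₑ ^ 2) +
      4 * (2 * ∫⁻ x, ‖v x - ψ x‖ₑ ^ 2)) := by
  have h1 := h.lintegral_sub_le hv ε
  have hvc := hv.continuous
  have h2 := h.lintegral_strip_le (F := fun x => ‖v x - ψ x‖ₑ ^ 2)
    (by have := hvc.measurable; have := hψ.measurable; fun_prop) ε
  set n := perp (Γ.tangent a)
  have hc := Γ.continuous_clamped
  have hcong : ∀ F : Plane → ENNReal, ∫⁻ s in Icc a b, F (Γ.γ s) =
      ∫⁻ s in Icc a b, F (Γ.clamped s) := fun F =>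
    setLIntegral_congr_fun measurableSet_Icc fun s hs => by
      simp only [Γ.clamped_of_mem (h.subset hs)]
  rw [hcong fun x => ∫⁻ t : ℝ in Ioc 0 ε, ‖v x - v (x + t • n)‖ₑ ^ 2] at h1
  rw [hcong fun x => ∫⁻ t : ℝ in Ioc 0 ε, ‖v (x + t • n) - ψ (x + t • n)‖ₑ ^ 2] at h2
  rw [hcong fun x => ‖g x - v x‖ₑ ^ 2,
    hcong fun x => ∫⁻ t : ℝ in Ioc 0 ε, ‖g x - ψ (x + t • n)‖ₑ ^ 2]
  have hB : Measurable fun p : ℝ × ℝ => 4 * ‖v (Γ.clamped p.1) - v (Γ.clamped p.1 + p.2 • n)‖ₑ ^ 2 := by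
    have : Continuous fun p : ℝ × ℝ => v (Γ.clamped p.1) - v (Γ.clamped p.1 + p.2 • n) := by
      fun_prop
    have := this.measurable
    fun_prop
  have hC : Measurable fun p : ℝ × ℝ =>
      4 * ‖v (Γ.clamped p.1 + p.2 • n) - ψ (Γ.clamped p.1 + p.2 • n)‖ₑ ^ 2 := by
    have : Continuous fun p : ℝ × ℝ =>
      v (Γ.clamped p.1 + p.2 • n) - ψ (Γ.clamped p.1 + p.2 • n) := by fun_prop
    have := this.measurable
    fun_prop
  have hin : ∀ s, ∫⁻ t : ℝ in Ioc 0 ε, ‖g (Γ.clamped s) - ψ (Γ.clamped s + t • n)‖ₑ ^ 2 ≤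
      2 * (ENNReal.ofReal ε * ‖g (Γ.clamped s) - v (Γ.clamped s)‖ₑ ^ 2) +
      ((∫⁻ t : ℝ in Ioc 0 ε, 4 * ‖v (Γ.clamped s) - v (Γ.clamped s + t • n)‖ₑ ^ 2) +
      ∫⁻ t : ℝ in Ioc 0 ε, 4 * ‖v (Γ.clamped s + t • n) - ψ (Γ.clamped s + t • n)‖ₑ ^ 2) := by
    intro s
    have hCs : Measurable fun t : ℝ =>
        4 * ‖v (Γ.clamped s + t • n) - ψ (Γ.clamped s + t • n)‖ₑ ^ 2 := by
      have : Continuous fun t : ℝ => v (Γ.clamped s + t • n) - ψ (Γ.clamped s + t • n) := by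
        fun_prop
      have := this.measurable
      fun_prop
    calc ∫⁻ t : ℝ in Ioc 0 ε, ‖g (Γ.clamped s) - ψ (Γ.clamped s + t • n)‖ₑ ^ 2
        ≤ ∫⁻ t : ℝ in Ioc 0 ε, (2 * ‖g (Γ.clamped s) - v (Γ.clamped s)‖ₑ ^ 2 +
          (4 * ‖v (Γ.clamped s) - v (Γ.clamped s + t • n)‖ₑ ^ 2 +
            4 * ‖v (Γ.clamped s + t • n) - ψ (Γ.clamped s + t • n)‖ₑ ^ 2)) := by
          refine lintegral_mono fun t => ?_
          have e1 := enorm_add_sq_le (g (Γ.clamped s) - v (Γ.clamped s))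
            (v (Γ.clamped s) - ψ (Γ.clamped s + t • n))
          have e2 := enorm_add_sq_le (v (Γ.clamped s) - v (Γ.clamped s + t • n))
            (v (Γ.clamped s + t • n) - ψ (Γ.clamped s + t • n))
          rw [sub_add_sub_cancel] at e1 e2
          refine e1.trans (add_le_add le_rfl ((mul_le_mul_right e2 2).trans (le_of_eq ?_)))
          rw [mul_add, ← mul_assoc, ← mul_assoc]
          norm_num
      _ = _ := by
          rw [lintegral_add_left measurable_const, lintegral_add_right _ hCs, setLIntegral_const,
            Real.volume_Ioc, sub_zero, mul_right_comm, mul_assoc]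
  refine (lintegral_mono hin).trans ?_
  rw [lintegral_add_right, lintegral_add_right]
  · simp only [lintegral_const_mul' (4 : ENNReal) _ (by simp : (4 : ENNReal) ≠ ⊤),
      lintegral_const_mul' (2 : ENNReal) _ (by simp : (2 : ENNReal) ≠ ⊤),
      lintegral_const_mul' (ENNReal.ofReal ε) _ (by simp)]
    gcongr
  · exact hC.lintegral_prod_right'
  · exact hB.lintegral_prod_right'.add hC.lintegral_prod_right'

lemma exists_forall_abs_sub_le {ψ : Plane → ℝ} (hψ : Continuous ψ) {w : ℝ} (hw : 0 < w) :
    ∃ ε₀ : ℝ, 0 < ε₀ ∧ ∀ s ∈ Icc 0 Γ.L, ∀ n : Plane, ‖n‖ = 1 → ∀ t ∈ Ioc 0 ε₀,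
      |ψ (Γ.γ s) - ψ (Γ.γ s + t • n)| ≤ w := by
  have hK : IsCompact (Metric.cthickening 1 Γ.carrier) := Γ.isCompact_carrier.cthickening
  obtain ⟨δ, hδ, h⟩ := Metric.uniformContinuousOn_iff.1
    (hK.uniformContinuousOn_of_continuous hψ.continuousOn) w hw
  refine ⟨min 1 (δ / 2), by positivity, fun s hs n hn t ht => ?_⟩
  have ht1 : t ≤ 1 := ht.2.trans (min_le_left _ _)
  have ht2 : t < δ := by linarith [ht.2.trans (min_le_right _ _)]
  have hd : dist (Γ.γ s) (Γ.γ s + t • n) = t := by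
    rw [dist_self_add_right, norm_smul, hn, mul_one, Real.norm_of_nonneg ht.1.le]
  have hm : Γ.γ s ∈ Γ.carrier := mem_image_of_mem _ hs
  refine (h _ (Metric.self_subset_cthickening _ hm) _ ?_ (by rw [hd]; exact ht2)).le
  refine Metric.mem_cthickening_of_dist_le _ (Γ.γ s) _ _ hm ?_
  rw [dist_comm, hd]; exact ht1

/-- Letting the test functions converge, the integral of `|g - ψ|²` over a strip of width `ε` is
`O(ε²)`, one power of `ε` better than the width. After division by `ε` only the oscillation of the
continuous function `ψ` across the strip remains, and it tends to zero with `ε`. -/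
lemma IsShortArc.lintegral_trace_sub_eq_zero {a b : ℝ} (h : Γ.IsShortArc a b) {ψ g : Plane → ℝ}
    {G : Plane → Plane} (hψ : Continuous ψ) (hG : MemLp G 2 volume) (htr : IsTrace Γ ψ G g) :
    ∫⁻ s in Icc a b, ‖g (Γ.γ s) - ψ (Γ.γ s)‖ₑ ^ 2 = 0 := by
  obtain ⟨hg, v, hv, hv1, hv2, hv3⟩ := htr
  have hn1 : ‖perp (Γ.tangent a)‖ = 1 := by rw [norm_perp, h.norm_tangent]
  have hD : ∀ ε > 0, ∫⁻ s in Icc a b, ∫⁻ t in Ioc 0 ε,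
      ‖g (Γ.γ s) - ψ (Γ.γ s + t • perp (Γ.tangent a))‖ₑ ^ 2 ≤
      16 * ENNReal.ofReal ε ^ 2 * ∫⁻ x, ‖G x‖ₑ ^ 2 := by
    intro ε hε
    have hle : ∀ n, ∫⁻ s in Icc a b, ∫⁻ t in Ioc 0 ε,
        ‖g (Γ.γ s) - ψ (Γ.γ s + t • perp (Γ.tangent a))‖ₑ ^ 2 ≤
        2 * (ENNReal.ofReal ε * ∫⁻ x, ‖v n x - g x‖ₑ ^ 2 ∂Γ.sigma) +
        (4 * (2 * ENNReal.ofReal ε ^ 2 *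
          (2 * (∫⁻ x, ‖gradient (v n) x - G x‖ₑ ^ 2) + 2 * ∫⁻ x, ‖G x‖ₑ ^ 2)) +
        4 * (2 * ∫⁻ x, ‖v n x - ψ x‖ₑ ^ 2)) := by
      intro n
      refine (h.lintegral_sub_approx_le g hψ (hv n).1 ε).trans ?_
      gcongr
      · have hm : AEMeasurable (fun x => ‖v n x - g x‖ₑ ^ 2) Γ.sigma := by
          have h1 := hg.1
          have h2 := (hv n).1.continuous.aestronglyMeasurable (μ := Γ.sigma)
          exact (h2.sub h1).enorm.pow_const 2
        refine le_trans (le_of_eq ?_) (Γ.setLIntegral_shortArc_le h hm)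
        refine lintegral_congr fun s => ?_
        rw [← enorm_neg, neg_sub]
      · have hgc := (continuous_gradient (hv n).1).aestronglyMeasurable (μ := volume)
        have hm1 : AEMeasurable (fun x => 2 * ‖gradient (v n) x - G x‖ₑ ^ 2) volume :=
          ((hgc.sub hG.1).enorm.pow_const 2).const_mul 2
        rw [← lintegral_const_mul' _ _ (by simp), ← lintegral_const_mul' _ _ (by simp),
          ← lintegral_add_left' hm1]
        refine lintegral_mono fun x => ?_
        have := enorm_add_sq_le (gradient (v n) x - G x) (G x)
        rwa [sub_add_cancel] at this
    have t1 := tendsto_lintegral_sq hv1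
    have t2 := tendsto_lintegral_sq hv2
    have t3 := tendsto_lintegral_sq hv3
    have hlim : Tendsto (fun n => 2 * (ENNReal.ofReal ε * ∫⁻ x, ‖v n x - g x‖ₑ ^ 2 ∂Γ.sigma) +
        (4 * (2 * ENNReal.ofReal ε ^ 2 *
          (2 * (∫⁻ x, ‖gradient (v n) x - G x‖ₑ ^ 2) + 2 * ∫⁻ x, ‖G x‖ₑ ^ 2)) +
        4 * (2 * ∫⁻ x, ‖v n x - ψ x‖ₑ ^ 2))) atTop
        (𝓝 (2 * (ENNReal.ofReal ε * 0) +
        (4 * (2 * ENNReal.ofReal ε ^ 2 * (2 * 0 + 2 * ∫⁻ x, ‖G x‖ₑ ^ 2)) + 4 * (2 * 0)))) := by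
      have hne : (2 * ENNReal.ofReal ε ^ 2) ≠ ⊤ :=
        ENNReal.mul_ne_top (by simp) (ENNReal.pow_ne_top (by simp))
      refine Tendsto.add ?_ (Tendsto.add ?_ ?_)
      · exact ENNReal.Tendsto.const_mul (ENNReal.Tendsto.const_mul t3 (Or.inr (by simp)))
          (Or.inr (by simp))
      · refine ENNReal.Tendsto.const_mul (ENNReal.Tendsto.const_mul (Tendsto.add ?_
          tendsto_const_nhds) (Or.inr hne)) (Or.inr (by simp))
        exact ENNReal.Tendsto.const_mul t2 (Or.inr (by simp))
      · exact ENNReal.Tendsto.const_mul (ENNReal.Tendsto.const_mul t1 (Or.inr (by simp)))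
          (Or.inr (by simp))
    refine (ge_of_tendsto' hlim hle).trans (le_of_eq ?_)
    ring
  set I := ∫⁻ s in Icc a b, ‖g (Γ.γ s) - ψ (Γ.γ s)‖ₑ ^ 2 with hI
  set N := ∫⁻ x, ‖G x‖ₑ ^ 2 with hN
  have hNtop : N ≠ ⊤ := lintegral_sq_ne_top hG
  -- With `w` a bound for the oscillation of `ψ` across the strip, first `ε → 0` and then `w → 0`.
  have hw : ∀ w > 0, I ≤ 2 * (ENNReal.ofReal w ^ 2 * ENNReal.ofReal (b - a)) := by
    intro w hw
    obtain ⟨ε₀, hε₀, hosc⟩ := exists_forall_abs_sub_le (Γ := Γ) hψ hw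
    have hle : ∀ᶠ ε in 𝓝[>] (0 : ℝ), I ≤ 32 * ENNReal.ofReal ε * N +
        2 * (ENNReal.ofReal w ^ 2 * ENNReal.ofReal (b - a)) := by
      filter_upwards [Ioc_mem_nhdsGT hε₀] with ε hε
      have he0 : ENNReal.ofReal ε ≠ 0 := by simpa using hε.1
      have h1 := h.ofReal_mul_lintegral_le g hψ ε
      rw [← hI] at h1
      have h2 : ∫⁻ s in Icc a b, ∫⁻ t in Ioc 0 ε,
          ‖ψ (Γ.γ s) - ψ (Γ.γ s + t • perp (Γ.tangent a))‖ₑ ^ 2 ≤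
          ENNReal.ofReal ε * (ENNReal.ofReal w ^ 2 * ENNReal.ofReal (b - a)) := by
        calc _ ≤ ∫⁻ _ in Icc a b, ∫⁻ _ in Ioc 0 ε, ENNReal.ofReal w ^ 2 := by
              refine setLIntegral_mono' measurableSet_Icc fun s hs =>
                setLIntegral_mono' measurableSet_Ioc fun t ht => ?_
              gcongr
              rw [← ofReal_norm, Real.norm_eq_abs]
              exact ENNReal.ofReal_le_ofReal
                (hosc s (h.subset hs) _ hn1 t ⟨ht.1, ht.2.trans hε.2⟩)
          _ = _ := by
              rw [setLIntegral_const, setLIntegral_const, Real.volume_Ioc, Real.volume_Icc,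
                sub_zero]
              ring
      have h3 : ENNReal.ofReal ε * I ≤ ENNReal.ofReal ε * (32 * ENNReal.ofReal ε * N +
          2 * (ENNReal.ofReal w ^ 2 * ENNReal.ofReal (b - a))) := by
        calc ENNReal.ofReal ε * I ≤ 2 * (16 * ENNReal.ofReal ε ^ 2 * N) +
              2 * (ENNReal.ofReal ε * (ENNReal.ofReal w ^ 2 * ENNReal.ofReal (b - a))) := by
              refine h1.trans ?_
              gcongr
              exact hD ε hε.1
          _ = _ := by ring
      exact (ENNReal.mul_le_mul_iff_right he0 ENNReal.ofReal_ne_top).1 h3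
    have hlim : Tendsto (fun ε : ℝ => 32 * ENNReal.ofReal ε * N +
        2 * (ENNReal.ofReal w ^ 2 * ENNReal.ofReal (b - a))) (𝓝[>] 0)
        (𝓝 (32 * ENNReal.ofReal 0 * N +
        2 * (ENNReal.ofReal w ^ 2 * ENNReal.ofReal (b - a)))) := by
      refine Tendsto.add ?_ tendsto_const_nhds
      refine ENNReal.Tendsto.mul_const (ENNReal.Tendsto.const_mul ?_ (Or.inr (by simp)))
        (Or.inr hNtop)
      exact (ENNReal.continuous_ofReal.tendsto 0).mono_left nhdsWithin_le_nhds
    simpa using ge_of_tendsto hlim hle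
  have hlim : Tendsto (fun w : ℝ => 2 * (ENNReal.ofReal w ^ 2 * ENNReal.ofReal (b - a))) (𝓝[>] 0)
      (𝓝 (2 * (ENNReal.ofReal 0 ^ 2 * ENNReal.ofReal (b - a)))) := by
    refine ENNReal.Tendsto.const_mul (ENNReal.Tendsto.mul_const ?_ (Or.inr (by simp)))
      (Or.inr (by simp))
    exact (((ENNReal.continuous_pow 2).comp ENNReal.continuous_ofReal).tendsto 0).mono_left
      nhdsWithin_le_nhds
  have := ge_of_tendsto hlim (eventually_nhdsWithin_of_forall hw)
  simpa using this

/-- The trace of a continuous function is its restriction. -/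
lemma trace_ae_eq {ψ g : Plane → ℝ} {G : Plane → Plane} (hψ : Continuous ψ)
    (hG : MemLp G 2 volume) (htr : IsTrace Γ ψ G g) : g =ᵐ[Γ.sigma] ψ := by
  obtain ⟨n, a, ha, hcov⟩ := Γ.exists_shortArcs
  have hm : AEMeasurable (fun x => ‖g x - ψ x‖ₑ ^ 2) Γ.sigma :=
    (htr.1.1.sub hψ.aestronglyMeasurable).enorm.pow_const 2
  have h0 : ∫⁻ x, ‖g x - ψ x‖ₑ ^ 2 ∂Γ.sigma = 0 := by
    refine le_antisymm ((Γ.lintegral_sigma_le_sum hcov hm).trans (le_of_eq ?_)) zero_le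
    exact Finset.sum_eq_zero fun i _ => (ha i i.2).lintegral_trace_sub_eq_zero hψ hG htr
  rw [lintegral_eq_zero_iff' hm] at h0
  filter_upwards [h0] with x hx
  simpa [sub_eq_zero] using hx

/-- The same averaging with `g = 0`: wide strips favour the `L²` norm, narrow ones the gradient. -/
lemma IsShortArc.lintegral_test_le {a b : ℝ} (h : Γ.IsShortArc a b) {v : Plane → ℝ}
    (hv : ContDiff ℝ ∞ v) {ε : ℝ} (hε : 0 < ε) :
    ∫⁻ s in Icc a b, ‖v (Γ.γ s)‖ₑ ^ 2 ≤
      ENNReal.ofReal (4 * ε) * (∫⁻ x, ‖gradient v x‖ₑ ^ 2) +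
      ENNReal.ofReal (4 / ε) * ∫⁻ x, ‖v x‖ₑ ^ 2 := by
  have h1 := h.lintegral_strip_le (F := fun x => ‖v x‖ₑ ^ 2)
    (by have := hv.continuous.measurable; fun_prop) ε
  have h2 := h.ofReal_mul_lintegral_le (fun _ => 0) hv.continuous ε
  have h3 := h.lintegral_sub_le hv ε
  simp only [zero_sub, enorm_neg] at h2
  have he0 : ENNReal.ofReal ε ≠ 0 := by simpa using hε
  refine (ENNReal.mul_le_mul_iff_right he0 ENNReal.ofReal_ne_top).1 (h2.trans ?_)
  have e1 : ENNReal.ofReal (4 * ε) = 4 * ENNReal.ofReal ε := by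
    rw [ENNReal.ofReal_mul (by norm_num)]; simp
  have e2 : ENNReal.ofReal ε * ENNReal.ofReal (4 / ε) = 4 := by
    rw [← ENNReal.ofReal_mul hε.le, mul_div_cancel₀ _ hε.ne']
    simp
  rw [e1, mul_add, ← mul_assoc (ENNReal.ofReal ε) (ENNReal.ofReal (4 / ε)), e2]
  refine (add_le_add (mul_le_mul_right h1 2) (mul_le_mul_right h3 2)).trans (le_of_eq ?_)
  ring

variable (Γ)

/-- The trace inequality with a small constant for the gradient. -/
lemma exists_trace_bound {η : ℝ} (hη : 0 < η) : ∃ C : ℝ, ∀ v : Plane → ℝ, IsTestFunction v →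
    ∫ x, v x * v x ∂Γ.sigma ≤
      η * (∫ x, inner ℝ (gradient v x) (gradient v x)) + C * ∫ x, v x * v x := by
  obtain ⟨n, a, ha, hcov⟩ := Γ.exists_shortArcs
  -- Each of the `n` arcs contributes `4ε` times the gradient term, and `4nε ≤ η`.
  set ε : ℝ := η / (4 * (n + 1)) with hε
  have hεpos : 0 < ε := by positivity
  refine ⟨n * (4 / ε), fun v hv => ?_⟩
  have hvσ := hv.memLp Γ.sigma
  have hvv := hv.memLp volume
  have hvg := hv.memLp_gradient
  have hm : AEMeasurable (fun x => ‖v x‖ₑ ^ 2) Γ.sigma := hvσ.1.enorm.pow_const 2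
  have h1 : ∫⁻ x, ‖v x‖ₑ ^ 2 ∂Γ.sigma ≤
      ∑ i : Fin n, (ENNReal.ofReal (4 * ε) * (∫⁻ x, ‖gradient v x‖ₑ ^ 2) +
      ENNReal.ofReal (4 / ε) * ∫⁻ x, ‖v x‖ₑ ^ 2) :=
    (Γ.lintegral_sigma_le_sum hcov hm).trans
      (Finset.sum_le_sum fun i _ => (ha i i.2).lintegral_test_le hv.1 hεpos)
  rw [Finset.sum_const, Finset.card_univ, Fintype.card_fin, lintegral_sq_eq_ofReal hvσ,
    lintegral_sq_eq_ofReal hvv, lintegral_sq_eq_ofReal hvg, ← ENNReal.ofReal_mul (by positivity),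
    ← ENNReal.ofReal_mul (by positivity), ← ENNReal.ofReal_add (by positivity) (by positivity),
    ← ENNReal.ofReal_nsmul, ENNReal.ofReal_le_ofReal_iff (by positivity)] at h1
  have e1 : ∀ μ : Measure Plane, ∫ x, ‖v x‖ ^ 2 ∂μ = ∫ x, v x * v x ∂μ := fun μ =>
    integral_congr_ae (Eventually.of_forall fun x => by
      simp only [Real.norm_eq_abs, sq_abs]; ring)
  have e2 : ∫ x, ‖gradient v x‖ ^ 2 = ∫ x, inner ℝ (gradient v x) (gradient v x) :=
    integral_congr_ae (Eventually.of_forall fun x => by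
      simp only [real_inner_self_eq_norm_sq])
  rw [e1, e1, e2, nsmul_eq_mul] at h1
  have hI : 0 ≤ ∫ x, inner ℝ (gradient v x) (gradient v x) := by rw [← e2]; positivity
  have h2 : (n : ℝ) * (4 * ε) ≤ η := by
    rw [hε]
    have : (n : ℝ) * (4 * (η / (4 * (n + 1)))) = η * (n / (n + 1)) := by field_simp
    rw [this]
    refine mul_le_of_le_one_right hη.le ?_
    rw [div_le_one (by positivity)]; linarith
  nlinarith [mul_le_mul_of_nonneg_right h2 hI]

end PlaneCurve

end

section

/-! ### Test functions as elements of the form domain -/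

lemma IsTestFunction.isWeakGradient {v : Plane → ℝ} (hv : IsTestFunction v) :
    IsWeakGradient v (gradient v) := by
  intro η hη hηc
  have hη' : IsTestFunction η := ⟨hη, hηc⟩
  have hi1 : Integrable (fun x => v x • gradient η x) :=
    (hv.1.continuous.smul (continuous_gradient hη)).integrable_of_hasCompactSupport
      hv.2.smul_right
  have hi2 : Integrable (fun x => η x • gradient v x) :=
    (hη.continuous.smul (continuous_gradient hv.1)).integrable_of_hasCompactSupport
      hηc.smul_right
  refine ext_inner_left ℝ fun y => ?_
  rw [inner_neg_right, ← integral_inner hi1, ← integral_inner hi2]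
  have e1 : ∀ x, inner ℝ y (v x • gradient η x) = v x * fderiv ℝ η x y := fun x => by
    rw [inner_smul_right, real_inner_comm, inner_gradient]
  have e2 : ∀ x, inner ℝ y (η x • gradient v x) = fderiv ℝ v x y * η x := fun x => by
    rw [inner_smul_right, real_inner_comm, inner_gradient, mul_comm]
  simp only [e1, e2]
  have hdv : Continuous fun x => fderiv ℝ v x y :=
    (hv.1.continuous_fderiv (by norm_num)).clm_apply continuous_const
  have hdη : Continuous fun x => fderiv ℝ η x y :=
    (hη.continuous_fderiv (by norm_num)).clm_apply continuous_const
  refine integral_mul_fderiv_eq_neg_fderiv_mul_of_integrable ?_ ?_ ?_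
    (fun x _ => hv.1.differentiable (by norm_num) x)
    (fun x _ => hη.differentiable (by norm_num) x)
  · exact (hdv.mul hη.continuous).integrable_of_hasCompactSupport hηc.mul_left
  · exact (hv.1.continuous.mul hdη).integrable_of_hasCompactSupport hv.2.mul_right
  · exact (hv.1.continuous.mul hη.continuous).integrable_of_hasCompactSupport hηc.mul_left

lemma IsTestFunction.isFormElement (Γ : PlaneCurve) {v : Plane → ℝ} (hv : IsTestFunction v) :
    IsFormElement Γ v (gradient v) v where
  memLp := hv.memLp _
  memLp_grad := hv.memLp_gradient
  weakGradient := hv.isWeakGradient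
  trace := ⟨hv.memLp _, fun _ => v, fun _ => hv, by simp, by simp, by simp⟩

/-! ### The quadratic form -/

section Form

variable {X E : Type*} [MeasurableSpace X] {μ : Measure X} [NormedAddCommGroup E]

lemma tendsto_eLpNorm_add_smul [NormedSpace ℝ E] {v v' : ℕ → X → E} {u u' : X → E} (c : ℝ)
    (hm : ∀ n, AEStronglyMeasurable (fun x => v n x - u x) μ)
    (hm' : ∀ n, AEStronglyMeasurable (fun x => v' n x - u' x) μ)
    (h : Tendsto (fun n => eLpNorm (fun x => v n x - u x) 2 μ) atTop (𝓝 0))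
    (h' : Tendsto (fun n => eLpNorm (fun x => v' n x - u' x) 2 μ) atTop (𝓝 0)) :
    Tendsto (fun n => eLpNorm (fun x => (v n x + c • v' n x) - (u x + c • u' x)) 2 μ) atTop
      (𝓝 0) := by
  have hlim : Tendsto (fun n => eLpNorm (fun x => v n x - u x) 2 μ +
      ‖c‖ₑ * eLpNorm (fun x => v' n x - u' x) 2 μ) atTop (𝓝 (0 + ‖c‖ₑ * 0)) :=
    h.add (ENNReal.Tendsto.const_mul h' (Or.inr enorm_ne_top))
  rw [mul_zero, add_zero] at hlim
  refine tendsto_of_tendsto_of_tendsto_of_le_of_le tendsto_const_nhds hlim (fun _ => zero_le)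
    fun n => ?_
  have e : (fun x => (v n x + c • v' n x) - (u x + c • u' x)) =
      (fun x => v n x - u x) + c • (fun x => v' n x - u' x) := by
    ext x; simp only [Pi.add_apply, Pi.smul_apply, smul_sub]; abel
  rw [e]
  refine (eLpNorm_add_le (hm n) ((hm' n).const_smul c) (by norm_num)).trans ?_
  rw [eLpNorm_const_smul]

lemma integral_inner_add_smul [InnerProductSpace ℝ E] {f f' : X → E} (hf : MemLp f 2 μ)
    (hf' : MemLp f' 2 μ) (c : ℝ) :
    ∫ x, inner ℝ (f x + c • f' x) (f x + c • f' x) ∂μ =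
      (∫ x, inner ℝ (f x) (f x) ∂μ) + 2 * c * (∫ x, inner ℝ (f x) (f' x) ∂μ) +
        c ^ 2 * ∫ x, inner ℝ (f' x) (f' x) ∂μ := by
  rw [← integral_const_mul, ← integral_const_mul, ← integral_add, ← integral_add]
  · refine integral_congr_ae (Eventually.of_forall fun x => ?_)
    simp only [inner_add_left, inner_add_right, inner_smul_left, inner_smul_right,
      real_inner_comm (f x) (f' x), conj_trivial]
    ring
  · exact (integrable_inner_of_memLp hf hf).add ((integrable_inner_of_memLp hf hf').const_mul _)
  · exact (integrable_inner_of_memLp hf' hf').const_mul _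
  · exact integrable_inner_of_memLp hf hf
  · exact (integrable_inner_of_memLp hf hf').const_mul _

lemma integral_mul_add_smul {f f' : X → ℝ} (hf : MemLp f 2 μ) (hf' : MemLp f' 2 μ) (c : ℝ) :
    ∫ x, (f x + c * f' x) * (f x + c * f' x) ∂μ =
      (∫ x, f x * f x ∂μ) + 2 * c * (∫ x, f x * f' x ∂μ) + c ^ 2 * ∫ x, f' x * f' x ∂μ := by
  have := integral_inner_add_smul hf hf' c
  simpa [mul_comm, ← sq] using this

end Form

variable {Γ : PlaneCurve} {α : ℝ}

lemma IsWeakGradient.add_smul {u u' : Plane → ℝ} {G G' : Plane → Plane} (h : IsWeakGradient u G)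
    (h' : IsWeakGradient u' G') (hu : MemLp u 2 volume) (hu' : MemLp u' 2 volume)
    (hG : MemLp G 2 volume) (hG' : MemLp G' 2 volume) (c : ℝ) :
    IsWeakGradient (fun x => u x + c * u' x) (fun x => G x + c • G' x) := by
  intro η hη hηc
  have hη' : IsTestFunction η := ⟨hη, hηc⟩
  have hi : ∀ {u : Plane → ℝ} {W : Plane → Plane}, MemLp u 2 volume → MemLp W 2 volume →
      Integrable (fun x => u x • W x) := fun hu hW =>
    memLp_one_iff_integrable.1 (hW.smul hu)
  have i1 := hi hu hη'.memLp_gradient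
  have i2 := hi hu' hη'.memLp_gradient
  have i3 := hi (hη'.memLp volume) hG
  have i4 := hi (hη'.memLp volume) hG'
  have e1 : ∫ x, (u x + c * u' x) • gradient η x =
      (∫ x, u x • gradient η x) + c • ∫ x, u' x • gradient η x := by
    rw [← integral_smul]
    refine Eq.trans ?_ (integral_add i1 (i2.smul c))
    simp only [_root_.add_smul, mul_smul]
  have e2 : ∫ x, η x • (G x + c • G' x) = (∫ x, η x • G x) + c • ∫ x, η x • G' x := by
    rw [← integral_smul]
    refine Eq.trans ?_ (integral_add i3 (i4.smul c))
    simp only [smul_add, smul_comm (η _) c]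
  rw [e1, e2, h η hη hηc, h' η hη hηc, smul_neg, neg_add]

lemma IsFormElement.add_smul {u u' : Plane → ℝ} {G G' : Plane → Plane} {g g' : Plane → ℝ}
    (h : IsFormElement Γ u G g) (h' : IsFormElement Γ u' G' g') (c : ℝ) :
    IsFormElement Γ (fun x => u x + c * u' x) (fun x => G x + c • G' x)
      (fun x => g x + c * g' x) where
  memLp := h.memLp.add (h'.memLp.const_mul c)
  memLp_grad := h.memLp_grad.add (h'.memLp_grad.const_smul c)
  weakGradient := h.weakGradient.add_smul h'.weakGradient h.memLp h'.memLp h.memLp_grad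
    h'.memLp_grad c
  trace := by
    obtain ⟨hg, v, hv, h1, h2, h3⟩ := h.trace
    obtain ⟨hg', v', hv', h1', h2', h3'⟩ := h'.trace
    refine ⟨hg.add (hg'.const_mul c), fun n x => v n x + c * v' n x, fun n => ⟨?_, ?_⟩, ?_, ?_, ?_⟩
    · exact (hv n).1.add (contDiff_const.mul (hv' n).1)
    · exact (hv n).2.add (hv' n).2.mul_left
    · exact tendsto_eLpNorm_add_smul c (fun n => ((hv n).1.continuous.aestronglyMeasurable).sub
        h.memLp.1) (fun n => ((hv' n).1.continuous.aestronglyMeasurable).sub h'.memLp.1) h1 h1'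
    · have hgr : ∀ n x, gradient (fun x => v n x + c * v' n x) x =
          gradient (v n) x + c • gradient (v' n) x := by
        intro n x
        have d1 := ((hv n).1.differentiable (by norm_num) x)
        have d2 := ((hv' n).1.differentiable (by norm_num) x)
        simp only [gradient]
        rw [fderiv_fun_add d1 (d2.const_mul c), fderiv_const_mul d2, map_add, map_smul]
      simp only [hgr]
      exact tendsto_eLpNorm_add_smul c
        (fun n => ((continuous_gradient (hv n).1).aestronglyMeasurable).sub h.memLp_grad.1)
        (fun n => ((continuous_gradient (hv' n).1).aestronglyMeasurable).sub h'.memLp_grad.1) h2 h2'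
    · exact tendsto_eLpNorm_add_smul c (fun n => ((hv n).1.continuous.aestronglyMeasurable).sub
        hg.1) (fun n => ((hv' n).1.continuous.aestronglyMeasurable).sub hg'.1) h3 h3'

/-- `E` is a lower bound of the form. -/
def IsFormLowerBound (Γ : PlaneCurve) (α E : ℝ) : Prop :=
  ∀ u G g, IsFormElement Γ u G g → E * ∫ x, u x * u x ≤ form Γ α G g G g

/-- The Cauchy-Schwarz inequality for a nonnegative form. -/
lemma IsFormLowerBound.sq_le {E : ℝ} (hE : IsFormLowerBound Γ α E) {u u' : Plane → ℝ}
    {G G' : Plane → Plane} {g g' : Plane → ℝ} (h : IsFormElement Γ u G g)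
    (h' : IsFormElement Γ u' G' g') :
    (form Γ α G g G' g' - E * ∫ x, u x * u' x) ^ 2 ≤
      (form Γ α G g G g - E * ∫ x, u x * u x) * (form Γ α G' g' G' g' - E * ∫ x, u' x * u' x) := by
  have hq : ∀ c : ℝ, 0 ≤ (form Γ α G' g' G' g' - E * ∫ x, u' x * u' x) * (c * c) +
      (2 * (form Γ α G g G' g' - E * ∫ x, u x * u' x)) * c +
      (form Γ α G g G g - E * ∫ x, u x * u x) := by
    intro c
    have h1 := hE _ _ _ (h.add_smul h' c)
    simp only [form] at h1 ⊢
    rw [integral_inner_add_smul h.memLp_grad h'.memLp_grad,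
      integral_mul_add_smul h.memLp h'.memLp, integral_mul_add_smul h.trace.1 h'.trace.1] at h1
    linarith
  have := discrim_le_zero hq
  rw [discrim] at this
  linarith

lemma IsFormElement.exists_approx {u : Plane → ℝ} {G : Plane → Plane} {g : Plane → ℝ}
    (h : IsFormElement Γ u G g) : ∃ v : ℕ → Plane → ℝ, (∀ n, IsTestFunction (v n)) ∧
      Tendsto (fun n => eLpNorm (fun x => v n x - u x) 2 volume) atTop (𝓝 0) ∧
      Tendsto (fun n => eLpNorm (fun x => v n x - g x) 2 Γ.sigma) atTop (𝓝 0) ∧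
      Tendsto (fun n => ∫ x, inner ℝ (gradient (v n) x) (gradient (v n) x)) atTop
        (𝓝 (∫ x, inner ℝ (G x) (G x))) ∧
      Tendsto (fun n => ∫ x, v n x * v n x) atTop (𝓝 (∫ x, u x * u x)) ∧
      Tendsto (fun n => ∫ x, v n x * v n x ∂Γ.sigma) atTop (𝓝 (∫ x, g x * g x ∂Γ.sigma)) := by
  obtain ⟨hg, v, hv, h1, h2, h3⟩ := h.trace
  have hv' : ∀ n, IsTestFunction (v n) := hv
  exact ⟨v, hv, h1, h3,
    tendsto_integral_inner (fun n => (hv' n).memLp_gradient) h.memLp_grad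
      (fun n => (hv' n).memLp_gradient) h.memLp_grad h2 h2,
    tendsto_integral_mul (fun n => (hv' n).memLp _) h.memLp (fun n => (hv' n).memLp _) h.memLp h1 h1,
    tendsto_integral_mul (fun n => (hv' n).memLp _) hg (fun n => (hv' n).memLp _) hg h3 h3⟩

/-- The trace inequality with gradient constant `1/α` lets the kinetic term absorb the curve term on
test functions; the bound passes to the limit in the form domain. -/
lemma exists_isFormLowerBound (Γ : PlaneCurve) (hα : 0 < α) : ∃ E, IsFormLowerBound Γ α E := by
  obtain ⟨C, hC⟩ := Γ.exists_trace_bound (η := α⁻¹) (by positivity)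
  refine ⟨-(α * C), fun u G g h => ?_⟩
  obtain ⟨v, hv, -, -, t1, t2, t3⟩ := h.exists_approx
  have hle : ∀ n, -(α * C) * ∫ x, v n x * v n x ≤
      (∫ x, inner ℝ (gradient (v n) x) (gradient (v n) x)) -
        α * ∫ x, v n x * v n x ∂Γ.sigma := by
    intro n
    have h1 := mul_le_mul_of_nonneg_left (hC (v n) (hv n)) hα.le
    rw [mul_add, ← mul_assoc, mul_inv_cancel₀ hα.ne', one_mul] at h1
    linarith
  exact le_of_tendsto_of_tendsto' (t2.const_mul _) (t1.sub (t3.const_mul _)) hle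

lemma integral_sq_pos {u : Plane → ℝ} (hu : MemLp u 2 volume) (h0 : ¬ u =ᵐ[volume] 0) :
    0 < ∫ x, u x * u x := by
  have hi : Integrable (fun x => u x * u x) := by
    have := hu.integrable_sq
    simpa only [sq] using this
  rw [integral_pos_iff_support_of_nonneg (fun x => mul_self_nonneg _) hi]
  refine pos_iff_ne_zero.2 fun h => h0 ?_
  have : Function.support (fun x => u x * u x) = {x | ¬ u x = 0} := by
    ext x; simp
  rw [this] at h
  exact h

lemma HamiltonianMaps.memLp {ψ h : Plane → ℝ} (hψ : HamiltonianMaps Γ α ψ h) :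
    MemLp ψ 2 volume := by
  obtain ⟨-, G, g, hf, -⟩ := hψ
  exact hf.memLp

lemma IsEigenfunction.form_eq {E : ℝ} {ψ : Plane → ℝ} (hψ : IsEigenfunction Γ α E ψ) :
    ∃ G g, IsFormElement Γ ψ G g ∧ ∀ φ G' g', IsFormElement Γ φ G' g' →
      form Γ α G g G' g' = E * ∫ x, ψ x * φ x := by
  obtain ⟨-, -, G, g, hf, h⟩ := hψ
  refine ⟨G, g, hf, fun φ G' g' hφ => ?_⟩
  rw [h φ G' g' hφ, ← integral_const_mul]
  simp only [mul_assoc]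

/-- The lowest eigenvalue is a lower bound for the form. -/
lemma TwoLowestEigenvalues.isFormLowerBound (hα : 0 < α) {E₀ E₁ : ℝ}
    (h : TwoLowestEigenvalues Γ α E₀ E₁) : IsFormLowerBound Γ α E₀ := by
  -- The supremum `m` of all lower bounds is itself one and is at most `E₀`. If it were smaller, it
  -- would lie in the resolvent set, and boundedness of the resolvent would allow a larger lower
  -- bound.
  set S : Set ℝ := {E | IsFormLowerBound Γ α E} with hS
  have hne : S.Nonempty := exists_isFormLowerBound Γ hα
  have hub : ∀ E ∈ S, E ≤ E₀ := by
    intro E hE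
    obtain ⟨ψ, hψ⟩ := h.eigenvalue₀
    obtain ⟨G, g, hf, hform⟩ := hψ.form_eq
    have h1 := hE ψ G g hf
    rw [hform ψ G g hf] at h1
    exact le_of_mul_le_mul_right h1 (integral_sq_pos hf.memLp hψ.1)
  have hbdd : BddAbove S := ⟨E₀, hub⟩
  set m := sSup S with hm
  have hmS : IsFormLowerBound Γ α m := by
    intro u G g hu
    have hI : 0 ≤ ∫ x, u x * u x := integral_nonneg fun x => mul_self_nonneg _
    rcases hI.eq_or_lt with h0 | h0
    · obtain ⟨E, hE⟩ := hne
      have := hE u G g hu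
      rw [← h0, mul_zero] at this ⊢
      exact this
    · rw [← le_div_iff₀ h0]
      refine csSup_le hne fun E hE => ?_
      rw [le_div_iff₀ h0]
      exact hE u G g hu
  have hmE : m ≤ E₀ := csSup_le hne hub
  rcases hmE.eq_or_lt with heq | hlt
  · rwa [← heq]
  exfalso
  obtain ⟨ε, hε, hbot⟩ := h.bottom
  have hres : InResolventSet Γ α m := by
    by_contra hc
    have : m ∈ hSpectrum Γ α ∩ Iio (E₁ + ε) := ⟨hc, by
      have := h.lt
      simp only [mem_Iio]; linarith⟩
    rw [hbot] at this
    rcases this with h1 | h1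
    · exact hlt.ne h1
    · rw [mem_singleton_iff] at h1
      have := h.lt
      linarith
  obtain ⟨C, hC⟩ := hres
  set C' := max C 1 with hC'
  have hC'1 : 1 ≤ C' := le_max_right _ _
  -- Let `q` be the form minus `m` times the norm square, and let `ψ` solve `(H - m) ψ = φ`. The
  -- Cauchy-Schwarz inequality for `q` reads `‖φ‖⁴ ≤ ⟨φ, ψ⟩ q(φ) ≤ C' ‖φ‖² q(φ)`, so `q(φ) ≥ ‖φ‖² /
  -- C'`.
  have hmem : m + 1 / C' ∈ S := by
    intro φ G' g' hφ
    obtain ⟨ψ, hψ, hbd, -⟩ := hC φ hφ.memLp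
    obtain ⟨-, G, g, hf, hform⟩ := hψ
    have iφφ : Integrable (fun x => φ x * φ x) := by
      simpa only [sq] using hφ.memLp.integrable_sq
    have iψψ : Integrable (fun x => ψ x * ψ x) := by
      simpa only [sq] using hf.memLp.integrable_sq
    have iφψ : Integrable (fun x => φ x * ψ x) := by
      have := integrable_inner_of_memLp hf.memLp hφ.memLp
      simpa using this
    have key : ∀ w G'' g'', IsFormElement Γ w G'' g'' →
        form Γ α G g G'' g'' - m * ∫ x, ψ x * w x = ∫ x, φ x * w x := by
      intro w G'' g'' hw
      have i1 : Integrable (fun x => φ x * w x) := by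
        have := integrable_inner_of_memLp hw.memLp hφ.memLp
        simpa using this
      have i2 : Integrable (fun x => m * (ψ x * w x)) := by
        have := integrable_inner_of_memLp hw.memLp hf.memLp
        exact Integrable.const_mul (by simpa using this) m
      rw [hform w G'' g'' hw, ← integral_const_mul, ← integral_sub _ i2]
      · congr 1; ext x; ring
      · refine (i1.add i2).congr (Eventually.of_forall fun x => ?_)
        simp only [Pi.add_apply]; ring
    have hcs := hmS.sq_le hf hφ
    rw [key _ _ _ hφ, key _ _ _ hf] at hcs
    have hQ := hmS φ G' g' hφ
    have hI : 0 ≤ ∫ x, φ x * φ x := integral_nonneg fun x => mul_self_nonneg _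
    have hψφ : ∫ x, ψ x * ψ x ≤ C' ^ 2 * ∫ x, φ x * φ x := by
      have h1 : eLpNorm ψ 2 volume ^ 2 ≤ (ENNReal.ofReal C' * eLpNorm φ 2 volume) ^ 2 := by
        gcongr
        refine hbd.trans ?_
        gcongr
        exact le_max_left _ _
      rw [mul_pow, eLpNorm_two_sq, eLpNorm_two_sq, lintegral_sq_eq_ofReal hf.memLp,
        lintegral_sq_eq_ofReal hφ.memLp, ← ENNReal.ofReal_pow (by linarith),
        ← ENNReal.ofReal_mul (by positivity), ENNReal.ofReal_le_ofReal_iff (by positivity)] at h1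
      simpa only [Real.norm_eq_abs, sq_abs, sq (ψ _), sq (φ _)] using h1
    have hφψ : ∫ x, φ x * ψ x ≤ C' * ∫ x, φ x * φ x := by
      have h1 : ∫ x, φ x * ψ x ≤ ∫ x, (C' / 2 * (φ x * φ x) + 1 / (2 * C') * (ψ x * ψ x)) := by
        refine integral_mono iφψ ((iφφ.const_mul _).add (iψψ.const_mul _)) fun x => ?_
        have hC0 : 0 < C' := by linarith
        have h2 : C' / 2 * (φ x * φ x) + 1 / (2 * C') * (ψ x * ψ x) - φ x * ψ x =
            1 / (2 * C') * (C' * φ x - ψ x) ^ 2 := by field_simp; ring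
        have h3 : 0 ≤ 1 / (2 * C') * (C' * φ x - ψ x) ^ 2 := by positivity
        simp only
        linarith
      rw [integral_add (iφφ.const_mul _) (iψψ.const_mul _), integral_const_mul,
        integral_const_mul] at h1
      have h2 : 1 / (2 * C') * ∫ x, ψ x * ψ x ≤ 1 / (2 * C') * (C' ^ 2 * ∫ x, φ x * φ x) := by
        gcongr
      have h3 : 1 / (2 * C') * (C' ^ 2 * ∫ x, φ x * φ x) = C' / 2 * ∫ x, φ x * φ x := by
        have hC0 : 0 < C' := by linarith
        field_simp
      linarith
    rcases hI.eq_or_lt with h0 | h0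
    · rw [← h0, mul_zero] at hQ ⊢
      exact hQ
    · have h1 : (∫ x, φ x * φ x) ^ 2 ≤ C' * (∫ x, φ x * φ x) *
          (form Γ α G' g' G' g' - m * ∫ x, φ x * φ x) :=
        hcs.trans (mul_le_mul_of_nonneg_right hφψ (by linarith))
      have h2 : ∫ x, φ x * φ x ≤ C' * (form Γ α G' g' G' g' - m * ∫ x, φ x * φ x) := by
        refine le_of_mul_le_mul_left ?_ h0
        linarith
      have h3 : 1 / C' * ∫ x, φ x * φ x ≤ form Γ α G' g' G' g' - m * ∫ x, φ x * φ x := by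
        rw [one_div, inv_mul_le_iff₀ (by linarith)]
        exact h2
      linarith
  have h1 := le_csSup hbdd hmem
  have : 0 < 1 / C' := by positivity
  linarith

lemma integral_mul_eq_zero_of_isEigenfunction {E₀ E₁ : ℝ} (hne : E₀ ≠ E₁) {ψ₀ ψ₁ : Plane → ℝ}
    (h₀ : IsEigenfunction Γ α E₀ ψ₀) (h₁ : IsEigenfunction Γ α E₁ ψ₁) :
    ∫ x, ψ₀ x * ψ₁ x = 0 := by
  obtain ⟨G₀, g₀, hf₀, hform₀⟩ := h₀.form_eq
  obtain ⟨G₁, g₁, hf₁, hform₁⟩ := h₁.form_eq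
  have e0 := hform₀ _ _ _ hf₁
  have e1 := hform₁ _ _ _ hf₀
  have hsym : form Γ α G₀ g₀ G₁ g₁ = form Γ α G₁ g₁ G₀ g₀ := by
    simp only [form, real_inner_comm, mul_comm]
  have hs : ∫ x, ψ₁ x * ψ₀ x = ∫ x, ψ₀ x * ψ₁ x := by simp only [mul_comm]
  rw [hsym, e1, hs] at e0
  have : (E₁ - E₀) * ∫ x, ψ₀ x * ψ₁ x = 0 := by linarith
  rcases mul_eq_zero.1 this with h | h
  · exact absurd (by linarith) hne
  · exact h

end

section

/-! ### The equation in the sense of distributions -/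

/-- The directional derivative along the `i`-th coordinate. -/
def partialDeriv (i : Fin 2) (φ : Plane → ℝ) (x : Plane) : ℝ :=
  fderiv ℝ φ x (EuclideanSpace.single i 1)

/-- The Laplacian in terms of coordinates. -/
def lap (φ : Plane → ℝ) (x : Plane) : ℝ :=
  partialDeriv 0 (partialDeriv 0 φ) x + partialDeriv 1 (partialDeriv 1 φ) x

lemma IsTestFunction.partialDeriv {φ : Plane → ℝ} (hφ : IsTestFunction φ) (i : Fin 2) :
    IsTestFunction (partialDeriv i φ) :=
  ⟨(hφ.1.fderiv_right (m := ∞) (by norm_num)).clm_apply contDiff_const,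
    hφ.2.fderiv_apply (𝕜 := ℝ) _⟩

lemma IsTestFunction.lap {φ : Plane → ℝ} (hφ : IsTestFunction φ) : IsTestFunction (lap φ) :=
  ⟨(((hφ.partialDeriv 0).partialDeriv 0).1.add ((hφ.partialDeriv 1).partialDeriv 1).1),
    (((hφ.partialDeriv 0).partialDeriv 0).2.add ((hφ.partialDeriv 1).partialDeriv 1).2)⟩

lemma gradient_apply (φ : Plane → ℝ) (x : Plane) (i : Fin 2) :
    gradient φ x i = partialDeriv i φ x := by
  rw [partialDeriv, ← inner_gradient, EuclideanSpace.inner_single_right]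
  simp

lemma IsWeakGradient.integral_mul_lap {u : Plane → ℝ} {G : Plane → Plane}
    (h : IsWeakGradient u G) (hu : MemLp u 2 volume) (hG : MemLp G 2 volume) {φ : Plane → ℝ}
    (hφ : IsTestFunction φ) :
    ∫ x, u x * lap φ x = - ∫ x, inner ℝ (G x) (gradient φ x) := by
  have hi : ∀ {u : Plane → ℝ} {W : Plane → Plane}, MemLp u 2 volume → MemLp W 2 volume →
      Integrable (fun x => u x • W x) := fun hu hW =>
    memLp_one_iff_integrable.1 (hW.smul hu)
  have key : ∀ i : Fin 2, ∫ x, u x * partialDeriv i (partialDeriv i φ) x =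
      - ∫ x, partialDeriv i φ x * G x i := by
    intro i
    have hη := hφ.partialDeriv i
    have i1 := hi hu hη.memLp_gradient
    have i2 := hi (hη.memLp volume) hG
    have h1 := congrArg (fun v => inner ℝ (EuclideanSpace.single i (1 : ℝ)) v) (h _ hη.1 hη.2)
    simp only [inner_neg_right] at h1
    rw [← integral_inner i1, ← integral_inner i2] at h1
    simpa [EuclideanSpace.inner_single_left, gradient_apply] using h1
  have hint1 : ∀ i, Integrable fun x => u x * partialDeriv i (partialDeriv i φ) x := fun i => by
    have := integrable_inner_of_memLp (((hφ.partialDeriv i).partialDeriv i).memLp volume) hu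
    simpa using this
  have hint2 : ∀ i, Integrable fun x => partialDeriv i φ x * G x i := fun i => by
    have hGi : MemLp (fun x => G x i) 2 volume := by
      have := hG.const_inner (𝕜 := ℝ) (EuclideanSpace.single i (1 : ℝ))
      simpa [EuclideanSpace.inner_single_left] using this
    have := integrable_inner_of_memLp hGi ((hφ.partialDeriv i).memLp volume)
    simpa using this
  simp only [lap, mul_add]
  rw [integral_add (hint1 0) (hint1 1), key, key, ← neg_add, ← integral_add (hint2 0) (hint2 1)]
  congr 2
  ext x
  rw [inner_eq, gradient_apply, gradient_apply]
  ring

/-- `u` is continuous, bounded by one, and solves `-Δ u + κ² u = α u σ` in the sense of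
distributions. -/
structure IsDistSolution (Γ : PlaneCurve) (α κ : ℝ) (u : Plane → ℝ) : Prop where
  continuous : Continuous u
  le_one : ∀ x, |u x| ≤ 1
  eq : ∀ φ, IsTestFunction φ →
    ∫ x, u x * lap φ x = κ ^ 2 * (∫ x, u x * φ x) - α * ∫ x, u x * φ x ∂Γ.sigma

variable {Γ : PlaneCurve} {α : ℝ}

/-- Test functions belong to the form domain, and the trace of the continuous function `ψ` is its
restriction. -/
lemma IsEigenfunction.isDistSolution {E : ℝ} {ψ : Plane → ℝ} (h : IsEigenfunction Γ α E ψ)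
    (hc : Continuous ψ) (hle : ∀ x, |ψ x| ≤ 1) {κ : ℝ} (hκ : κ ^ 2 = -E) :
    IsDistSolution Γ α κ ψ := by
  obtain ⟨G, g, hf, hform⟩ := h.form_eq
  refine ⟨hc, hle, fun φ hφ => ?_⟩
  have htr := Γ.trace_ae_eq hc hf.memLp_grad hf.trace
  have h1 := hform φ _ _ (hφ.isFormElement Γ)
  rw [form] at h1
  have h2 : ∫ x, g x * φ x ∂Γ.sigma = ∫ x, ψ x * φ x ∂Γ.sigma :=
    integral_congr_ae (by filter_upwards [htr] with x hx; rw [hx])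
  rw [hf.weakGradient.integral_mul_lap hf.memLp hf.memLp_grad hφ, hκ]
  rw [h2] at h1
  linarith

/-! ### The absolute value of a ground state -/

/-- This is a smooth substitute for `|v|`. It vanishes where `v` does, and its gradient is nowhere
larger than that of `v`. -/
lemma isTestFunction_sqrt {v : Plane → ℝ} (hv : IsTestFunction v) {ε : ℝ} (hε : 0 < ε) :
    IsTestFunction fun x => √(v x ^ 2 + ε ^ 2) - ε := by
  constructor
  · refine ContDiff.sub (ContDiff.sqrt ((hv.1.pow 2).add contDiff_const) fun x => ?_) contDiff_const
    positivity
  · refine hv.2.comp_left (g := fun r => √(r ^ 2 + ε ^ 2) - ε) ?_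
    simp [Real.sqrt_sq hε.le]

lemma norm_gradient_sqrt_le {v : Plane → ℝ} (hv : ContDiff ℝ ∞ v) {ε : ℝ} (hε : 0 < ε)
    (x : Plane) : ‖gradient (fun x => √(v x ^ 2 + ε ^ 2) - ε) x‖ ≤ ‖gradient v x‖ := by
  rw [norm_gradient, norm_gradient]
  have h1 : HasFDerivAt v (fderiv ℝ v x) x := (hv.differentiable (by norm_num) x).hasFDerivAt
  have h2 : HasDerivAt (fun r : ℝ => √(r ^ 2 + ε ^ 2) - ε) (v x / √(v x ^ 2 + ε ^ 2)) (v x) := by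
    have h3 : HasDerivAt (fun r : ℝ => r ^ 2 + ε ^ 2) (2 * v x) (v x) := by
      simpa using! (hasDerivAt_pow 2 (v x)).add_const (ε ^ 2)
    refine ((h3.sqrt (by positivity)).sub_const ε).congr_deriv ?_
    rw [mul_div_mul_left _ _ two_ne_zero]
  have h4 := h2.comp_hasFDerivAt x h1
  have h5 : fderiv ℝ (fun x => √(v x ^ 2 + ε ^ 2) - ε) x =
      (v x / √(v x ^ 2 + ε ^ 2)) • fderiv ℝ v x := h4.fderiv
  rw [h5, norm_smul]
  refine mul_le_of_le_one_left (norm_nonneg _) ?_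
  rw [Real.norm_eq_abs, abs_div, abs_of_nonneg (Real.sqrt_nonneg _)]
  refine div_le_one_of_le₀ (Real.abs_le_sqrt ?_) (Real.sqrt_nonneg _)
  nlinarith

lemma sqrt_sub_abs_sq_le (a : ℝ) {ε : ℝ} (hε : 0 < ε) :
    (√(a ^ 2 + ε ^ 2) - ε - |a|) ^ 2 ≤ ε * |a| := by
  have h1 : |a| ≤ √(a ^ 2 + ε ^ 2) := Real.abs_le_sqrt (by nlinarith)
  have h2 : ε ≤ √(a ^ 2 + ε ^ 2) := Real.le_sqrt_of_sq_le (by nlinarith)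
  have h3 : √(a ^ 2 + ε ^ 2) ≤ |a| + ε := by
    refine Real.sqrt_le_iff.2 ⟨by positivity, ?_⟩
    rw [← sq_abs a]
    nlinarith [mul_nonneg (abs_nonneg a) hε.le]
  nlinarith

/-- Approximation of `|u|` in two measures by test functions with controlled gradients. -/
lemma exists_abs_approx {v : Plane → ℝ} (hv : IsTestFunction v) (μ : Measure Plane)
    [IsFiniteMeasureOnCompacts μ] {δ : ℝ} (hδ : 0 < δ) :
    ∃ ε₀ > 0, ∀ ε, 0 < ε → ε ≤ ε₀ →
      ∫⁻ x, ‖√(v x ^ 2 + ε ^ 2) - ε - |v x|‖ₑ ^ 2 ∂μ ≤ ENNReal.ofReal δ := by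
  have hi : Integrable (fun x => |v x|) μ :=
    (hv.1.continuous.integrable_of_hasCompactSupport hv.2).abs
  set J := ∫ x, |v x| ∂μ with hJ
  have hJ0 : 0 ≤ J := integral_nonneg fun x => abs_nonneg _
  refine ⟨δ / (J + 1), by positivity, fun ε hε hle => ?_⟩
  calc ∫⁻ x, ‖√(v x ^ 2 + ε ^ 2) - ε - |v x|‖ₑ ^ 2 ∂μ
      ≤ ∫⁻ x, ENNReal.ofReal (ε * |v x|) ∂μ := by
        refine lintegral_mono fun x => ?_
        rw [← ofReal_norm, ← ENNReal.ofReal_pow (norm_nonneg _), Real.norm_eq_abs, sq_abs]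
        exact ENNReal.ofReal_le_ofReal (sqrt_sub_abs_sq_le _ hε)
    _ = ENNReal.ofReal (ε * J) := by
        rw [← ofReal_integral_eq_lintegral_ofReal (hi.const_mul ε)
          (Eventually.of_forall fun x => by positivity), integral_const_mul]
    _ ≤ ENNReal.ofReal δ := by
        refine ENNReal.ofReal_le_ofReal ?_
        calc ε * J ≤ δ / (J + 1) * (J + 1) := by gcongr; linarith
          _ = δ := by field_simp

lemma tendsto_eLpNorm_abs {μ : Measure Plane} {v w : ℕ → Plane → ℝ} {u : Plane → ℝ}
    (hv : ∀ n, Continuous (v n)) (hw : ∀ n, Continuous (w n)) (hu : AEStronglyMeasurable u μ)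
    (h : Tendsto (fun n => eLpNorm (fun x => v n x - u x) 2 μ) atTop (𝓝 0))
    (hle : ∀ n : ℕ, ∫⁻ x, ‖w n x - |v n x|‖ₑ ^ 2 ∂μ ≤ ENNReal.ofReal (1 / (n + 1))) :
    Tendsto (fun n => eLpNorm (fun x => w n x - |u x|) 2 μ) atTop (𝓝 0) := by
  have h1 : Tendsto (fun n => eLpNorm (fun x => w n x - |v n x|) 2 μ) atTop (𝓝 0) := by
    have h2 : Tendsto (fun n => eLpNorm (fun x => w n x - |v n x|) 2 μ ^ 2) atTop (𝓝 0) := by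
      simp only [eLpNorm_two_sq]
      refine tendsto_of_tendsto_of_tendsto_of_le_of_le tendsto_const_nhds ?_ (fun _ => zero_le) hle
      have := (ENNReal.continuous_ofReal.tendsto 0).comp
        (tendsto_one_div_add_atTop_nhds_zero_nat (𝕜 := ℝ))
      simpa using! this
    have h3 := (ENNReal.continuous_rpow_const (y := 1 / 2)).tendsto 0 |>.comp h2
    have e : ∀ a : ENNReal, (a ^ 2) ^ (1 / 2 : ℝ) = a := fun a => by
      rw [← ENNReal.rpow_natCast, ← ENNReal.rpow_mul]; simp
    simp only [Function.comp_def, e] at h3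
    simpa using h3
  have hlim := h1.add h
  rw [add_zero] at hlim
  refine tendsto_of_tendsto_of_tendsto_of_le_of_le tendsto_const_nhds hlim (fun _ => zero_le)
    fun n => ?_
  have e : (fun x => w n x - |u x|) = (fun x => w n x - |v n x|) + fun x => |v n x| - |u x| := by
    ext x; simp
  rw [e]
  refine (eLpNorm_add_le ?_ ?_ (by norm_num)).trans (add_le_add le_rfl (eLpNorm_mono fun x => ?_))
  · exact ((hw n).sub (hv n).abs).aestronglyMeasurable
  · exact (hv n).abs.aestronglyMeasurable.sub hu.norm
  · exact abs_abs_sub_abs_le _ _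

/-- Passing to the modulus does not raise the kinetic energy and leaves the other terms unchanged,
so `|ψ|` minimizes the form as well, and a minimizer satisfies the Euler equation. The argument is
carried out on approximating test functions `w n`, so that neither a weak gradient nor a trace of
`|ψ|` has to be constructed. -/
lemma IsEigenfunction.isDistSolution_abs {E : ℝ} {ψ : Plane → ℝ} (h : IsEigenfunction Γ α E ψ)
    (hE : IsFormLowerBound Γ α E)
    (hc : Continuous ψ) (hle : ∀ x, |ψ x| ≤ 1) {κ : ℝ} (hκ : κ ^ 2 = -E) :
    IsDistSolution Γ α κ fun x => |ψ x| := by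
  obtain ⟨G, g, hf, hform⟩ := h.form_eq
  refine ⟨hc.abs, fun x => by rw [abs_abs]; exact hle x, fun φ hφ => ?_⟩
  have htr := Γ.trace_ae_eq hc hf.memLp_grad hf.trace
  obtain ⟨v, hv, hv1, hv2, t1, t2, t3⟩ := hf.exists_approx
  have hex : ∀ n : ℕ, ∃ ε > 0,
      ∫⁻ x, ‖√(v n x ^ 2 + ε ^ 2) - ε - |v n x|‖ₑ ^ 2 ≤ ENNReal.ofReal (1 / (n + 1)) ∧
      ∫⁻ x, ‖√(v n x ^ 2 + ε ^ 2) - ε - |v n x|‖ₑ ^ 2 ∂Γ.sigma ≤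
        ENNReal.ofReal (1 / (n + 1)) := by
    intro n
    obtain ⟨ε₁, h1, h1'⟩ := exists_abs_approx (hv n) volume (δ := 1 / (n + 1)) (by positivity)
    obtain ⟨ε₂, h2, h2'⟩ := exists_abs_approx (hv n) Γ.sigma (δ := 1 / (n + 1)) (by positivity)
    exact ⟨min ε₁ ε₂, lt_min h1 h2, h1' _ (lt_min h1 h2) (min_le_left _ _),
      h2' _ (lt_min h1 h2) (min_le_right _ _)⟩
  choose ε hε hε1 hε2 using hex
  set w : ℕ → Plane → ℝ := fun n x => √(v n x ^ 2 + ε n ^ 2) - ε n with hw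
  have hwt : ∀ n, IsTestFunction (w n) := fun n => isTestFunction_sqrt (hv n) (hε n)
  have hψabs : MemLp (fun x => |ψ x|) 2 volume := hf.memLp.norm
  have hgabs : MemLp (fun x => |g x|) 2 Γ.sigma := hf.trace.1.norm
  have c1 : Tendsto (fun n => eLpNorm (fun x => w n x - |ψ x|) 2 volume) atTop (𝓝 0) :=
    tendsto_eLpNorm_abs (fun n => (hv n).1.continuous) (fun n => (hwt n).1.continuous)
      hf.memLp.1 hv1 hε1
  have c2 : Tendsto (fun n => eLpNorm (fun x => w n x - |g x|) 2 Γ.sigma) atTop (𝓝 0) :=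
    tendsto_eLpNorm_abs (fun n => (hv n).1.continuous) (fun n => (hwt n).1.continuous)
      hf.trace.1.1 hv2 hε2
  have d1 : Tendsto (fun n => ∫ x, w n x * w n x) atTop (𝓝 (∫ x, |ψ x| * |ψ x|)) :=
    tendsto_integral_mul (fun n => (hwt n).memLp _) hψabs (fun n => (hwt n).memLp _) hψabs c1 c1
  have d2 : Tendsto (fun n => ∫ x, w n x * w n x ∂Γ.sigma) atTop
      (𝓝 (∫ x, |g x| * |g x| ∂Γ.sigma)) :=
    tendsto_integral_mul (fun n => (hwt n).memLp _) hgabs (fun n => (hwt n).memLp _) hgabs c2 c2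
  have hzero : ∀ (ρ : Measure Plane) (f : Plane → ℝ), MemLp f 2 ρ →
      Tendsto (fun _ : ℕ => eLpNorm (fun x => f x - f x) 2 ρ) atTop (𝓝 0) := fun ρ f _ => by simp
  have e1 : Tendsto (fun n => ∫ x, w n x * lap φ x) atTop (𝓝 (∫ x, |ψ x| * lap φ x)) :=
    tendsto_integral_mul (fun n => (hwt n).memLp _) hψabs (fun _ => hφ.lap.memLp _)
      (hφ.lap.memLp _) c1 (hzero _ _ (hφ.lap.memLp _))
  have e2 : Tendsto (fun n => ∫ x, w n x * φ x) atTop (𝓝 (∫ x, |ψ x| * φ x)) :=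
    tendsto_integral_mul (fun n => (hwt n).memLp _) hψabs (fun _ => hφ.memLp _)
      (hφ.memLp _) c1 (hzero _ _ (hφ.memLp _))
  have e3 : Tendsto (fun n => ∫ x, w n x * φ x ∂Γ.sigma) atTop
      (𝓝 (∫ x, |g x| * φ x ∂Γ.sigma)) :=
    tendsto_integral_mul (fun n => (hwt n).memLp _) hgabs (fun _ => hφ.memLp _)
      (hφ.memLp _) c2 (hzero _ _ (hφ.memLp _))
  set Q : ℕ → ℝ := fun n => form Γ α (gradient (w n)) (w n) (gradient (w n)) (w n) -
    E * ∫ x, w n x * w n x with hQ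
  set P : ℕ → ℝ := fun n => form Γ α (gradient (w n)) (w n) (gradient φ) φ -
    E * ∫ x, w n x * φ x with hP
  have hQ0 : ∀ n, 0 ≤ Q n := fun n => sub_nonneg.2 (hE _ _ _ ((hwt n).isFormElement Γ))
  have hQle : ∀ n, Q n ≤ (∫ x, inner ℝ (gradient (v n) x) (gradient (v n) x)) -
      α * (∫ x, w n x * w n x ∂Γ.sigma) - E * ∫ x, w n x * w n x := by
    intro n
    have : ∫ x, inner ℝ (gradient (w n) x) (gradient (w n) x) ≤
        ∫ x, inner ℝ (gradient (v n) x) (gradient (v n) x) := by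
      refine integral_mono
        (integrable_inner_of_memLp (hwt n).memLp_gradient (hwt n).memLp_gradient)
        (integrable_inner_of_memLp (hv n).memLp_gradient (hv n).memLp_gradient) fun x => ?_
      simp only [real_inner_self_eq_norm_sq]
      gcongr
      exact norm_gradient_sqrt_le (hv n).1 (hε n) x
    simp only [hQ, form]
    linarith
  have hQlim : Tendsto Q atTop (𝓝 0) := by
    have hlim := (t1.sub (d2.const_mul α)).sub (d1.const_mul E)
    have h0 := hform _ _ _ hf
    rw [form] at h0
    simp only [abs_mul_abs_self] at hlim
    have hz : (∫ x, inner ℝ (G x) (G x)) - α * (∫ x, g x * g x ∂Γ.sigma) -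
        E * ∫ x, ψ x * ψ x = 0 := by linarith
    rw [hz] at hlim
    exact tendsto_of_tendsto_of_tendsto_of_le_of_le tendsto_const_nhds hlim hQ0 hQle
  -- Since the shifted form is nonnegative, `P n ^ 2` is at most `Q n` times a constant depending on
  -- `φ`, and `Q n → 0`.
  have hP2 : Tendsto (fun n => P n ^ 2) atTop (𝓝 0) := by
    have hlim := hQlim.mul_const (form Γ α (gradient φ) φ (gradient φ) φ - E * ∫ x, φ x * φ x)
    rw [zero_mul] at hlim
    exact tendsto_of_tendsto_of_tendsto_of_le_of_le tendsto_const_nhds hlim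
      (fun n => sq_nonneg _) fun n => hE.sq_le ((hwt n).isFormElement Γ) (hφ.isFormElement Γ)
  have hPlim' : Tendsto P atTop
      (𝓝 (-(∫ x, |ψ x| * lap φ x) - α * (∫ x, |g x| * φ x ∂Γ.sigma) - E * ∫ x, |ψ x| * φ x)) := by
    refine ((e1.neg.sub (e3.const_mul α)).sub (e2.const_mul E)).congr fun n => ?_
    simp only [hP, form]
    rw [(hwt n).isWeakGradient.integral_mul_lap ((hwt n).memLp _) (hwt n).memLp_gradient hφ]
    ring
  have hsq := tendsto_nhds_unique hP2 (hPlim'.pow 2)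
  have hfin := pow_eq_zero_iff two_ne_zero |>.1 hsq.symm
  have hgψ : ∫ x, |g x| * φ x ∂Γ.sigma = ∫ x, |ψ x| * φ x ∂Γ.sigma :=
    integral_congr_ae (by filter_upwards [htr] with x hx; rw [hx])
  rw [hgψ] at hfin
  rw [hκ]
  linarith

end

section

/-! ### Test functions that do not have compact support -/

lemma partialDeriv_mul {f g : Plane → ℝ} (hf : Differentiable ℝ f) (hg : Differentiable ℝ g)
    (i : Fin 2) :
    partialDeriv i (fun y => f y * g y) =
      fun y => partialDeriv i f y * g y + f y * partialDeriv i g y := by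
  ext y
  simp only [partialDeriv]
  rw [fderiv_fun_mul (hf y) (hg y)]
  simp
  ring

lemma partialDeriv_add {f g : Plane → ℝ} (hf : Differentiable ℝ f) (hg : Differentiable ℝ g)
    (i : Fin 2) :
    partialDeriv i (fun y => f y + g y) = fun y => partialDeriv i f y + partialDeriv i g y := by
  ext y
  simp only [partialDeriv]
  rw [fderiv_fun_add (hf y) (hg y)]
  simp

lemma partialDeriv_comp_smul (f : Plane → ℝ) (c : ℝ) (i : Fin 2) :
    partialDeriv i (fun y => f (c • y)) = fun y => c * partialDeriv i f (c • y) := by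
  ext y
  simp only [partialDeriv]
  rw [fderiv_comp_smul]
  simp

lemma partialDeriv_const_mul (f : Plane → ℝ) (c : ℝ) (i : Fin 2) :
    partialDeriv i (fun y => c * f y) = fun y => c * partialDeriv i f y := by
  ext y
  simp only [partialDeriv]
  have := congrFun (fderiv_const_smul_field (𝕜 := ℝ) (f := f) c) y
  simp only [Pi.smul_def, smul_eq_mul] at this
  rw [this]
  simp

lemma contDiff_partialDeriv {f : Plane → ℝ} (hf : ContDiff ℝ ∞ f) (i : Fin 2) :
    ContDiff ℝ ∞ (partialDeriv i f) :=
  (hf.fderiv_right (m := ∞) (by norm_num)).clm_apply contDiff_const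

lemma differentiable_of_contDiff {f : Plane → ℝ} (hf : ContDiff ℝ ∞ f) : Differentiable ℝ f :=
  hf.differentiable (by norm_num)

lemma lap_comp_smul_mul {f g : Plane → ℝ} (hf : ContDiff ℝ ∞ f) (hg : ContDiff ℝ ∞ g) (c : ℝ) :
    lap (fun y => f (c • y) * g y) = fun y => c ^ 2 * lap f (c • y) * g y +
      2 * c * (partialDeriv 0 f (c • y) * partialDeriv 0 g y +
        partialDeriv 1 f (c • y) * partialDeriv 1 g y) + f (c • y) * lap g y := by
  have hs : ∀ {f : Plane → ℝ}, ContDiff ℝ ∞ f → Differentiable ℝ fun y => f (c • y) :=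
    fun hf => (differentiable_of_contDiff hf).comp (differentiable_id.const_smul c)
  have key : ∀ i, partialDeriv i (partialDeriv i fun y => f (c • y) * g y) = fun y =>
      c ^ 2 * partialDeriv i (partialDeriv i f) (c • y) * g y +
      2 * c * (partialDeriv i f (c • y) * partialDeriv i g y) +
      f (c • y) * partialDeriv i (partialDeriv i g) y := by
    intro i
    have hfi := contDiff_partialDeriv hf i
    have hgi := contDiff_partialDeriv hg i
    have dg := differentiable_of_contDiff hg
    have dgi := differentiable_of_contDiff hgi
    have d1 : Differentiable ℝ fun y => c * partialDeriv i f (c • y) := (hs hfi).const_mul c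
    have d2 : Differentiable ℝ fun y => c * partialDeriv i f (c • y) * g y := d1.mul dg
    have d3 : Differentiable ℝ fun y => f (c • y) * partialDeriv i g y := (hs hf).mul dgi
    rw [partialDeriv_mul (hs hf) dg, partialDeriv_comp_smul, partialDeriv_add d2 d3, partialDeriv_mul d1 dg,
      partialDeriv_mul (hs hf) dgi, partialDeriv_const_mul (fun y => partialDeriv i f (c • y)),
      partialDeriv_comp_smul, partialDeriv_comp_smul]
    ext y
    ring
  ext y
  rw [lap, key, key]
  simp only [lap]
  ring

lemma IsTestFunction.exists_bound {φ : Plane → ℝ} (hφ : IsTestFunction φ) :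
    ∃ C, ∀ x, |φ x| ≤ C := by
  obtain ⟨C, hC⟩ := hφ.2.exists_bound_of_continuous hφ.1.continuous
  exact ⟨C, hC⟩

lemma PlaneCurve.integrable_sigma_of_continuous (Γ : PlaneCurve) {g : Plane → ℝ}
    (hg : Continuous g) : Integrable g Γ.sigma := by
  obtain ⟨C, hC⟩ := Γ.isCompact_carrier.exists_bound_of_continuousOn hg.continuousOn
  refine Integrable.mono' (integrable_const C) hg.aestronglyMeasurable ?_
  filter_upwards [Γ.ae_mem_carrier] with x hx using hC x hx

variable {Γ : PlaneCurve} {α κ : ℝ} {u : Plane → ℝ}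

lemma IsDistSolution.integrable_mul (h : IsDistSolution Γ α κ u) {g : Plane → ℝ}
    {μ : Measure Plane} (hg : Integrable g μ) : Integrable (fun y => u y * g y) μ := by
  refine hg.norm.mono' (h.continuous.aestronglyMeasurable.mul hg.aestronglyMeasurable) ?_
  refine Eventually.of_forall fun y => ?_
  rw [norm_mul]
  exact mul_le_of_le_one_left (norm_nonneg _) (h.le_one y)

/-- Cut `g` off by `f (c y)` and let `c → 0`: every derivative of the cutoff carries a factor `c`,
so dominated convergence removes those terms. This admits Gaussians as test functions. -/
lemma IsDistSolution.eq_of_integrable (h : IsDistSolution Γ α κ u) {g : Plane → ℝ}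
    (hg : ContDiff ℝ ∞ g) (h0 : Integrable g) (h1 : ∀ i, Integrable (partialDeriv i g))
    (h2 : Integrable (lap g)) :
    ∫ x, u x * lap g x = κ ^ 2 * (∫ x, u x * g x) - α * ∫ x, u x * g x ∂Γ.sigma := by
  let f : ContDiffBump (0 : Plane) := ⟨1, 2, one_pos, one_lt_two⟩
  have hχ : IsTestFunction (f : Plane → ℝ) := ⟨f.contDiff, f.hasCompactSupport⟩
  obtain ⟨C0, hC0⟩ := hχ.exists_bound
  obtain ⟨C1, hC1⟩ := (hχ.partialDeriv 0).exists_bound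
  obtain ⟨C1', hC1'⟩ := (hχ.partialDeriv 1).exists_bound
  obtain ⟨C2, hC2⟩ := hχ.lap.exists_bound
  set c : ℕ → ℝ := fun n => ((n : ℝ) + 1)⁻¹ with hc
  have hc0 : ∀ n, 0 < c n := fun n => by positivity
  have hc1 : ∀ n, c n ≤ 1 := fun n => by
    refine inv_le_one_of_one_le₀ ?_
    have : (0 : ℝ) ≤ n := by positivity
    linarith
  have hclim : Tendsto c atTop (𝓝 0) := by
    simpa [hc] using tendsto_one_div_add_atTop_nhds_zero_nat (𝕜 := ℝ)
  have hcy : ∀ y : Plane, Tendsto (fun n => c n • y) atTop (𝓝 0) := fun y => by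
    simpa using hclim.smul_const y
  have hf0 : f (0 : Plane) = 1 := f.one_of_mem_closedBall (by simp [f])
  have hfy : ∀ y : Plane, Tendsto (fun n => f (c n • y)) atTop (𝓝 1) := fun y => by
    have := hχ.1.continuous.tendsto (0 : Plane)
    rw [hf0] at this
    exact this.comp (hcy y)
  have htest : ∀ n, IsTestFunction fun y => f (c n • y) * g y := fun n => by
    refine ⟨(hχ.1.comp (contDiff_const_smul (c n))).mul hg, ?_⟩
    exact (hχ.2.comp_smul (hc0 n).ne').mul_right
  have e1 : Tendsto (fun n => ∫ x, u x * (f (c n • x) * g x)) atTop (𝓝 (∫ x, u x * g x)) := by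
    refine tendsto_integral_of_dominated_convergence (fun x => C0 * |g x|)
      (fun n => ?_) (h0.abs.const_mul C0) (fun n => Eventually.of_forall fun x => ?_)
      (Eventually.of_forall fun x => ?_)
    · exact (h.continuous.mul (htest n).1.continuous).aestronglyMeasurable
    · rw [norm_mul, norm_mul, Real.norm_eq_abs, Real.norm_eq_abs, Real.norm_eq_abs]
      calc |u x| * (|f (c n • x)| * |g x|) ≤ 1 * (C0 * |g x|) := by
            gcongr
            exacts [h.le_one x, hC0 _]
        _ = _ := one_mul _
    · simpa using ((hfy x).mul_const (g x)).const_mul (u x)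
  have e2 : Tendsto (fun n => ∫ x, u x * (f (c n • x) * g x) ∂Γ.sigma) atTop
      (𝓝 (∫ x, u x * g x ∂Γ.sigma)) := by
    refine tendsto_integral_of_dominated_convergence (fun x => C0 * |g x|)
      (fun n => ?_) ((Γ.integrable_sigma_of_continuous hg.continuous).abs.const_mul C0)
      (fun n => Eventually.of_forall fun x => ?_) (Eventually.of_forall fun x => ?_)
    · exact (h.continuous.mul (htest n).1.continuous).aestronglyMeasurable
    · rw [norm_mul, norm_mul, Real.norm_eq_abs, Real.norm_eq_abs, Real.norm_eq_abs]
      calc |u x| * (|f (c n • x)| * |g x|) ≤ 1 * (C0 * |g x|) := by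
            gcongr
            exacts [h.le_one x, hC0 _]
        _ = _ := one_mul _
    · simpa using ((hfy x).mul_const (g x)).const_mul (u x)
  have e3 : Tendsto (fun n => ∫ x, u x * lap (fun y => f (c n • y) * g y) x) atTop
      (𝓝 (∫ x, u x * lap g x)) := by
    refine tendsto_integral_of_dominated_convergence
      (fun x => C2 * |g x| + 2 * (C1 * |partialDeriv 0 g x| + C1' * |partialDeriv 1 g x|) +
        C0 * |lap g x|) (fun n => ?_)
      (((h0.abs.const_mul C2).add ((((h1 0).abs.const_mul C1).add
        ((h1 1).abs.const_mul C1')).const_mul 2)).add (h2.abs.const_mul C0))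
      (fun n => Eventually.of_forall fun x => ?_) (Eventually.of_forall fun x => ?_)
    · exact (h.continuous.mul (htest n).lap.1.continuous).aestronglyMeasurable
    · rw [norm_mul, Real.norm_eq_abs, Real.norm_eq_abs, lap_comp_smul_mul hχ.1 hg]
      have hC2' : 0 ≤ C2 := (abs_nonneg _).trans (hC2 0)
      have hC1p : 0 ≤ C1 := (abs_nonneg _).trans (hC1 0)
      have hC1p' : 0 ≤ C1' := (abs_nonneg _).trans (hC1' 0)
      have a1 : |c n ^ 2 * lap f (c n • x) * g x| ≤ C2 * |g x| := by
        rw [abs_mul, abs_mul, abs_of_nonneg (by positivity : 0 ≤ c n ^ 2)]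
        gcongr
        calc c n ^ 2 * |lap f (c n • x)| ≤ 1 * C2 := by
              gcongr
              exacts [pow_le_one₀ (hc0 n).le (hc1 n), hC2 _]
          _ = C2 := one_mul _
      have a2 : |2 * c n * (partialDeriv 0 f (c n • x) * partialDeriv 0 g x +
          partialDeriv 1 f (c n • x) * partialDeriv 1 g x)| ≤
          2 * (C1 * |partialDeriv 0 g x| + C1' * |partialDeriv 1 g x|) := by
        rw [abs_mul, abs_of_nonneg (by have := hc0 n; positivity : 0 ≤ 2 * c n)]
        have : 2 * c n ≤ 2 := by linarith [hc1 n]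
        refine mul_le_mul this ((abs_add_le _ _).trans ?_) (abs_nonneg _) (by norm_num)
        rw [abs_mul, abs_mul]
        gcongr
        exacts [hC1 _, hC1' _]
      have a3 : |f (c n • x) * lap g x| ≤ C0 * |lap g x| := by
        rw [abs_mul]
        gcongr
        exact hC0 _
      refine (mul_le_of_le_one_left (abs_nonneg _) (h.le_one x)).trans ?_
      exact (abs_add_three _ _ _).trans (add_le_add (add_le_add a1 a2) a3)
    · simp only [lap_comp_smul_mul hχ.1 hg]
      have cont : ∀ {v : Plane → ℝ}, IsTestFunction v →
          Tendsto (fun n => v (c n • x)) atTop (𝓝 (v 0)) := fun hv =>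
        (hv.1.continuous.tendsto 0).comp (hcy x)
      have b1 := (((hclim.pow 2).mul (cont hχ.lap)).mul_const (g x))
      have b2 := (hclim.const_mul 2).mul
        (((cont (hχ.partialDeriv 0)).mul_const (partialDeriv 0 g x)).add
          ((cont (hχ.partialDeriv 1)).mul_const (partialDeriv 1 g x)))
      have b3 := (hfy x).mul_const (lap g x)
      simpa using ((b1.add b2).add b3).const_mul (u x)
  have e4 := (e1.const_mul (κ ^ 2)).sub (e2.const_mul α)
  refine tendsto_nhds_unique e3 (e4.congr fun n => ?_)
  exact (h.eq _ (htest n)).symm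

/-! ### The heat kernel -/

lemma integrable_exp_neg_mul_sq {b : ℝ} (hb : 0 < b) (x : Plane) :
    Integrable fun y : Plane => Real.exp (-(b * ‖x - y‖ ^ 2)) := by
  have h1 : Integrable fun y : Plane => Real.exp (-(b * ‖y‖ ^ 2)) := by
    -- Again a nonzero value of the integral proves integrability.
    by_contra hcon
    have h2 := GaussianFourier.integral_rexp_neg_mul_sq_norm (V := Plane) hb
    simp only [neg_mul] at h2
    rw [integral_undef hcon] at h2
    have : (0 : ℝ) < (Real.pi / b) ^ ((Module.finrank ℝ Plane : ℝ) / 2) := by positivity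
    linarith
  exact h1.comp_sub_left x

lemma integral_killedHeat {κ t : ℝ} (ht : 0 < t) (x : Plane) :
    ∫ y : Plane, killedHeat κ t (‖x - y‖ ^ 2) = Real.exp (-(κ ^ 2 * t)) := by
  have h := GaussianFourier.integral_rexp_neg_mul_sq_norm (V := Plane) (b := 1 / (4 * t))
    (by positivity)
  rw [finrank_euclideanSpace_fin] at h
  norm_num at h
  rw [integral_sub_left_eq_self (fun y : Plane => killedHeat κ t (‖y‖ ^ 2)) volume x]
  have e : ∀ y : Plane, killedHeat κ t (‖y‖ ^ 2) = (4 * Real.pi * t)⁻¹ * Real.exp (-(κ ^ 2 * t)) *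
      Real.exp (-(t⁻¹ * (1 / 4) * ‖y‖ ^ 2)) := fun y => by
    rw [killedHeat, sub_eq_add_neg, Real.exp_add, mul_assoc]
    rw [mul_assoc]
    congr 3
    field_simp
  simp only [e]
  rw [integral_const_mul, h]
  field_simp

lemma hasDerivAt_killedHeat_left (κ q : ℝ) {t : ℝ} (ht : 0 < t) :
    HasDerivAt (fun t => killedHeat κ t q)
      ((q / (4 * t ^ 2) - 1 / t - κ ^ 2) * killedHeat κ t q) t := by
  have h1 : HasDerivAt (fun t : ℝ => (4 * Real.pi * t)⁻¹) (-(4 * Real.pi) / (4 * Real.pi * t) ^ 2) t := by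
    have := ((hasDerivAt_id t).const_mul (4 * Real.pi)).inv (by simp; positivity)
    simpa only [id_eq, mul_one] using! this
  have h2 : HasDerivAt (fun t : ℝ => -(κ ^ 2 * t) - q / (4 * t)) (-κ ^ 2 + q / (4 * t ^ 2)) t := by
    have h3 : HasDerivAt (fun t : ℝ => q / (4 * t)) (-(q / (4 * t ^ 2))) t := by
      have := (((hasDerivAt_id t).const_mul 4).inv (by simp; positivity)).const_mul q
      refine (this.congr_deriv ?_).congr_of_eventuallyEq ?_
      · simp; field_simp
      · exact Eventually.of_forall fun t => by simp [div_eq_mul_inv]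
    have := ((hasDerivAt_id t).const_mul (κ ^ 2)).neg.sub h3
    refine this.congr_deriv ?_
    simp
  refine (h1.mul h2.exp).congr_deriv ?_
  unfold killedHeat
  field_simp
  ring

lemma contDiff_killedHeat (κ t : ℝ) (x : Plane) :
    ContDiff ℝ ∞ fun y : Plane => killedHeat κ t (‖x - y‖ ^ 2) := by
  unfold killedHeat
  have : ContDiff ℝ ∞ fun y : Plane => ‖x - y‖ ^ 2 := (contDiff_const.sub contDiff_id).norm_sq ℝ
  exact contDiff_const.mul (((contDiff_const.sub (this.div_const _))).exp)

lemma partialDeriv_killedHeat (κ t : ℝ) (x : Plane) (i : Fin 2) :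
    partialDeriv i (fun y : Plane => killedHeat κ t (‖x - y‖ ^ 2)) =
      fun y => (x i - y i) / (2 * t) * killedHeat κ t (‖x - y‖ ^ 2) := by
  ext y
  have h1 : HasFDerivAt (fun x : Plane => ‖x‖ ^ 2) ((2 : ℝ) • innerSL ℝ (x - y)) (x - y) :=
    (hasStrictFDerivAt_norm_sq (x - y)).hasFDerivAt.congr_fderiv (by rw [two_smul, two_smul])
  have h2 := h1.comp y ((hasFDerivAt_id y).const_sub x)
  have h3 : HasDerivAt (fun q => killedHeat κ t q) (-(1 / (4 * t)) * killedHeat κ t (‖x - y‖ ^ 2))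
      (‖x - y‖ ^ 2) := by
    have := ((((hasDerivAt_id (‖x - y‖ ^ 2)).div_const (4 * t)).const_sub
      (-(κ ^ 2 * t))).exp.const_mul (4 * Real.pi * t)⁻¹)
    refine this.congr_deriv ?_
    simp [killedHeat]
    ring
  have h4 := (h3.comp_hasFDerivAt y h2).fderiv
  simp only [partialDeriv]
  have h5 : (fun y : Plane => killedHeat κ t (‖x - y‖ ^ 2)) =
    (fun q => killedHeat κ t q) ∘ ((fun x : Plane => ‖x‖ ^ 2) ∘ fun y => x - y) := rfl
  rw [h5, h4]
  simp [EuclideanSpace.inner_single_right]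
  ring

/-- Together with `hasDerivAt_killedHeat_left` this is the equation `∂ₜ k = Δk - κ² k`. -/
lemma lap_killedHeat (κ t : ℝ) (x : Plane) :
    lap (fun y : Plane => killedHeat κ t (‖x - y‖ ^ 2)) =
      fun y => (‖x - y‖ ^ 2 / (4 * t ^ 2) - 1 / t) * killedHeat κ t (‖x - y‖ ^ 2) := by
  have hd := differentiable_of_contDiff (contDiff_killedHeat κ t x)
  have key : ∀ i, partialDeriv i (partialDeriv i
      (fun y : Plane => killedHeat κ t (‖x - y‖ ^ 2))) = fun y =>
      ((x i - y i) ^ 2 / (4 * t ^ 2) - 1 / (2 * t)) * killedHeat κ t (‖x - y‖ ^ 2) := by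
    intro i
    have hl : ∀ y, HasFDerivAt (fun y : Plane => (x i - y i) / (2 * t))
        ((2 * t)⁻¹ • (-(EuclideanSpace.proj i : Plane →L[ℝ] ℝ))) y := fun y => by
      have := ((EuclideanSpace.proj i : Plane →L[ℝ] ℝ).hasFDerivAt (x := y)).const_sub (x i)
      have := this.const_smul (2 * t)⁻¹
      refine this.congr_of_eventuallyEq (Eventually.of_forall fun y => ?_)
      simp [div_eq_inv_mul]
    have hl2 : partialDeriv i (fun y : Plane => (x i - y i) / (2 * t)) = fun y => -(2 * t)⁻¹ := by
      ext y
      simp [partialDeriv, (hl y).fderiv]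
    rw [partialDeriv_killedHeat, partialDeriv_mul (fun y => (hl y).differentiableAt) hd, hl2,
      partialDeriv_killedHeat]
    ext y
    field_simp
    ring
  ext y
  have hn : ‖x - y‖ ^ 2 = (x 0 - y 0) ^ 2 + (x 1 - y 1) ^ 2 := by
    simp [EuclideanSpace.norm_sq_eq, Fin.sum_univ_two]
  rw [lap, key, key]
  beta_reduce
  generalize killedHeat κ t (‖x - y‖ ^ 2) = k
  rw [hn]
  ring

end

section

/-! ### Singular integrals over the curve -/

open Classical in
/-- The function `τ ↦ τ ^ (-b)`, cut off outside the set `S` and infinite for `τ ≤ 0`. -/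
def singularPower (S : Set ℝ) (b τ : ℝ) : ENNReal :=
  if τ ≤ 0 then ⊤ else if τ ∈ S then ENNReal.ofReal (τ ^ (-b)) else 0

/-- The value `⊤` for `τ ≤ 0` makes the function decreasing on the whole line; the real power itself
takes the value `0` at `0` when `b ≠ 0`. -/
lemma singularPower_antitone {S : Set ℝ} (hS : IsLowerSet S) {b : ℝ} (hb : 0 ≤ b) :
    Antitone (singularPower S b) := by
  intro s t hst
  unfold singularPower
  by_cases hs0 : s ≤ 0
  · rw [if_pos hs0]
    exact le_top
  rw [if_neg hs0, if_neg fun ht0 => hs0 (hst.trans ht0)]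
  by_cases ht : t ∈ S
  · rw [if_pos ht, if_pos (hS hst ht)]
    exact ENNReal.ofReal_le_ofReal
      (Real.rpow_le_rpow_of_nonpos (not_le.1 hs0) hst (neg_nonpos.2 hb))
  · rw [if_neg ht]
    exact zero_le

lemma lintegral_rpow_neg_Ioc {b ℓ : ℝ} (hb : b < 1) (hℓ : 0 ≤ ℓ) :
    ∫⁻ τ in Ioc 0 ℓ, ENNReal.ofReal (τ ^ (-b)) = ENNReal.ofReal (ℓ ^ (1 - b) / (1 - b)) := by
  have hi : IntegrableOn (fun τ : ℝ => τ ^ (-b)) (Ioc 0 ℓ) :=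
    (intervalIntegrable_iff_integrableOn_Ioc_of_le hℓ).1
      (intervalIntegral.intervalIntegrable_rpow' (by linarith))
  rw [← ofReal_integral_eq_lintegral_ofReal hi, ← intervalIntegral.integral_of_le hℓ,
    integral_rpow (Or.inl (by linarith))]
  · rw [Real.zero_rpow (by linarith)]
    congr 2
    · rw [sub_zero]; congr 1; ring
    · ring
  · filter_upwards [ae_restrict_mem measurableSet_Ioc] with τ hτ
    exact Real.rpow_nonneg hτ.1.le _

variable {Γ : PlaneCurve} {α κ : ℝ} {u : Plane → ℝ}

namespace PlaneCurve

/-- `ℓ` bounds the arc lengths that still count: `S = univ` goes with `ℓ = L`, while `S = Iio δ`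
isolates the small contribution of a neighbourhood of `x`. -/
lemma lintegral_singularPower_le (Γ : PlaneCurve) {S : Set ℝ} (hS : IsLowerSet S) {b ℓ : ℝ}
    (hb : 0 ≤ b) (hb1 : b < 1) (hℓ : 0 ≤ ℓ)
    (h : ∀ τ, 0 < τ → τ ≤ Γ.L → Γ.injConst / 2 * τ ∈ S → τ ≤ ℓ) (x : Plane) :
    ∫⁻ z, singularPower S b ‖x - z‖ ∂Γ.sigma ≤
      ENNReal.ofReal (4 * ((Γ.injConst / 2) ^ (-b) * (ℓ ^ (1 - b) / (1 - b)))) := by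
  have hM := Γ.injConst_pos
  refine (Γ.lintegral_antitone_le (singularPower_antitone hS hb) x).trans ?_
  rw [ENNReal.ofReal_mul (by norm_num), ENNReal.ofReal_ofNat]
  gcongr
  rw [ENNReal.ofReal_mul (by positivity), ← lintegral_rpow_neg_Ioc hb1 hℓ,
    ← lintegral_const_mul _ (by fun_prop), ← lintegral_indicator measurableSet_Ioc,
    setLIntegral_congr (Ioc_ae_eq_Icc).symm, ← lintegral_indicator measurableSet_Ioc]
  refine lintegral_mono fun τ => ?_
  by_cases hτ : τ ∈ Ioc 0 Γ.L
  · rw [indicator_of_mem hτ]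
    have hpos : 0 < Γ.injConst / 2 * τ := by have := hτ.1; positivity
    rw [singularPower, if_neg (not_le.2 hpos)]
    split_ifs with h1
    · have hτℓ : τ ∈ Ioc 0 ℓ := ⟨hτ.1, h τ hτ.1 hτ.2 h1⟩
      rw [indicator_of_mem hτℓ, Real.mul_rpow (by positivity) hτ.1.le,
        ENNReal.ofReal_mul (by positivity)]
    · exact zero_le
  · rw [indicator_of_notMem hτ]
    exact zero_le

/-- A function that is infinite at `x` has a finite integral, so the arc length measure has no atom
at `x`. -/
lemma ae_ne (Γ : PlaneCurve) (x : Plane) : ∀ᵐ z ∂Γ.sigma, z ≠ x := by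
  have h := Γ.lintegral_singularPower_le isLowerSet_univ (b := 1 / 2) (by norm_num) (by norm_num)
    Γ.L_pos.le (fun τ _ h _ => h) x
  have hm : Measurable fun z : Plane => singularPower univ (1 / 2) ‖x - z‖ :=
    (singularPower_antitone isLowerSet_univ (by norm_num)).measurable.comp (by fun_prop)
  filter_upwards [ae_lt_top hm (h.trans_lt ENNReal.ofReal_lt_top).ne] with z hz hzx
  simp [hzx, singularPower] at hz

lemma integral_rpow_le (Γ : PlaneCurve) {b : ℝ} (hb : 0 ≤ b) (hb1 : b < 1) (x : Plane) :
    Integrable (fun z => ‖x - z‖ ^ (-b)) Γ.sigma ∧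
    ∫ z, ‖x - z‖ ^ (-b) ∂Γ.sigma ≤ 4 * ((Γ.injConst / 2) ^ (-b) * (Γ.L ^ (1 - b) / (1 - b))) := by
  have hM := Γ.injConst_pos
  have hL := Γ.L_pos
  have h1b : 0 < 1 - b := by linarith
  have h := Γ.lintegral_singularPower_le isLowerSet_univ hb hb1 Γ.L_pos.le (fun τ _ h _ => h) x
  have hle : ∫⁻ z, ENNReal.ofReal (‖x - z‖ ^ (-b)) ∂Γ.sigma ≤
      ENNReal.ofReal (4 * ((Γ.injConst / 2) ^ (-b) * (Γ.L ^ (1 - b) / (1 - b)))) := by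
    refine (lintegral_mono fun z => ?_).trans h
    rw [singularPower]
    split_ifs with h1 h2
    · exact le_top
    · exact le_rfl
    · exact absurd (mem_univ _) h2
  have hm : Measurable fun z : Plane => ‖x - z‖ ^ (-b) := by fun_prop
  have h0 : 0 ≤ᵐ[Γ.sigma] fun z => ‖x - z‖ ^ (-b) :=
    Eventually.of_forall fun z => Real.rpow_nonneg (norm_nonneg _) _
  refine ⟨⟨hm.aestronglyMeasurable, ?_⟩, ?_⟩
  · rw [hasFiniteIntegral_iff_ofReal h0]
    exact hle.trans_lt ENNReal.ofReal_lt_top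
  · rw [integral_eq_lintegral_of_nonneg_ae h0 hm.aestronglyMeasurable]
    exact ENNReal.toReal_le_of_le_ofReal (by positivity) hle

lemma integrable_green (Γ : PlaneCurve) (hκ : 0 < κ) (x : Plane) :
    Integrable (fun z => green κ (‖x - z‖ ^ 2)) Γ.sigma := by
  have h := (Γ.integral_rpow_le (b := 1 / 3) (by norm_num) (by norm_num) x).1
  refine (h.const_mul (greenConst * (κ ^ 2) ^ (-(1 / 6 : ℝ)))).mono'
    ((measurable_green κ).comp (by fun_prop)).aestronglyMeasurable ?_
  filter_upwards [Γ.ae_ne x] with z hz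
  have hxz : 0 < ‖x - z‖ := norm_pos_iff.2 (sub_ne_zero.2 hz.symm)
  rw [Real.norm_of_nonneg (green_nonneg _ _)]
  refine (green_le hκ (by positivity)).trans (le_of_eq ?_)
  rw [Real.mul_rpow (by positivity) (by positivity), ← mul_assoc]
  congr 1
  rw [← Real.rpow_natCast, ← Real.rpow_mul hxz.le]
  norm_num

end PlaneCurve

/-! ### Heat means -/

/-- For times within a factor of two of `t₀` a single Gaussian dominates; half of its exponent pays
for the factor `1 + q`. -/
lemma one_add_mul_killedHeat_le (κ : ℝ) {t₀ t q : ℝ} (ht₀ : 0 < t₀) (ht : t ∈ Ioo (t₀ / 2) (2 * t₀))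
    (hq : 0 ≤ q) : (1 + q) * killedHeat κ t q ≤
      (2 * Real.pi * t₀)⁻¹ * (1 + 16 * t₀) * Real.exp (-((16 * t₀)⁻¹ * q)) := by
  have htp : 0 < t := lt_trans (by positivity) ht.1
  have h1 : killedHeat κ t q ≤ (2 * Real.pi * t₀)⁻¹ * Real.exp (-(q / (8 * t₀))) := by
    unfold killedHeat
    have e1 : 2 * Real.pi * t₀ ≤ 4 * Real.pi * t := by nlinarith [Real.pi_pos, ht.1]
    have e2 : 4 * t ≤ 8 * t₀ := by linarith [ht.2]
    have e3 : q / (8 * t₀) ≤ q / (4 * t) := by gcongr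
    gcongr
    have : 0 ≤ κ ^ 2 * t := by positivity
    linarith
  have h2 : 1 + q ≤ (1 + 16 * t₀) * Real.exp ((16 * t₀)⁻¹ * q) := by
    have h3 := Real.add_one_le_exp ((16 * t₀)⁻¹ * q)
    have h4 : 1 ≤ Real.exp ((16 * t₀)⁻¹ * q) := Real.one_le_exp (by positivity)
    have h5 : 16 * t₀ * ((16 * t₀)⁻¹ * q) = q := by field_simp
    nlinarith
  calc (1 + q) * killedHeat κ t q
      ≤ ((1 + 16 * t₀) * Real.exp ((16 * t₀)⁻¹ * q)) *
          ((2 * Real.pi * t₀)⁻¹ * Real.exp (-(q / (8 * t₀)))) := by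
        gcongr
        exact (killedHeat_pos htp).le
    _ = (2 * Real.pi * t₀)⁻¹ * (1 + 16 * t₀) *
          (Real.exp ((16 * t₀)⁻¹ * q) * Real.exp (-(q / (8 * t₀)))) := by ring
    _ = _ := by
        rw [← Real.exp_add]
        congr 2
        field_simp
        ring

lemma continuous_killedHeat_sq (κ t : ℝ) (x : Plane) :
    Continuous fun y : Plane => killedHeat κ t (‖x - y‖ ^ 2) :=
  (contDiff_killedHeat κ t x).continuous

lemma integrable_one_add_mul_killedHeat (κ : ℝ) {t : ℝ} (ht : 0 < t) (x : Plane) :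
    Integrable fun y : Plane => (1 + ‖x - y‖ ^ 2) * killedHeat κ t (‖x - y‖ ^ 2) := by
  refine ((integrable_exp_neg_mul_sq (b := (16 * t)⁻¹) (by positivity) x).const_mul
    ((2 * Real.pi * t)⁻¹ * (1 + 16 * t))).mono' ?_ (Eventually.of_forall fun y => ?_)
  · have := continuous_killedHeat_sq κ t x
    exact Continuous.aestronglyMeasurable (by fun_prop)
  · have := (killedHeat_pos (κ := κ) (q := ‖x - y‖ ^ 2) ht).le
    rw [Real.norm_of_nonneg (by positivity)]
    exact one_add_mul_killedHeat_le κ ht ⟨by linarith, by linarith⟩ (by positivity)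

lemma integrable_mul_killedHeat (κ : ℝ) {t : ℝ} (ht : 0 < t) (x : Plane) {w : Plane → ℝ}
    (hw : Continuous w) {C : ℝ} (hC : ∀ y, |w y| ≤ C * (1 + ‖x - y‖ ^ 2)) :
    Integrable fun y : Plane => w y * killedHeat κ t (‖x - y‖ ^ 2) := by
  refine ((integrable_one_add_mul_killedHeat κ ht x).const_mul C).mono' ?_
    (Eventually.of_forall fun y => ?_)
  · exact (hw.mul (continuous_killedHeat_sq κ t x)).aestronglyMeasurable
  · have := (killedHeat_pos (κ := κ) (q := ‖x - y‖ ^ 2) ht).le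
    rw [norm_mul, Real.norm_eq_abs, Real.norm_of_nonneg this, ← mul_assoc]
    gcongr
    exact hC y

/-- The mean of `u` with respect to the heat kernel. -/
def heatMean (κ : ℝ) (u : Plane → ℝ) (x : Plane) (t : ℝ) : ℝ :=
  ∫ y, u y * killedHeat κ t (‖x - y‖ ^ 2)

/-- The heat kernel integrated against `u σ`. -/
def curveHeat (Γ : PlaneCurve) (κ : ℝ) (u : Plane → ℝ) (x : Plane) (t : ℝ) : ℝ :=
  ∫ z, u z * killedHeat κ t (‖x - z‖ ^ 2) ∂Γ.sigma

/-- On the kernel `∂ₜ` is `Δ - κ²`, and the equation for `u`, tested with the kernel, turns this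
operator into `-α` times integration against `σ`. -/
lemma IsDistSolution.hasDerivAt_heatMean (h : IsDistSolution Γ α κ u) (x : Plane) {t : ℝ}
    (ht : 0 < t) : HasDerivAt (heatMean κ u x) (-(α * curveHeat Γ κ u x t)) t := by
  have hcoord : ∀ y : Plane, ∀ i, |x i - y i| ≤ 1 + ‖x - y‖ ^ 2 := fun y i => by
    have := PiLp.norm_apply_le (x - y) i
    rw [PiLp.sub_apply, Real.norm_eq_abs] at this
    nlinarith [sq_nonneg (‖x - y‖ - 1), norm_nonneg (x - y)]
  have hg := contDiff_killedHeat κ t x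
  have hbound : ∀ t₀ > 0, ∀ t ∈ Ioo (t₀ / 2) (2 * t₀), ∀ q ≥ 0,
      |q / (4 * t ^ 2) - 1 / t - κ ^ 2| ≤ (1 / t₀ ^ 2 + 2 / t₀ + κ ^ 2) * (1 + q) := by
    intro t₀ ht₀ t ht q hq
    have htp : 0 < t := lt_trans (by positivity) ht.1
    have e1 : q / (4 * t ^ 2) ≤ 1 / t₀ ^ 2 * q := by
      rw [one_div, ← div_eq_inv_mul]
      gcongr
      nlinarith [ht.1]
    have e2 : 1 / t ≤ 2 / t₀ := by
      rw [div_le_div_iff₀ htp ht₀]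
      linarith [ht.1]
    have e3 : 0 ≤ q / (4 * t ^ 2) := by positivity
    have e4 : 0 ≤ 1 / t := by positivity
    have e5 : 0 ≤ 1 / t₀ ^ 2 := by positivity
    have e6 : 0 ≤ 2 / t₀ * q := by positivity
    have e7 : 0 ≤ κ ^ 2 * q := by positivity
    rw [abs_le]
    constructor <;> nlinarith [sq_nonneg κ]
  have i0 : Integrable fun y : Plane => killedHeat κ t (‖x - y‖ ^ 2) := by
    have := integrable_mul_killedHeat κ ht x (w := fun _ => 1) continuous_const (C := 1)
      (fun y => by simp)
    simpa using this
  have i1 : ∀ i, Integrable (partialDeriv i fun y : Plane => killedHeat κ t (‖x - y‖ ^ 2)) := by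
    intro i
    rw [partialDeriv_killedHeat]
    refine integrable_mul_killedHeat κ ht x (by fun_prop) (C := (2 * t)⁻¹) fun y => ?_
    rw [abs_div, abs_of_pos (by positivity : 0 < 2 * t), div_eq_inv_mul]
    gcongr
    exact hcoord y i
  have i2 : Integrable (lap fun y : Plane => killedHeat κ t (‖x - y‖ ^ 2)) := by
    rw [lap_killedHeat]
    refine integrable_mul_killedHeat κ ht x (by fun_prop)
      (C := (1 / t ^ 2 + 2 / t + κ ^ 2) + κ ^ 2) fun y => ?_
    have h1 := hbound t ht t ⟨by linarith, by linarith⟩ (‖x - y‖ ^ 2) (by positivity)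
    have h2 : ‖x - y‖ ^ 2 / (4 * t ^ 2) - 1 / t =
        (‖x - y‖ ^ 2 / (4 * t ^ 2) - 1 / t - κ ^ 2) + κ ^ 2 := by ring
    rw [h2]
    refine (abs_add_le _ _).trans ?_
    rw [abs_of_nonneg (sq_nonneg κ), add_mul]
    refine add_le_add h1 (le_mul_of_one_le_right (sq_nonneg κ) ?_)
    have : 0 ≤ ‖x - y‖ ^ 2 := by positivity
    linarith
  have heq := h.eq_of_integrable hg i0 i1 i2
  have key := hasDerivAt_integral_of_dominated_loc_of_deriv_le (μ := (volume : Measure Plane))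
    (F := fun t y => u y * killedHeat κ t (‖x - y‖ ^ 2))
    (F' := fun t y => u y * ((‖x - y‖ ^ 2 / (4 * t ^ 2) - 1 / t - κ ^ 2) *
      killedHeat κ t (‖x - y‖ ^ 2)))
    (x₀ := t) (s := Ioo (t / 2) (2 * t))
    (bound := fun y => (1 / t ^ 2 + 2 / t + κ ^ 2) * ((2 * Real.pi * t)⁻¹ * (1 + 16 * t) *
      Real.exp (-((16 * t)⁻¹ * ‖x - y‖ ^ 2))))
    (Ioo_mem_nhds (by linarith) (by linarith))
    (Eventually.of_forall fun s =>
      (h.continuous.mul (continuous_killedHeat_sq κ s x)).aestronglyMeasurable)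
    (h.integrable_mul i0) ?_ ?_ ?_ ?_
  · refine key.2.congr_deriv ?_
    have e : ∀ y, u y * ((‖x - y‖ ^ 2 / (4 * t ^ 2) - 1 / t - κ ^ 2) *
        killedHeat κ t (‖x - y‖ ^ 2)) = u y * lap (fun y => killedHeat κ t (‖x - y‖ ^ 2)) y -
          κ ^ 2 * (u y * killedHeat κ t (‖x - y‖ ^ 2)) := fun y => by
      rw [lap_killedHeat]; ring
    simp only [e]
    rw [integral_sub (h.integrable_mul i2) ((h.integrable_mul i0).const_mul _),
      integral_const_mul, heq, curveHeat]
    ring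
  · refine Continuous.aestronglyMeasurable ?_
    have := h.continuous
    have := continuous_killedHeat_sq κ t x
    fun_prop
  · refine Eventually.of_forall fun y s hs => ?_
    have hsp : 0 < s := lt_trans (by positivity) hs.1
    have hk := (killedHeat_pos (κ := κ) (q := ‖x - y‖ ^ 2) hsp).le
    rw [norm_mul, Real.norm_eq_abs, norm_mul, Real.norm_eq_abs, Real.norm_of_nonneg hk]
    refine (mul_le_of_le_one_left (by positivity) (h.le_one y)).trans ?_
    calc |‖x - y‖ ^ 2 / (4 * s ^ 2) - 1 / s - κ ^ 2| * killedHeat κ s (‖x - y‖ ^ 2)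
        ≤ ((1 / t ^ 2 + 2 / t + κ ^ 2) * (1 + ‖x - y‖ ^ 2)) * killedHeat κ s (‖x - y‖ ^ 2) := by
          gcongr
          exact hbound t ht s hs _ (by positivity)
      _ ≤ _ := by
          rw [mul_assoc]
          exact mul_le_mul_of_nonneg_left (one_add_mul_killedHeat_le κ ht hs (by positivity))
            (by positivity)
  · exact (((integrable_exp_neg_mul_sq (by positivity) x).const_mul _).const_mul _)
  · refine Eventually.of_forall fun y s hs => ?_
    exact (hasDerivAt_killedHeat_left κ _ (lt_trans (by positivity) hs.1)).const_mul (u y)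

lemma IsDistSolution.abs_heatMean_le (h : IsDistSolution Γ α κ u) (x : Plane) {t : ℝ}
    (ht : 0 < t) : |heatMean κ u x t| ≤ Real.exp (-(κ ^ 2 * t)) := by
  rw [← integral_killedHeat ht x, heatMean, ← Real.norm_eq_abs]
  have i0 : Integrable fun y : Plane => killedHeat κ t (‖x - y‖ ^ 2) := by
    have := integrable_mul_killedHeat κ ht x (w := fun _ => 1) continuous_const (C := 1)
      (fun y => by simp)
    simpa using this
  refine norm_integral_le_of_norm_le i0 (Eventually.of_forall fun y => ?_)
  have hk := (killedHeat_pos (κ := κ) (q := ‖x - y‖ ^ 2) ht).le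
  rw [norm_mul, Real.norm_eq_abs, Real.norm_of_nonneg hk]
  exact mul_le_of_le_one_left hk (h.le_one y)

/-- The substitution `y = x - √t v` fixes the Gaussian and moves the dependence on `t` into `u`,
ready for `t → 0`. -/
lemma heatMean_eq (κ : ℝ) (u : Plane → ℝ) (x : Plane) {t : ℝ} (ht : 0 < t) :
    heatMean κ u x t = Real.exp (-(κ ^ 2 * t)) *
      ∫ v, u (x - √t • v) * killedHeat 0 1 (‖(0 : Plane) - v‖ ^ 2) := by
  have h1 := integral_sub_left_eq_self
    (fun w : Plane => u (x - w) * killedHeat κ t (‖w‖ ^ 2)) volume x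
  simp only [sub_sub_cancel] at h1
  have h2 := Measure.integral_comp_smul volume
    (fun w : Plane => u (x - w) * killedHeat κ t (‖w‖ ^ 2)) √t
  rw [finrank_euclideanSpace_fin, Real.sq_sqrt ht.le, abs_of_pos (by positivity),
    smul_eq_mul] at h2
  have h3 : ∫ w : Plane, u (x - w) * killedHeat κ t (‖w‖ ^ 2) =
      t * ∫ v : Plane, u (x - √t • v) * killedHeat κ t (‖√t • v‖ ^ 2) := by
    rw [h2]
    field_simp
  rw [heatMean, h1, h3, ← integral_const_mul, ← integral_const_mul]
  congr 1
  ext v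
  have h4 : ‖√t • v‖ ^ 2 = t * ‖v‖ ^ 2 := by
    rw [norm_smul, mul_pow, Real.norm_of_nonneg (Real.sqrt_nonneg _), Real.sq_sqrt ht.le]
  rw [h4, zero_sub, norm_neg, killedHeat, killedHeat]
  have h5 : -(κ ^ 2 * t) - t * ‖v‖ ^ 2 / (4 * t) =
      -(κ ^ 2 * t) + (-(0 ^ 2 * 1) - ‖v‖ ^ 2 / (4 * 1)) := by
    field_simp
    ring
  rw [h5, Real.exp_add]
  field_simp

lemma IsDistSolution.tendsto_heatMean (h : IsDistSolution Γ α κ u) (x : Plane) :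
    Tendsto (heatMean κ u x) (𝓝[>] 0) (𝓝 (u x)) := by
  have i0 : Integrable fun y : Plane => killedHeat 0 1 (‖0 - y‖ ^ 2) := by
    have := integrable_mul_killedHeat 0 one_pos 0 (w := fun _ => 1) continuous_const (C := 1)
      (fun y => by simp)
    simpa using this
  have e1 : Tendsto (fun t : ℝ => ∫ v, u (x - √t • v) * killedHeat 0 1 (‖(0 : Plane) - v‖ ^ 2))
      (𝓝[>] 0) (𝓝 (∫ v, u x * killedHeat 0 1 (‖(0 : Plane) - v‖ ^ 2))) := by
    refine tendsto_integral_filter_of_dominated_convergence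
      (fun v => killedHeat 0 1 (‖(0 : Plane) - v‖ ^ 2)) (Eventually.of_forall fun t => ?_)
      (Eventually.of_forall fun t => Eventually.of_forall fun v => ?_) i0
      (Eventually.of_forall fun v => ?_)
    · have := h.continuous
      have := continuous_killedHeat_sq 0 1 0
      exact Continuous.aestronglyMeasurable (by fun_prop)
    · have hk := (killedHeat_pos (κ := 0) (q := ‖(0 : Plane) - v‖ ^ 2) one_pos).le
      rw [norm_mul, Real.norm_eq_abs, Real.norm_of_nonneg hk]
      exact mul_le_of_le_one_left hk (h.le_one _)
    · refine Tendsto.mul_const _ ?_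
      have hc : Continuous fun t : ℝ => u (x - √t • v) := by
        have := h.continuous
        fun_prop
      have := hc.tendsto 0
      simp only [Real.sqrt_zero, zero_smul, sub_zero] at this
      exact this.mono_left nhdsWithin_le_nhds
  have e2 : Tendsto (fun t : ℝ => Real.exp (-(κ ^ 2 * t))) (𝓝[>] 0) (𝓝 1) := by
    have hc : Continuous fun t : ℝ => Real.exp (-(κ ^ 2 * t)) := by fun_prop
    have := hc.tendsto 0
    simp only [mul_zero, neg_zero, Real.exp_zero] at this
    exact this.mono_left nhdsWithin_le_nhds
  have e3 := e2.mul e1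
  rw [integral_const_mul, integral_killedHeat one_pos] at e3
  simp only [ne_eq, OfNat.ofNat_ne_zero, not_false_eq_true, zero_pow, neg_zero,
    Real.exp_zero, mul_one, one_mul] at e3
  refine e3.congr' ?_
  filter_upwards [self_mem_nhdsWithin] with t ht
  exact (heatMean_eq κ u x ht).symm

/-! ### The representation by the Green function -/

lemma IsDistSolution.integrable_prod (h : IsDistSolution Γ α κ u) (hκ : 0 < κ) (x : Plane) :
    Integrable (fun p : ℝ × Plane => u p.2 * killedHeat κ p.1 (‖x - p.2‖ ^ 2))
      ((volume.restrict (Ioi 0)).prod Γ.sigma) := by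
  have hm : AEStronglyMeasurable (fun p : ℝ × Plane => u p.2 * killedHeat κ p.1 (‖x - p.2‖ ^ 2))
      ((volume.restrict (Ioi 0)).prod Γ.sigma) := by
    have h1 := h.continuous.measurable
    have h2 : Measurable fun p : ℝ × Plane => killedHeat κ p.1 (‖x - p.2‖ ^ 2) := by
      unfold killedHeat; fun_prop
    exact ((h1.comp measurable_snd).mul h2).aestronglyMeasurable
  have habs : ∀ z, ∫ t in Ioi (0 : ℝ), ‖u z * killedHeat κ t (‖x - z‖ ^ 2)‖ =
      |u z| * green κ (‖x - z‖ ^ 2) := fun z => by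
    rw [green, ← integral_const_mul]
    refine setIntegral_congr_fun measurableSet_Ioi fun t ht => ?_
    simp only [norm_mul, Real.norm_eq_abs]
    rw [abs_of_nonneg (killedHeat_pos ht).le]
  rw [integrable_prod_iff' hm]
  constructor
  · filter_upwards [Γ.ae_ne x] with z hz
    have hxz : 0 < ‖x - z‖ := norm_pos_iff.2 (sub_ne_zero.2 hz.symm)
    exact (integrableOn_killedHeat hκ (by positivity)).const_mul (u z)
  · simp only [habs]
    refine (Γ.integrable_green hκ x).mono' ?_ (Eventually.of_forall fun z => ?_)
    · have := h.continuous.measurable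
      have := measurable_green κ
      exact Measurable.aestronglyMeasurable (by fun_prop)
    · rw [norm_mul, norm_abs_eq_norm, Real.norm_eq_abs, Real.norm_of_nonneg (green_nonneg _ _)]
      exact mul_le_of_le_one_left (green_nonneg _ _) (h.le_one z)

/-- The heat mean runs from `u x` at time `0` to `0` at infinity. Integrating its derivative over
time and exchanging the integrals turns the heat kernel into the Green function. -/
theorem IsDistSolution.eq_integral_green (h : IsDistSolution Γ α κ u) (hκ : 0 < κ) (x : Plane) :
    u x = α * ∫ z, u z * green κ (‖x - z‖ ^ 2) ∂Γ.sigma := by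
  classical
  -- At `t = 0` the heat mean is a junk value; it is replaced by its limit.
  set f : ℝ → ℝ := Function.update (heatMean κ u x) 0 (u x) with hf
  have hfe : ∀ t > 0, f t = heatMean κ u x t := fun t ht => by
    simp [hf, Function.update_of_ne ht.ne']
  have hcont : ContinuousWithinAt f (Ici 0) 0 := by
    rw [continuousWithinAt_update_same, Ici_sdiff_left]
    exact h.tendsto_heatMean x
  have hderiv : ∀ t ∈ Ioi (0 : ℝ), HasDerivAt f (-(α * curveHeat Γ κ u x t)) t := fun t ht =>
    (h.hasDerivAt_heatMean x ht).congr_of_eventuallyEq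
      (by filter_upwards [Ioi_mem_nhds ht] with s hs using hfe s hs)
  have hint : IntegrableOn (fun t => -(α * curveHeat Γ κ u x t)) (Ioi 0) :=
    ((h.integrable_prod hκ x).integral_prod_left.const_mul α).neg
  have hlim : Tendsto f atTop (𝓝 0) := by
    have h1 : Tendsto (fun t : ℝ => Real.exp (-(κ ^ 2 * t))) atTop (𝓝 0) :=
      Real.tendsto_exp_neg_atTop_nhds_zero.comp (tendsto_id.const_mul_atTop (by positivity))
    refine squeeze_zero_norm' ?_ h1
    filter_upwards [eventually_gt_atTop 0] with t ht
    rw [hfe t ht]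
    exact h.abs_heatMean_le x ht
  have hftc := integral_Ioi_of_hasDerivAt_of_tendsto hcont hderiv hint hlim
  have hf0 : f 0 = u x := by simp [hf]
  rw [hf0, integral_neg, integral_const_mul, zero_sub, neg_inj] at hftc
  rw [← hftc]
  congr 1
  simp only [curveHeat]
  rw [integral_integral_swap (h.integrable_prod hκ x)]
  refine integral_congr_ae (Eventually.of_forall fun z => ?_)
  simp only [green, integral_const_mul]

end

section

variable {Γ : PlaneCurve} {α κ : ℝ} {u : Plane → ℝ}

/-! ### Positivity and maxima -/

lemma IsDistSolution.neg (h : IsDistSolution Γ α κ u) :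
    IsDistSolution Γ α κ fun x => -u x := by
  refine ⟨h.continuous.neg, fun x => by rw [abs_neg]; exact h.le_one x, fun φ hφ => ?_⟩
  simp only [neg_mul, integral_neg, h.eq φ hφ]
  ring

lemma IsDistSolution.integrable_green (h : IsDistSolution Γ α κ u) (hκ : 0 < κ) (x : Plane) :
    Integrable (fun z => u z * green κ (‖x - z‖ ^ 2)) Γ.sigma :=
  h.integrable_mul (Γ.integrable_green hκ x)

/-- The Green function is positive, so a zero of `u` forces `u = 0` almost everywhere on the curve
and then, by the representation, everywhere. -/
lemma IsDistSolution.pos_of_nonneg (h : IsDistSolution Γ α κ u) (hκ : 0 < κ) (hα : 0 < α)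
    (h0 : ∀ x, 0 ≤ u x) {y : Plane} (hy : u y ≠ 0) (x : Plane) : 0 < u x := by
  refine lt_of_le_of_ne (h0 x) fun hx => hy ?_
  have h1 := h.eq_integral_green hκ x
  rw [← hx, zero_eq_mul, or_iff_right hα.ne', integral_eq_zero_iff_of_nonneg
    (fun z => mul_nonneg (h0 z) (green_nonneg _ _)) (h.integrable_green hκ x)] at h1
  rw [h.eq_integral_green hκ y]
  refine mul_eq_zero_of_right _ (integral_eq_zero_of_ae ?_)
  filter_upwards [h1, Γ.ae_ne x] with z hz hzx
  have hxz : 0 < ‖x - z‖ := norm_pos_iff.2 (sub_ne_zero.2 hzx.symm)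
  have : u z = 0 := (mul_eq_zero.1 hz).resolve_right (green_pos hκ (by positivity)).ne'
  simp [this]

lemma IsDistSolution.nonneg_of_nonneg_on (h : IsDistSolution Γ α κ u) (hκ : 0 < κ) (hα : 0 < α)
    (h0 : ∀ x ∈ Γ.carrier, 0 ≤ u x) (x : Plane) : 0 ≤ u x := by
  rw [h.eq_integral_green hκ x]
  refine mul_nonneg hα.le (integral_nonneg_of_ae ?_)
  filter_upwards [Γ.ae_mem_carrier] with z hz using mul_nonneg (h0 z hz) (green_nonneg _ _)

lemma green_sq_le {r : ℝ} (hκ : 0 < κ) (hr : 0 < r) :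
    green κ (r ^ 2) ≤ greenConst * (κ * r) ^ (-(1 / 3 : ℝ)) := by
  refine (green_le hκ (by positivity)).trans (le_of_eq ?_)
  rw [← mul_pow, ← Real.rpow_natCast, ← Real.rpow_mul (by positivity)]
  norm_num

lemma IsDistSolution.tendsto_cocompact (h : IsDistSolution Γ α κ u) (hκ : 0 < κ) :
    Tendsto u (cocompact Plane) (𝓝 0) := by
  obtain ⟨C, hC⟩ := Γ.isCompact_carrier.isBounded.exists_norm_le
  have hnorm : Tendsto (fun x : Plane => ‖x‖ - C) (cocompact Plane) atTop :=
    tendsto_atTop_add_const_right _ (-C) (tendsto_norm_cocompact_atTop (E := Plane))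
  have h1 : Tendsto (fun x : Plane => |α| * (greenConst * (κ * (‖x‖ - C)) ^ (-(1 / 3 : ℝ)) *
      Γ.sigma.real univ)) (cocompact Plane) (𝓝 0) := by
    have := ((((tendsto_rpow_neg_atTop (y := 1 / 3) (by norm_num)).comp
      (hnorm.const_mul_atTop hκ)).const_mul greenConst).mul_const (Γ.sigma.real univ)).const_mul |α|
    simpa using! this
  refine squeeze_zero_norm' ?_ h1
  filter_upwards [hnorm.eventually_gt_atTop 0] with x hx
  rw [h.eq_integral_green hκ x, norm_mul, Real.norm_eq_abs α]
  refine mul_le_mul_of_nonneg_left ?_ (abs_nonneg α)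
  refine norm_integral_le_of_norm_le_const ?_
  filter_upwards [Γ.ae_mem_carrier] with z hz
  have h2 : ‖x‖ - C ≤ ‖x - z‖ := by linarith [norm_sub_norm_le x z, hC z hz]
  rw [norm_mul, Real.norm_of_nonneg (green_nonneg _ _)]
  refine (mul_le_of_le_one_left (green_nonneg _ _) (h.le_one z)).trans ?_
  exact (green_anti hκ (by positivity) (by gcongr)).trans (green_sq_le hκ hx)

lemma killedHeat_le_mul {t q : ℝ} (ht : 0 < t) (hq : 0 < q) :
    killedHeat κ t q ≤ 8 / (Real.pi * q ^ 2) * t := by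
  unfold killedHeat
  have h1 : Real.exp (-(κ ^ 2 * t) - q / (4 * t)) ≤ Real.exp (-(q / (4 * t))) := by
    gcongr
    have : 0 ≤ κ ^ 2 * t := by positivity
    linarith
  have h2 := h1.trans (exp_neg_sq_le (x := q / (4 * t)) (by positivity))
  calc (4 * Real.pi * t)⁻¹ * Real.exp (-(κ ^ 2 * t) - q / (4 * t))
      ≤ (4 * Real.pi * t)⁻¹ * (2 / (q / (4 * t)) ^ 2) := by gcongr
    _ = 8 / (Real.pi * q ^ 2) * t := by field_simp; norm_num

/-- A maximum principle for the heat mean. Away from the curve the source term is at most `C t`, so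
the mean starting from `u x = 1` stays above `1 - C t² / 2`. But it is bounded by `exp(-κ² t)`,
which decreases linearly at first. -/
lemma IsDistSolution.lt_one (h : IsDistSolution Γ α κ u) (hκ : 0 < κ) (hα : 0 < α)
    {x : Plane} (hx : x ∉ Γ.carrier) : u x < 1 := by
  classical
  refine lt_of_le_of_ne ((le_abs_self _).trans (h.le_one x)) fun hx1 => ?_
  obtain ⟨δ, hδ, hball⟩ := Metric.isOpen_iff.1 Γ.isCompact_carrier.isClosed.isOpen_compl x hx
  have hdist : ∀ z ∈ Γ.carrier, δ ≤ ‖x - z‖ := fun z hz => by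
    by_contra! hlt
    exact hball (by rwa [Metric.mem_ball, dist_comm, dist_eq_norm]) hz
  set C := α * (8 / (Real.pi * (δ ^ 2) ^ 2) * Γ.L) with hC
  have hL := Γ.L_pos
  have hC0 : 0 < C := by positivity
  have hsig : Γ.sigma.real univ = Γ.L := by
    simp [Measure.real, Γ.sigma_univ, hL.le]
  have hk : ∀ t > 0, α * curveHeat Γ κ u x t ≤ C * t := fun t ht => by
    have : ‖curveHeat Γ κ u x t‖ ≤ (8 / (Real.pi * (δ ^ 2) ^ 2) * t) * Γ.sigma.real univ := by
      refine norm_integral_le_of_norm_le_const ?_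
      filter_upwards [Γ.ae_mem_carrier] with z hz
      rw [norm_mul, Real.norm_of_nonneg (killedHeat_pos ht).le]
      refine (mul_le_of_le_one_left (killedHeat_pos ht).le (h.le_one z)).trans ?_
      refine (killedHeat_anti ht ?_).trans (killedHeat_le_mul ht (by positivity))
      have := hdist z hz
      gcongr
    rw [hsig] at this
    calc α * curveHeat Γ κ u x t ≤ α * (8 / (Real.pi * (δ ^ 2) ^ 2) * t * Γ.L) := by
          gcongr
          exact (le_abs_self _).trans this
      _ = C * t := by rw [hC]; ring
  set f : ℝ → ℝ := Function.update (heatMean κ u x) 0 (u x) with hf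
  have hfe : ∀ t > 0, f t = heatMean κ u x t := fun t ht => by
    simp [hf, Function.update_of_ne ht.ne']
  have hderiv : ∀ t ∈ Ioi (0 : ℝ), HasDerivAt f (-(α * curveHeat Γ κ u x t)) t := fun t ht =>
    (h.hasDerivAt_heatMean x ht).congr_of_eventuallyEq
      (by filter_upwards [Ioi_mem_nhds ht] with s hs using hfe s hs)
  have hd2 : ∀ t ∈ Ioi (0 : ℝ), HasDerivAt (fun t => f t + C / 2 * t ^ 2)
      (-(α * curveHeat Γ κ u x t) + C * t) t := fun t ht => by
    refine ((hderiv t ht).add ((hasDerivAt_pow 2 t).const_mul (C / 2))).congr_deriv ?_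
    simp; ring
  have hcont : ContinuousOn (fun t => f t + C / 2 * t ^ 2) (Ici 0) := by
    refine ContinuousOn.add (fun t ht => ?_) (by fun_prop)
    rcases eq_or_lt_of_le (mem_Ici.1 ht) with rfl | ht
    · rw [continuousWithinAt_update_same, Ici_sdiff_left]
      exact h.tendsto_heatMean x
    · exact (hderiv t ht).continuousAt.continuousWithinAt
  have hmono : MonotoneOn (fun t => f t + C / 2 * t ^ 2) (Ici 0) := by
    refine monotoneOn_of_deriv_nonneg (convex_Ici 0) hcont ?_ ?_
    · rw [interior_Ici]
      exact fun t ht => (hd2 t ht).differentiableAt.differentiableWithinAt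
    · rw [interior_Ici]
      intro t ht
      rw [(hd2 t ht).deriv]
      linarith [hk t ht]
  -- Small enough for the quadratic loss, multiplied by `1 + κ² t`, to be at most `κ² t / 2`.
  set t := min 1 (κ ^ 2 / (C * (1 + κ ^ 2))) with ht
  have ht0 : 0 < t := by positivity
  have ht1 : t ≤ 1 := min_le_left _ _
  have ht2 : C * t * (1 + κ ^ 2) ≤ κ ^ 2 := by
    have := min_le_right 1 (κ ^ 2 / (C * (1 + κ ^ 2)))
    rw [← ht, le_div_iff₀ (by positivity)] at this
    linarith
  have h1 := hmono self_mem_Ici ht0.le ht0.le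
  have h2 := (le_abs_self _).trans (h.abs_heatMean_le x ht0)
  have h3 : Real.exp (-(κ ^ 2 * t)) * (1 + κ ^ 2 * t) ≤ 1 := by
    rw [Real.exp_neg, inv_mul_le_iff₀ (Real.exp_pos _)]
    linarith [Real.add_one_le_exp (κ ^ 2 * t)]
  have hf0 : f 0 = 1 := by simp [hf, hx1]
  simp only [hf0] at h1
  rw [hfe t ht0] at h1
  have h4 : 1 - C / 2 * t ^ 2 ≤ Real.exp (-(κ ^ 2 * t)) := by linarith
  have hκ2 : 0 < κ ^ 2 := by positivity
  have h5 : (1 - C / 2 * t ^ 2) * (1 + κ ^ 2 * t) ≤ 1 :=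
    (mul_le_mul_of_nonneg_right h4 (by positivity)).trans h3
  have h6 : κ ^ 2 * t ≤ C / 2 * t ^ 2 * (1 + κ ^ 2 * t) := by linarith
  have h7 : C / 2 * t ^ 2 * (1 + κ ^ 2 * t) ≤ C / 2 * t ^ 2 * (1 + κ ^ 2) := by
    gcongr
    nlinarith
  nlinarith

/-- `u` vanishes at infinity, so the supremum is attained, and it cannot be attained off the curve.
-/
lemma IsDistSolution.exists_abs_eq_one (h : IsDistSolution Γ α κ u) (hκ : 0 < κ) (hα : 0 < α)
    (hlub : IsLUB (range fun x => |u x|) 1) : ∃ x ∈ Γ.carrier, |u x| = 1 := by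
  obtain ⟨x₀, hx₀⟩ : ∃ x, 0 < |u x| := by
    obtain ⟨_, ⟨x, rfl⟩, hx, -⟩ := hlub.exists_between one_pos
    exact ⟨x, hx⟩
  have hc : Continuous fun x => |u x| := h.continuous.abs
  have ht : Tendsto (fun x => |u x|) (cocompact Plane) (𝓝 0) := by
    simpa using (h.tendsto_cocompact hκ).abs
  obtain ⟨x, hx⟩ := hc.exists_forall_ge' x₀ ((ht.eventually_lt_const hx₀).mono fun _ h => h.le)
  have hx1 : |u x| = 1 := by
    refine le_antisymm (h.le_one x) (hlub.2 ?_)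
    rintro _ ⟨y, rfl⟩
    exact hx y
  refine ⟨x, ?_, hx1⟩
  by_contra hxΓ
  rcases le_total 0 (u x) with h0 | h0
  · exact (h.lt_one hκ hα hxΓ).ne (by rwa [abs_of_nonneg h0] at hx1)
  · exact (h.neg.lt_one hκ hα hxΓ).ne (by rwa [abs_of_nonpos h0] at hx1)

/-! ### Hölder continuity -/

/-- The natural bound is a multiple of `√(L / M)`; the hypothesis `M L ≤ 4R` replaces the length by
the radius. -/
lemma PlaneCurve.integral_inv_sqrt_le (Γ : PlaneCurve) {R : ℝ} (hR : Γ.injConst * Γ.L ≤ 4 * R)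
    (x : Plane) : Integrable (fun z => (√‖x - z‖)⁻¹) Γ.sigma ∧
      ∫ z, (√‖x - z‖)⁻¹ ∂Γ.sigma ≤ 24 * √R / Γ.injConst := by
  have hM := Γ.injConst_pos
  have hL := Γ.L_pos
  obtain ⟨h1, h2⟩ := Γ.integral_rpow_le (b := 1 / 2) (by norm_num) (by norm_num) x
  have e : ∀ z, ‖x - z‖ ^ (-(1 / 2 : ℝ)) = (√‖x - z‖)⁻¹ := fun z => by
    rw [Real.rpow_neg (norm_nonneg _), Real.sqrt_eq_rpow]
  simp only [e] at h1 h2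
  refine ⟨h1, h2.trans ?_⟩
  rw [Real.rpow_neg (by positivity), show (1 : ℝ) - 1 / 2 = 1 / 2 by norm_num, ← Real.sqrt_eq_rpow,
    ← Real.sqrt_eq_rpow]
  have h3 : √(Γ.injConst / 2) * √(Γ.injConst / 2) = Γ.injConst / 2 :=
    Real.mul_self_sqrt (by positivity)
  have h4 : √(Γ.injConst / 2) * √Γ.L ≤ 3 / 2 * √R := by
    rw [← Real.sqrt_mul (by positivity)]
    refine Real.sqrt_le_iff.2 ⟨by positivity, ?_⟩
    have hR0 : 0 ≤ R := by nlinarith [mul_pos hM hL]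
    rw [mul_pow, Real.sq_sqrt hR0]
    nlinarith
  have h5 : 0 < √(Γ.injConst / 2) := Real.sqrt_pos.2 (by positivity)
  rw [le_div_iff₀ hM]
  calc 4 * ((√(Γ.injConst / 2))⁻¹ * (√Γ.L / (1 / 2))) * Γ.injConst
      = 16 * ((√(Γ.injConst / 2))⁻¹ * √Γ.L * (Γ.injConst / 2)) := by ring
    _ = 16 * (√(Γ.injConst / 2) * √Γ.L) := by
        have h6 : (√(Γ.injConst / 2))⁻¹ * (Γ.injConst / 2) = √(Γ.injConst / 2) := by
          nth_rewrite 2 [← h3]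
          field_simp
        rw [mul_right_comm, h6]
    _ ≤ 24 * √R := by linarith

/-- The Hölder estimate of the Green function, integrated along the curve. The constant does not
involve `κ`, so it serves for the excited state without a bound on its eigenvalue. -/
lemma IsDistSolution.abs_sub_le (h : IsDistSolution Γ α κ u) (hκ : 0 < κ) (hα : 0 < α) {R : ℝ}
    (hR : Γ.injConst * Γ.L ≤ 4 * R) (x y : Plane) :
    |u x - u y| ≤ 16 * α / Γ.injConst * √R * √‖x - y‖ := by
  have hM := Γ.injConst_pos
  obtain ⟨h1, h2⟩ := Γ.integral_inv_sqrt_le hR x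
  obtain ⟨h3, h4⟩ := Γ.integral_inv_sqrt_le hR y
  rw [h.eq_integral_green hκ x, h.eq_integral_green hκ y, ← mul_sub,
    ← integral_sub (h.integrable_green hκ x) (h.integrable_green hκ y), abs_mul, abs_of_pos hα]
  have h5 : ‖∫ z, (u z * green κ (‖x - z‖ ^ 2) - u z * green κ (‖y - z‖ ^ 2)) ∂Γ.sigma‖ ≤
      ∫ z, 1 / Real.pi * √‖x - y‖ * ((√‖x - z‖)⁻¹ + (√‖y - z‖)⁻¹) ∂Γ.sigma := by
    refine norm_integral_le_of_norm_le ((h1.add h3).const_mul _) ?_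
    filter_upwards [Γ.ae_ne x, Γ.ae_ne y] with z hzx hzy
    rw [← mul_sub, norm_mul]
    refine (mul_le_of_le_one_left (norm_nonneg _) (h.le_one z)).trans ?_
    have := abs_green_sub_green_le hκ (sub_ne_zero.2 hzx.symm) (sub_ne_zero.2 hzy.symm)
    rwa [sub_sub_sub_cancel_right] at this
  rw [integral_const_mul, integral_add h1 h3] at h5
  calc α * ‖∫ z, (u z * green κ (‖x - z‖ ^ 2) - u z * green κ (‖y - z‖ ^ 2)) ∂Γ.sigma‖
      ≤ α * (1 / Real.pi * √‖x - y‖ * (24 * √R / Γ.injConst + 24 * √R / Γ.injConst)) := by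
        gcongr
        exact h5.trans (by gcongr)
    _ = 48 / Real.pi * (α / Γ.injConst * √R * √‖x - y‖) := by ring
    _ ≤ 16 * (α / Γ.injConst * √R * √‖x - y‖) := by
        gcongr
        rw [div_le_iff₀ Real.pi_pos]
        linarith [Real.pi_gt_three]
    _ = _ := by ring

/-! ### The lower bound for positive solutions -/

/-- At the maximum, `1 = α ∫ u(z) G(p - z) dσ(z)`. Points within `δ` of `p` contribute at most
`1/2`, even with `u` replaced by `1`. Beyond that distance `G ≤ greenConst / v`, so `α ∫ u dσ ≥ v /
(2 greenConst)`. Any two points of the ball are at distance at most `2R`, where `G` is bounded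
below, and the representation at `x` gives the claim. -/
lemma IsDistSolution.le_of_nonneg (h : IsDistSolution Γ α κ u) (hκ : 0 < κ) (hα : 0 < α)
    (h0 : ∀ x, 0 ≤ u x) {p : Plane} (hp : u p = 1) {A : ℝ} (hA0 : 0 < A)
    (hA : 24 * greenConst * α / Γ.injConst ≤ A) {x₀ : Plane} {R : ℝ} (hR : 0 < R)
    (hΓ : Γ.carrier ⊆ Metric.closedBall x₀ R) {x : Plane} (hx : x ∈ Metric.closedBall x₀ R) :
    (16 * Real.pi * greenConst)⁻¹ * √(κ / A) * Real.exp (-(3 * (κ * R))) ≤ u x := by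
  have hM := Γ.injConst_pos
  have hG := greenConst_pos
  set v := √(κ / A) with hv
  have hv0 : 0 < v := Real.sqrt_pos.2 (by positivity)
  have hv2 : v ^ 2 = κ / A := Real.sq_sqrt (by positivity)
  -- Two requirements meet here: `(κδ) ^ (-1/3) = v⁻¹` for the far part, and `κ ^ (-1/3) δ ^ (2/3) =
  -- v² / κ = 1 / A` for the near part.
  set δ := v ^ 3 / κ with hδ
  have hδ0 : 0 < δ := by positivity
  have hS := Γ.lintegral_singularPower_le (isLowerSet_Iio δ) (b := 1 / 3)
    (ℓ := 2 / Γ.injConst * δ) (by norm_num) (by norm_num) (by positivity) (fun τ _ _ hτ => by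
      rw [div_mul_eq_mul_div, le_div_iff₀ hM]
      have := mem_Iio.1 hτ
      linarith) p
  have hSm : AEMeasurable (fun z : Plane => singularPower (Iio δ) (1 / 3) ‖p - z‖) Γ.sigma :=
    ((singularPower_antitone (isLowerSet_Iio δ) (by norm_num)).measurable.comp
      (by fun_prop)).aemeasurable
  have hSfin := (hS.trans_lt ENNReal.ofReal_lt_top).ne
  have hSi := integrable_toReal_of_lintegral_ne_top hSm hSfin
  have hSint := integral_toReal hSm (ae_lt_top' hSm hSfin)
  set N := ∫ z, (singularPower (Iio δ) (1 / 3) ‖p - z‖).toReal ∂Γ.sigma with hN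
  have hNle : N ≤ 4 * ((Γ.injConst / 2) ^ (-(1 / 3 : ℝ)) *
      ((2 / Γ.injConst * δ) ^ (1 - 1 / 3 : ℝ) / (1 - 1 / 3))) := by
    rw [hSint]
    refine ENNReal.toReal_le_of_le_ofReal ?_ hS
    have : (0 : ℝ) < 1 - 1 / 3 := by norm_num
    positivity
  have hui : Integrable u Γ.sigma := Γ.integrable_sigma_of_continuous h.continuous
  have hpt : ∀ᵐ z ∂Γ.sigma, u z * green κ (‖p - z‖ ^ 2) ≤ greenConst * κ ^ (-(1 / 3 : ℝ)) *
      (singularPower (Iio δ) (1 / 3) ‖p - z‖).toReal + greenConst * v⁻¹ * u z := by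
    filter_upwards [Γ.ae_ne p] with z hz
    have hr : 0 < ‖p - z‖ := norm_pos_iff.2 (sub_ne_zero.2 hz.symm)
    have hg := green_sq_le hκ hr
    have hu1 := (le_abs_self _).trans (h.le_one z)
    rw [singularPower, if_neg (not_le.2 hr)]
    by_cases hlt : ‖p - z‖ < δ
    · rw [if_pos (mem_Iio.2 hlt), ENNReal.toReal_ofReal (by positivity), mul_assoc,
        ← Real.mul_rpow hκ.le hr.le]
      have h1 : u z * green κ (‖p - z‖ ^ 2) ≤ 1 * green κ (‖p - z‖ ^ 2) := by
        gcongr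
        exact green_nonneg _ _
      have h2 : 0 ≤ greenConst * v⁻¹ * u z := mul_nonneg (by positivity) (h0 z)
      linarith
    · rw [if_neg (fun hc => hlt (mem_Iio.1 hc)), ENNReal.toReal_zero, mul_zero, zero_add,
        mul_comm (greenConst * v⁻¹)]
      refine mul_le_mul_of_nonneg_left (hg.trans ?_) (h0 z)
      gcongr
      have h1 : v ^ 3 ≤ κ * ‖p - z‖ := by
        rw [not_lt, hδ, div_le_iff₀ hκ] at hlt
        linarith
      refine (Real.rpow_le_rpow_of_nonpos (by positivity) h1 (by norm_num)).trans (le_of_eq ?_)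
      rw [← Real.rpow_natCast, ← Real.rpow_mul hv0.le, ← Real.rpow_neg_one]
      norm_num
  have hI : 1 ≤ α * (greenConst * κ ^ (-(1 / 3 : ℝ)) * N + greenConst * v⁻¹ * ∫ z, u z ∂Γ.sigma) := by
    have h1 := h.eq_integral_green hκ p
    rw [hp] at h1
    refine h1.le.trans (mul_le_mul_of_nonneg_left ?_ hα.le)
    refine (integral_mono_ae (h.integrable_green hκ p)
      ((hSi.const_mul _).add (hui.const_mul _)) hpt).trans (le_of_eq ?_)
    rw [integral_add' (hSi.const_mul _) (hui.const_mul _), integral_const_mul,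
      integral_const_mul]
  have hnear : α * (greenConst * κ ^ (-(1 / 3 : ℝ)) * N) ≤ 1 / 2 := by
    -- The powers of `2 / M` add up to one, and `12 = 4 · 2 · (3/2)`; the constant `24` in the
    -- hypothesis on `A` makes the near part at most `1/2`.
    have e1 : κ ^ (-(1 / 3 : ℝ)) * (4 * ((Γ.injConst / 2) ^ (-(1 / 3 : ℝ)) *
      ((2 / Γ.injConst * δ) ^ (1 - 1 / 3 : ℝ) / (1 - 1 / 3)))) = 12 / (Γ.injConst * A) := by
      have hMi : Γ.injConst / 2 = (2 / Γ.injConst)⁻¹ := by rw [inv_div]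
      rw [hMi, Real.inv_rpow (by positivity), ← Real.rpow_neg (by positivity), neg_neg,
        Real.mul_rpow (by positivity) hδ0.le, hδ, Real.div_rpow (by positivity) hκ.le,
        ← Real.rpow_natCast v, ← Real.rpow_mul hv0.le]
      have e2 : (2 / Γ.injConst) ^ (1 / 3 : ℝ) * (2 / Γ.injConst) ^ (1 - 1 / 3 : ℝ) =
          2 / Γ.injConst := by
        rw [← Real.rpow_add (by positivity)]
        norm_num
      have e3 : κ ^ (-(1 / 3 : ℝ)) / κ ^ (1 - 1 / 3 : ℝ) = κ⁻¹ := by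
        rw [← Real.rpow_sub hκ, ← Real.rpow_neg_one]
        norm_num
      have e4 : v ^ (((3 : ℕ) : ℝ) * (1 - 1 / 3)) = κ / A := by
        rw [← hv2, ← Real.rpow_natCast]
        norm_num
      rw [e4]
      calc _ = (κ ^ (-(1 / 3 : ℝ)) / κ ^ (1 - 1 / 3 : ℝ)) * ((2 / Γ.injConst) ^ (1 / 3 : ℝ) *
            (2 / Γ.injConst) ^ (1 - 1 / 3 : ℝ)) * (κ / A) * 6 := by ring
        _ = _ := by
            rw [e2, e3]
            field_simp
            norm_num
    calc α * (greenConst * κ ^ (-(1 / 3 : ℝ)) * N)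
        ≤ α * (greenConst * κ ^ (-(1 / 3 : ℝ)) * (4 * ((Γ.injConst / 2) ^ (-(1 / 3 : ℝ)) *
      ((2 / Γ.injConst * δ) ^ (1 - 1 / 3 : ℝ) / (1 - 1 / 3))))) := by gcongr
      _ = α * (greenConst * (12 / (Γ.injConst * A))) := by rw [mul_assoc greenConst, e1]
      _ ≤ 1 / 2 := by
        rw [div_le_iff₀ hM] at hA
        have : α * (greenConst * (12 / (Γ.injConst * A))) =
          (12 * greenConst * α) / (Γ.injConst * A) := by ring
        rw [this, div_le_iff₀ (by positivity)]
        linarith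
  have hfar : v / (2 * greenConst) ≤ α * ∫ z, u z ∂Γ.sigma := by
    rw [mul_add] at hI
    have h1 : 1 / 2 ≤ α * (greenConst * v⁻¹ * ∫ z, u z ∂Γ.sigma) := by linarith
    have h2 : α * (greenConst * v⁻¹ * ∫ z, u z ∂Γ.sigma) =
      (α * ∫ z, u z ∂Γ.sigma) * greenConst / v := by field_simp
    rw [h2, le_div_iff₀ hv0] at h1
    rw [div_le_iff₀ (by positivity)]
    linarith
  have hlow : 1 / (8 * Real.pi) * Real.exp (-(3 * (κ * R))) * ∫ z, u z ∂Γ.sigma ≤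
      ∫ z, u z * green κ (‖x - z‖ ^ 2) ∂Γ.sigma := by
    rw [← integral_const_mul]
    refine integral_mono_ae (hui.const_mul _) (h.integrable_green hκ x) ?_
    filter_upwards [Γ.ae_ne x, Γ.ae_mem_carrier] with z hz hzΓ
    have hr : 0 < ‖x - z‖ := norm_pos_iff.2 (sub_ne_zero.2 hz.symm)
    rw [mul_comm]
    refine mul_le_mul_of_nonneg_left ?_ (h0 z)
    have h1 := le_green hκ (r := 2 * R) (by positivity)
    have h2 : -(3 / 2 * (κ * (2 * R))) = -(3 * (κ * R)) := by ring
    rw [h2] at h1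
    refine h1.trans (green_anti hκ (by positivity) ?_)
    have h3 : ‖x - z‖ ≤ 2 * R := by
      rw [← dist_eq_norm]
      have := dist_triangle_right x z x₀
      have := Metric.mem_closedBall.1 hx
      have := Metric.mem_closedBall.1 (hΓ hzΓ)
      linarith
    gcongr
  rw [h.eq_integral_green hκ x]
  calc (16 * Real.pi * greenConst)⁻¹ * v * Real.exp (-(3 * (κ * R)))
      = 1 / (8 * Real.pi) * Real.exp (-(3 * (κ * R))) * (v / (2 * greenConst)) := by
        field_simp
        norm_num
    _ ≤ 1 / (8 * Real.pi) * Real.exp (-(3 * (κ * R))) * (α * ∫ z, u z ∂Γ.sigma) := by gcongr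
    _ = α * (1 / (8 * Real.pi) * Real.exp (-(3 * (κ * R))) * ∫ z, u z ∂Γ.sigma) := by ring
    _ ≤ _ := by gcongr

end

section

variable {Γ : PlaneCurve} {α κ : ℝ} {u : Plane → ℝ}

/-! ### Derivatives off the curve -/

lemma PlaneCurve.exists_le_norm_sub (Γ : PlaneCurve) {x : Plane} (hx : x ∉ Γ.carrier) :
    ∃ δ > 0, ∀ y ∈ Metric.ball x δ, ∀ z ∈ Γ.carrier, δ ≤ ‖y - z‖ := by
  obtain ⟨δ, hδ, hball⟩ := Metric.isOpen_iff.1 Γ.isCompact_carrier.isClosed.isOpen_compl x hx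
  refine ⟨δ / 2, by positivity, fun y hy z hz => ?_⟩
  by_contra! hlt
  refine hball ?_ hz
  rw [← dist_eq_norm] at hlt
  have h1 := dist_triangle z y x
  rw [Metric.mem_ball] at hy ⊢
  rw [dist_comm z y] at h1
  linarith

lemma PlaneCurve.integrable_inv_norm (Γ : PlaneCurve) {x : Plane} (hx : x ∉ Γ.carrier) :
    Integrable (fun z => ‖x - z‖⁻¹) Γ.sigma := by
  obtain ⟨δ, hδ, h⟩ := Γ.exists_le_norm_sub hx
  refine Integrable.mono' (integrable_const δ⁻¹)
    (Measurable.aestronglyMeasurable (by fun_prop)) ?_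
  filter_upwards [Γ.ae_mem_carrier] with z hz
  rw [Real.norm_of_nonneg (by positivity)]
  exact inv_anti₀ hδ (h x (Metric.mem_ball_self hδ) z hz)

lemma IsDistSolution.hasFDerivAt (h : IsDistSolution Γ α κ u) (hκ : 0 < κ) {x : Plane}
    (hx : x ∉ Γ.carrier) :
    HasFDerivAt u (α • ∫ z, u z • greenFDeriv κ (x - z) ∂Γ.sigma) x := by
  obtain ⟨δ, hδ, hd⟩ := Γ.exists_le_norm_sub hx
  have hmu := h.continuous.measurable
  have hmg := measurable_green κ
  have key := hasFDerivAt_integral_of_dominated_of_fderiv_le (𝕜 := ℝ) (μ := Γ.sigma)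
    (F := fun x z => u z * green κ (‖x - z‖ ^ 2)) (F' := fun x z => u z • greenFDeriv κ (x - z))
    (x₀ := x) (s := Metric.ball x δ) (bound := fun _ => δ⁻¹) (Metric.ball_mem_nhds x hδ)
    (Eventually.of_forall fun y => Measurable.aestronglyMeasurable (by fun_prop))
    (h.integrable_green hκ x) ?_ ?_ (integrable_const _) ?_
  · have e : u = fun x => α • ∫ z, u z * green κ (‖x - z‖ ^ 2) ∂Γ.sigma :=
      funext fun x => h.eq_integral_green hκ x
    exact (key.const_smul α).congr_of_eventuallyEq (Eventually.of_forall (congrFun e))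
  · have := measurable_greenFDeriv κ
    exact Measurable.aestronglyMeasurable (by fun_prop)
  · filter_upwards [Γ.ae_mem_carrier] with z hz y hy
    rw [norm_smul]
    refine (mul_le_of_le_one_left (norm_nonneg _) (h.le_one z)).trans ?_
    refine (norm_greenFDeriv_le κ _).trans ?_
    rw [one_div]
    exact inv_anti₀ hδ (hd y hy z hz)
  · filter_upwards [Γ.ae_mem_carrier] with z hz y hy
    have hyz : y - z ≠ 0 := norm_pos_iff.1 (hδ.trans_le (hd y hy z hz))
    have h1 := (hasFDerivAt_green hκ hyz).comp y ((hasFDerivAt_id y).sub_const z)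
    exact h1.const_mul (u z)

/-- The Newtonian potential `∫ |x - z|⁻¹ dσ(z)` of the curve. -/
def PlaneCurve.newton (Γ : PlaneCurve) (x : Plane) : ℝ := ∫ z, ‖x - z‖⁻¹ ∂Γ.sigma

lemma PlaneCurve.newton_nonneg (Γ : PlaneCurve) (x : Plane) : 0 ≤ Γ.newton x :=
  integral_nonneg fun z => by positivity

lemma IsDistSolution.norm_fderiv_le (h : IsDistSolution Γ α κ u) (hκ : 0 < κ) (hα : 0 < α)
    {x : Plane} (hx : x ∉ Γ.carrier) : ‖fderiv ℝ u x‖ ≤ α * Γ.newton x := by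
  rw [(h.hasFDerivAt hκ hx).fderiv, norm_smul, Real.norm_of_nonneg hα.le]
  refine mul_le_mul_of_nonneg_left ?_ hα.le
  refine norm_integral_le_of_norm_le (Γ.integrable_inv_norm hx) (Eventually.of_forall fun z => ?_)
  rw [norm_smul]
  refine (mul_le_of_le_one_left (norm_nonneg _) (h.le_one z)).trans ?_
  simpa using norm_greenFDeriv_le κ (x - z)

lemma integrableOn_inv_norm (r : ℝ) :
    IntegrableOn (fun x : Plane => ‖x‖⁻¹) (Metric.ball 0 r) := by
  rw [integrableOn_fun_norm_addHaar volume (f := fun r => r⁻¹), finrank_euclideanSpace_fin]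
  refine (integrableOn_const (C := (1 : ℝ)) (s := Ioo 0 r) (by simp)).congr_fun (fun y hy => ?_)
    measurableSet_Ioo
  have : y ≠ 0 := hy.1.ne'
  simp [this]

/-- Fubini: in the plane `‖x‖⁻¹` is locally integrable, with a bound uniform in the translations by
points of the curve. -/
lemma PlaneCurve.integrableOn_newton (Γ : PlaneCurve) (x₀ : Plane) (R : ℝ) :
    IntegrableOn Γ.newton (Metric.closedBall x₀ R) := by
  obtain ⟨C, hC⟩ := Γ.isCompact_carrier.isBounded.subset_closedBall x₀
  have hsub : ∀ z ∈ Γ.carrier, ∀ x ∈ Metric.closedBall x₀ R, x - z ∈ Metric.ball 0 (R + C + 1) := by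
    intro z hz x hx
    rw [Metric.mem_ball, dist_zero_right, ← dist_eq_norm]
    have h1 := dist_triangle_right x z x₀
    have h2 := Metric.mem_closedBall.1 hx
    have h3 := Metric.mem_closedBall.1 (hC hz)
    linarith
  have hshift : ∀ z, IntegrableOn (fun x : Plane => (Metric.ball (0 : Plane) (R + C + 1)).indicator
      (fun x => ‖x‖⁻¹) (x - z)) univ := fun z => by
    have := ((integrableOn_inv_norm (R + C + 1)).integrable_indicator
      measurableSet_ball).comp_sub_right z
    exact this.integrableOn
  have hm : Measurable fun p : Plane × Plane => ‖p.1 - p.2‖⁻¹ := by fun_prop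
  have hprod : Integrable (fun p : Plane × Plane => ‖p.1 - p.2‖⁻¹)
      ((volume.restrict (Metric.closedBall x₀ R)).prod Γ.sigma) := by
    rw [integrable_prod_iff' hm.aestronglyMeasurable]
    have heq : ∀ z ∈ Γ.carrier, EqOn (fun x : Plane => (Metric.ball (0 : Plane)
        (R + C + 1)).indicator (fun x => ‖x‖⁻¹) (x - z)) (fun x => ‖x - z‖⁻¹)
        (Metric.closedBall x₀ R) := fun z hz x hx => by
      simp only [indicator_of_mem (hsub z hz x hx)]
    have hint : ∀ z ∈ Γ.carrier, IntegrableOn (fun x : Plane => ‖x - z‖⁻¹)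
        (Metric.closedBall x₀ R) := fun z hz =>
      ((hshift z).mono_set (subset_univ _)).congr_fun (heq z hz) measurableSet_closedBall
    constructor
    · filter_upwards [Γ.ae_mem_carrier] with z hz using hint z hz
    · refine Integrable.mono' (integrable_const (∫ x : Plane, (Metric.ball (0 : Plane)
        (R + C + 1)).indicator (fun x => ‖x‖⁻¹) x)) ?_ ?_
      · exact hm.norm.stronglyMeasurable.integral_prod_left'.aestronglyMeasurable
      · filter_upwards [Γ.ae_mem_carrier] with z hz
        rw [Real.norm_of_nonneg (integral_nonneg fun x => norm_nonneg _)]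
        have e : ∀ x : Plane, ‖‖x - z‖⁻¹‖ = ‖x - z‖⁻¹ := fun x => by simp
        simp only [e]
        rw [← setIntegral_congr_fun measurableSet_closedBall (heq z hz),
          ← integral_sub_right_eq_self (μ := (volume : Measure Plane)) _ z]
        refine setIntegral_le_integral (by simpa using hshift z)
          (Eventually.of_forall fun x => ?_)
        exact indicator_nonneg (fun y _ => by positivity) _
  exact hprod.integral_prod_left

/-- The curve is the image of a segment of a coordinate axis, a null set, under a differentiable map
of the plane's subset into the plane. -/
lemma PlaneCurve.volume_carrier (Γ : PlaneCurve) : volume Γ.carrier = 0 := by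
  have hline : volume {p : Plane | p 1 = 0} = 0 := by
    have h1 : ({p : Plane | p 1 = 0} : Set Plane) =
        (LinearMap.ker (EuclideanSpace.proj 1 : Plane →L[ℝ] ℝ).toLinearMap : Submodule ℝ Plane) := by
      ext p; simp
    rw [h1]
    refine Measure.addHaar_submodule volume _ fun htop => ?_
    have : (EuclideanSpace.single 1 1 : Plane) ∈
        LinearMap.ker (EuclideanSpace.proj 1 : Plane →L[ℝ] ℝ).toLinearMap := by
      rw [htop]; trivial
    simp at this
  have hsub : Γ.carrier ⊆ (fun p : Plane => Γ.γ (p 0)) '' {p : Plane | p 0 ∈ Icc 0 Γ.L ∧ p 1 = 0} := by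
    rintro _ ⟨s, hs, rfl⟩
    exact ⟨EuclideanSpace.single 0 s, by simpa using hs, by simp⟩
  refine measure_mono_null hsub (addHaar_image_eq_zero_of_differentiableOn_of_addHaar_eq_zero
    volume ?_ (measure_mono_null (fun p hp => hp.2) hline))
  have hγ : DifferentiableOn ℝ Γ.γ (Icc 0 Γ.L) := Γ.contDiffOn.differentiableOn (by norm_num)
  exact hγ.comp (t := Icc 0 Γ.L) (EuclideanSpace.proj 0 : Plane →L[ℝ] ℝ).differentiable.differentiableOn
    fun p hp => hp.1

/-! ### Quotients of solutions -/

lemma hasFDerivAt_div_of_ne {v u : Plane → ℝ} {v' u' : Plane →L[ℝ] ℝ} {x : Plane}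
    (hv : HasFDerivAt v v' x) (hu : HasFDerivAt u u' x) (h0 : u x ≠ 0) :
    HasFDerivAt (fun y => v y / u y) ((u x ^ 2)⁻¹ • (u x • v' - v x • u')) x := by
  have h1 := hv.mul ((hasDerivAt_inv h0).comp_hasFDerivAt x hu)
  refine (h1.congr_fderiv ?_).congr_of_eventuallyEq
    (Eventually.of_forall fun y => div_eq_mul_inv _ _)
  ext w
  simp
  field_simp
  ring

lemma IsDistSolution.differentiableAt_div {κ₁ : ℝ} {v : Plane → ℝ} (h : IsDistSolution Γ α κ u)
    (hκ : 0 < κ) (h₁ : IsDistSolution Γ α κ₁ v) (hκ₁ : 0 < κ₁) {x : Plane} (hx : x ∉ Γ.carrier)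
    (h0 : u x ≠ 0) : DifferentiableAt ℝ (fun y => v y / u y) x :=
  ((hasFDerivAt_div_of_ne (h₁.hasFDerivAt hκ₁ hx).differentiableAt.hasFDerivAt
    (h.hasFDerivAt hκ hx).differentiableAt.hasFDerivAt h0)).differentiableAt

lemma IsDistSolution.norm_fderiv_div_le {κ₁ m : ℝ} {v : Plane → ℝ} (h : IsDistSolution Γ α κ u)
    (hκ : 0 < κ) (h₁ : IsDistSolution Γ α κ₁ v) (hκ₁ : 0 < κ₁) (hα : 0 < α) {x : Plane}
    (hx : x ∉ Γ.carrier) (hm : 0 < m) (h0 : m ≤ u x) :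
    ‖fderiv ℝ (fun y => v y / u y) x‖ ≤ (m ^ 2)⁻¹ * (2 * α) * Γ.newton x := by
  have hu : 0 < u x := hm.trans_le h0
  have hN := Γ.newton_nonneg x
  have hdu := (h.hasFDerivAt hκ hx).differentiableAt.hasFDerivAt
  have hdv := (h₁.hasFDerivAt hκ₁ hx).differentiableAt.hasFDerivAt
  have hd := (hasFDerivAt_div_of_ne hdv hdu hu.ne').fderiv
  rw [hd, norm_smul, norm_inv, norm_pow, Real.norm_of_nonneg hu.le, mul_assoc]
  have h2 : ‖u x • fderiv ℝ v x - v x • fderiv ℝ u x‖ ≤ 2 * α * Γ.newton x := by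
    refine (norm_sub_le _ _).trans ?_
    rw [norm_smul, norm_smul]
    have e1 := (mul_le_of_le_one_left (norm_nonneg _) (h.le_one x)).trans
      (h₁.norm_fderiv_le hκ₁ hα hx)
    have e2 := (mul_le_of_le_one_left (norm_nonneg _) (h₁.le_one x)).trans
      (h.norm_fderiv_le hκ hα hx)
    rw [Real.norm_eq_abs, Real.norm_eq_abs]
    linarith
  gcongr

lemma IsDistSolution.integrableOn_fderiv_div {κ₁ m : ℝ} {v : Plane → ℝ}
    (h : IsDistSolution Γ α κ u) (hκ : 0 < κ) (h₁ : IsDistSolution Γ α κ₁ v) (hκ₁ : 0 < κ₁)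
    (hα : 0 < α) {x₀ : Plane} {R : ℝ} (hm : 0 < m)
    (h0 : ∀ x ∈ Metric.closedBall x₀ R, m ≤ u x) :
    IntegrableOn (fun x => ‖fderiv ℝ (fun y => v y / u y) x‖) (Metric.closedBall x₀ R) := by
  refine ((Γ.integrableOn_newton x₀ R).const_mul ((m ^ 2)⁻¹ * (2 * α))).mono'
    (measurable_fderiv ℝ _).norm.aestronglyMeasurable ?_
  filter_upwards [ae_restrict_mem measurableSet_closedBall,
    ae_restrict_of_ae (measure_eq_zero_iff_ae_notMem.1 Γ.volume_carrier)] with x hx hxΓ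
  rw [norm_norm]
  exact h.norm_fderiv_div_le hκ h₁ hκ₁ hα hxΓ hm (h0 x hx)

/-! ### Integration along parallel lines -/

/-- Sard's theorem in one dimension: the critical values of `t ↦ ⟨n, γ t⟩` form a null set. The
level set of a regular value is compact and discrete, hence finite. -/
lemma PlaneCurve.ae_finite_level (Γ : PlaneCurve) (n : Plane) :
    ∀ᵐ h : ℝ, {t ∈ Icc 0 Γ.L | inner ℝ n (Γ.γ t) = h}.Finite := by
  have hder : ∀ t ∈ Icc 0 Γ.L, HasDerivWithinAt (fun t => inner ℝ n (Γ.γ t))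
      (inner ℝ n (Γ.tangent t)) (Icc 0 Γ.L) t := fun t ht => by
    have := (innerSL ℝ n).hasFDerivAt.comp_hasDerivWithinAt t (Γ.hasDerivWithinAt_param ht)
    simpa using! this
  have hcont : ContinuousOn (fun t => inner ℝ n (Γ.γ t)) (Icc 0 Γ.L) := fun t ht =>
    (hder t ht).continuousWithinAt
  set S := {t ∈ Icc 0 Γ.L | inner ℝ n (Γ.tangent t) = 0} with hS
  have hnull : volume ((fun t => inner ℝ n (Γ.γ t)) '' S) = 0 := by
    refine addHaar_image_eq_zero_of_det_fderivWithin_eq_zero volume (f' := fun _ => 0)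
      (fun t ht => ?_) fun t _ => ?_
    · have h1 := (hder t ht.1).mono (sep_subset _ _ : S ⊆ Icc 0 Γ.L)
      rw [ht.2] at h1
      have h2 := h1.hasFDerivWithinAt
      simpa using! h2
    · simp
  filter_upwards [measure_eq_zero_iff_ae_notMem.1 hnull] with h hh
  have hK : IsCompact {t ∈ Icc 0 Γ.L | inner ℝ n (Γ.γ t) = h} :=
    isCompact_Icc.of_isClosed_subset
      (hcont.preimage_isClosed_of_isClosed isClosed_Icc isClosed_singleton) (sep_subset _ _)
  refine hK.finite (isDiscrete_iff_nhdsNE.2 fun t ht => ?_)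
  have hne : inner ℝ n (Γ.tangent t) ≠ 0 := fun h0 => hh ⟨t, ⟨ht.1, h0⟩, ht.2⟩
  have hev := (hder t ht.1).eventually_ne (c := h) hne
  rw [← Filter.empty_mem_iff_bot, nhdsWithin, inf_assoc, inf_principal]
  rw [nhdsWithin, eventually_inf_principal] at hev
  rw [mem_inf_principal]
  filter_upwards [hev] with s hs hs2
  exact hs ⟨hs2.2.1, hs2.1⟩ hs2.2.2

/-- The fundamental theorem of calculus for a continuous function differentiable off a countable
set. It needs an integrable derivative; if the right side is infinite there is nothing to prove. -/
lemma ofReal_sub_le_lintegral_line {f : Plane → ℝ} (hf : Continuous f) {n τ : Plane} (hτ : ‖τ‖ = 1)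
    {h a b : ℝ} (hab : a ≤ b) {S : Set ℝ} (hS : S.Countable)
    (hd : ∀ s ∉ S, DifferentiableAt ℝ f (h • n + s • τ)) :
    ENNReal.ofReal (f (h • n + b • τ) - f (h • n + a • τ)) ≤
      ∫⁻ s in Ioc a b, ‖fderiv ℝ f (h • n + s • τ)‖ₑ := by
  rcases eq_or_ne (∫⁻ s in Ioc a b, ‖fderiv ℝ f (h • n + s • τ)‖ₑ) ⊤ with htop | htop
  · rw [htop]
    exact le_top
  have hline : Continuous fun s : ℝ => h • n + s • τ := by fun_prop
  have hle : ∀ s : ℝ, ‖fderiv ℝ f (h • n + s • τ) τ‖ₑ ≤ ‖fderiv ℝ f (h • n + s • τ)‖ₑ := fun s => by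
    rw [← ofReal_norm, ← ofReal_norm]
    refine ENNReal.ofReal_le_ofReal ?_
    simpa [hτ] using (fderiv ℝ f (h • n + s • τ)).le_opNorm τ
  have hm : Measurable fun s : ℝ => fderiv ℝ f (h • n + s • τ) τ :=
    (measurable_fderiv_apply_const ℝ f τ).comp hline.measurable
  have hint : IntervalIntegrable (fun s : ℝ => fderiv ℝ f (h • n + s • τ) τ) volume a b := by
    rw [intervalIntegrable_iff_integrableOn_Ioc_of_le hab]
    exact ⟨hm.aestronglyMeasurable, (lintegral_mono hle).trans_lt htop.lt_top⟩
  have hftc := integral_eq_of_hasDerivAt_off_countable_of_le (fun s : ℝ => f (h • n + s • τ)) _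
    hab hS (hf.comp hline).continuousOn (fun s hs => by
      have h1 : HasDerivAt (fun s : ℝ => h • n + s • τ) τ s := by
        simpa using! ((hasDerivAt_id s).smul_const τ).const_add (h • n)
      exact (hd s hs.2).hasFDerivAt.comp_hasDerivAt s h1) hint
  rw [← hftc, intervalIntegral.integral_of_le hab]
  refine (ENNReal.ofReal_le_ofReal (le_abs_self _)).trans ?_
  rw [← Real.norm_eq_abs, ofReal_norm]
  exact (enorm_integral_le_lintegral_enorm _).trans (lintegral_mono hle)

/-- A function that is at least `a` on one ball and at most `b` on another one of the same radius
has a gradient of a definite size in between. -/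
theorem PlaneCurve.le_lintegral_fderiv (Γ : PlaneCurve) {f : Plane → ℝ} (hf : Continuous f)
    (hd : ∀ x ∉ Γ.carrier, DifferentiableAt ℝ f x) {B : Set Plane} (hB : Convex ℝ B)
    (hBm : MeasurableSet B) {p q : Plane} {r a b : ℝ} (hr : 0 < r)
    (hp : Metric.closedBall p r ⊆ B) (hq : Metric.closedBall q r ⊆ B)
    (hfp : ∀ x ∈ Metric.closedBall p r, a ≤ f x) (hfq : ∀ x ∈ Metric.closedBall q r, f x ≤ b)
    (hab : b < a) :
    ENNReal.ofReal (a - b) * ENNReal.ofReal (2 * r) ≤ ∫⁻ x in B, ‖fderiv ℝ f x‖ₑ := by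
  have hpq : p - q ≠ 0 := fun h0 => by
    have h1 := hfp p (Metric.mem_closedBall_self hr.le)
    have h2 := hfq q (Metric.mem_closedBall_self hr.le)
    rw [sub_eq_zero.1 h0] at h1
    linarith
  have hℓ : 0 < ‖p - q‖ := norm_pos_iff.2 hpq
  set τ : Plane := ‖p - q‖⁻¹ • (p - q) with hτ
  have hτ1 : ‖τ‖ = 1 := by
    rw [hτ, norm_smul, norm_inv, norm_norm, inv_mul_cancel₀ hℓ.ne']
  -- The sign makes `perp n = τ`, so `(n, τ)` is a frame to which `lintegral_frame` applies.
  set n : Plane := -perp τ with hn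
  have hn1 : ‖n‖ = 1 := by rw [hn, norm_neg, norm_perp, hτ1]
  have hperp : perp n = τ := by
    ext i
    fin_cases i <;> simp [hn, perp]
  have hnτ : inner ℝ n (p - q) = 0 := by
    have : p - q = ‖p - q‖ • τ := by rw [hτ, smul_smul, mul_inv_cancel₀ hℓ.ne', one_smul]
    rw [this, inner_smul_right, hn, inner_neg_left, inner_eq]
    simp [perp]
    ring_nf
    simp
  have hfp1 := eq_frame hn1 p
  have hfq1 := eq_frame hn1 q
  rw [hperp] at hfp1 hfq1
  have hnpq : (inner ℝ n p : ℝ) = inner ℝ n q := by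
    rw [inner_sub_right] at hnτ
    linarith
  set β : ℝ := inner ℝ n p with hβ
  set s₁ : ℝ := inner ℝ τ p with hs₁
  set s₂ : ℝ := inner ℝ τ q with hs₂
  have hs : s₂ ≤ s₁ := by
    have : s₁ - s₂ = ‖p - q‖⁻¹ * inner ℝ (p - q) (p - q) := by
      rw [hs₁, hs₂, ← inner_sub_right, hτ, real_inner_smul_left]
    have h2 : 0 ≤ s₁ - s₂ := by
      rw [this, real_inner_self_eq_norm_sq]
      positivity
    linarith
  -- The centres `p` and `q` share the coordinate `β` along `n`. Each line with `|h - β| ≤ r`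
  -- therefore meets both balls at the heights of the centres.
  have hdist : ∀ {x : Plane} {s h : ℝ}, x = β • n + s • τ → h ∈ Icc (β - r) (β + r) →
      h • n + s • τ ∈ Metric.closedBall x r := by
    rintro x s h rfl hh
    rw [Metric.mem_closedBall, dist_eq_norm, add_sub_add_right_eq_sub, ← sub_smul, norm_smul, hn1,
      mul_one, Real.norm_eq_abs, abs_le]
    constructor <;> linarith [hh.1, hh.2]
  rw [← hnpq] at hfq1
  have hF : Measurable (B.indicator fun x => ‖fderiv ℝ f x‖ₑ) :=
    (measurable_fderiv ℝ f).enorm.indicator hBm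
  rw [← lintegral_indicator hBm, ← lintegral_frame hn1 hF, hperp]
  calc ENNReal.ofReal (a - b) * ENNReal.ofReal (2 * r)
      = ∫⁻ h in Icc (β - r) (β + r), ENNReal.ofReal (a - b) := by
        rw [setLIntegral_const, Real.volume_Icc]
        congr 2
        ring
    _ ≤ ∫⁻ h in Icc (β - r) (β + r), ∫⁻ s : ℝ,
          B.indicator (fun x => ‖fderiv ℝ f x‖ₑ) (h • n + s • τ) := by
        refine lintegral_mono_ae ?_
        filter_upwards [ae_restrict_mem measurableSet_Icc,
          ae_restrict_of_ae (Γ.ae_finite_level n)] with h hh hfin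
        have hP := hdist hfp1 hh
        have hQ := hdist hfq1 hh
        have hS : {s : ℝ | h • n + s • τ ∈ Γ.carrier}.Countable := by
          refine (hfin.image fun t => inner ℝ τ (Γ.γ t)).countable.mono ?_
          rintro s ⟨t, ht, hts⟩
          have e1 : (inner ℝ n n : ℝ) = 1 := by rw [real_inner_self_eq_norm_sq, hn1]; norm_num
          have e2 : (inner ℝ τ τ : ℝ) = 1 := by rw [real_inner_self_eq_norm_sq, hτ1]; norm_num
          have e3 : (inner ℝ n τ : ℝ) = 0 := by
            rw [hτ, inner_smul_right, hnτ, mul_zero]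
          refine ⟨t, ⟨ht, ?_⟩, ?_⟩
          · rw [hts, inner_add_right, inner_smul_right, inner_smul_right, e1, e3]
            ring
          · simp only [hts]
            rw [inner_add_right, inner_smul_right, inner_smul_right, e2, real_inner_comm, e3]
            ring
        calc ENNReal.ofReal (a - b)
            ≤ ENNReal.ofReal (f (h • n + s₁ • τ) - f (h • n + s₂ • τ)) :=
              ENNReal.ofReal_le_ofReal (by linarith [hfp _ hP, hfq _ hQ])
          _ ≤ ∫⁻ s in Ioc s₂ s₁, ‖fderiv ℝ f (h • n + s • τ)‖ₑ :=
              ofReal_sub_le_lintegral_line hf hτ1 hs hS fun s hs => hd _ hs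
          _ = ∫⁻ s in Ioc s₂ s₁, B.indicator (fun x => ‖fderiv ℝ f x‖ₑ) (h • n + s • τ) := by
              refine setLIntegral_congr_fun measurableSet_Ioc fun s hs => ?_
              have hmem : h • n + s • τ ∈ B := by
                have hseg : s ∈ segment ℝ s₂ s₁ := by
                  rw [segment_eq_Icc (hs.1.le.trans hs.2)]
                  exact Ioc_subset_Icc_self hs
                obtain ⟨c, d, hc, hd', hcd, rfl⟩ := hseg
                have := hB (hq hQ) (hp hP) hc hd' hcd
                convert this using 1
                have : h • n = (c + d) • h • n := by rw [hcd, one_smul]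
                simp only [smul_eq_mul]
                nth_rewrite 1 [this]
                module
              simp only [indicator_of_mem hmem]
          _ ≤ _ := setLIntegral_le_lintegral _ _
    _ ≤ _ := setLIntegral_le_lintegral _ _

end

section

variable {Γ : PlaneCurve} {α : ℝ}

/-! ### The ball containing the hull -/

namespace PlaneCurve

lemma closedBall_subset_of_hull_subset {x₀ : Plane} {R : ℝ}
    (h : Γ.hull ⊆ Metric.closedBall x₀ R) {p : Plane} (hp : p ∈ Γ.carrier) :
    Metric.closedBall p 1 ⊆ Metric.closedBall x₀ R :=
  ((Metric.closedBall_subset_cthickening hp 1).trans (subset_convexHull ℝ _)).trans h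

lemma carrier_subset_of_hull_subset {x₀ : Plane} {R : ℝ}
    (h : Γ.hull ⊆ Metric.closedBall x₀ R) : Γ.carrier ⊆ Metric.closedBall x₀ R := fun _ hp =>
  closedBall_subset_of_hull_subset h hp (Metric.mem_closedBall_self zero_le_one)

/-- The ball contains a unit ball around a point of the curve, hence two points at distance `2`. -/
lemma one_le_of_hull_subset {x₀ : Plane} {R : ℝ}
    (h : Γ.hull ⊆ Metric.closedBall x₀ R) : 1 ≤ R := by
  have hp : Γ.γ 0 ∈ Γ.carrier := ⟨0, Γ.zero_mem, rfl⟩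
  set e : Plane := EuclideanSpace.single 0 1 with he
  have he1 : ‖e‖ = 1 := by simp [he]
  have h1 := closedBall_subset_of_hull_subset h hp
    (show Γ.γ 0 + e ∈ Metric.closedBall (Γ.γ 0) 1 by simp [he1])
  have h2 := closedBall_subset_of_hull_subset h hp
    (show Γ.γ 0 - e ∈ Metric.closedBall (Γ.γ 0) 1 by simp [he1])
  have h3 := dist_triangle_right (Γ.γ 0 + e) (Γ.γ 0 - e) x₀
  rw [dist_eq_norm, show Γ.γ 0 + e - (Γ.γ 0 - e) = (2 : ℝ) • e by module, norm_smul, he1] at h3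
  rw [Metric.mem_closedBall] at h1 h2
  rw [Real.norm_ofNat] at h3
  linarith

end PlaneCurve

/-! ### The gradient of the quotient of two solutions -/

/-- Around `x₁` and `x₂` the function `v` stays within `m / 4` of `1` and of a number `≤ 0`. As `m ≤
u ≤ 1` there, `v / u` is at least `3/4` on one disc and at most `1/4` on the other. The discs have
radius `d²`, so the gradient integral is at least `d²`. -/
theorem IsDistSolution.le_integral_fderiv_div {κ₀ κ₁ A R : ℝ} {u v : Plane → ℝ}
    (h : IsDistSolution Γ α κ₀ u) (hκ₀ : 0 < κ₀) (h₁ : IsDistSolution Γ α κ₁ v) (hκ₁ : 0 < κ₁)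
    (hα : 0 < α) (hu : ∀ x, 0 < u x) {p : Plane} (hp : u p = 1)
    {x₁ x₂ : Plane} (hx₁ : x₁ ∈ Γ.carrier) (hv₁ : v x₁ = 1) (hx₂ : x₂ ∈ Γ.carrier) (hv₂ : v x₂ ≤ 0)
    (hA : 1 ≤ A) (hA₁ : 16 * α / Γ.injConst ≤ A) (hA₂ : 24 * greenConst * α / Γ.injConst ≤ A)
    {x₀ : Plane} (hpR : p ∈ Metric.closedBall x₀ R) (hR : Γ.hull ⊆ Metric.closedBall x₀ R) :
    IntegrableOn (fun x => ‖fderiv ℝ (fun y => v y / u y) x‖) (Metric.closedBall x₀ R) ∧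
    ((16 * Real.pi * greenConst)⁻¹) ^ 2 / 16 * (κ₀ / (A ^ 3 * R)) *
      Real.exp (-(6 * (κ₀ * R))) ≤
      ∫ x in Metric.closedBall x₀ R, ‖fderiv ℝ (fun y => v y / u y) x‖ := by
  have hG := greenConst_pos
  have hR1 := PlaneCurve.one_le_of_hull_subset hR
  have hR0 : 0 < R := by linarith
  have hA0 : 0 < A := by linarith
  have hΓ := PlaneCurve.carrier_subset_of_hull_subset hR
  set m := (16 * Real.pi * greenConst)⁻¹ * √(κ₀ / A) * Real.exp (-(3 * (κ₀ * R))) with hm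
  have hsq : 0 < √(κ₀ / A) := Real.sqrt_pos.2 (by positivity)
  have hm0 : 0 < m := by positivity
  have hlow : ∀ x ∈ Metric.closedBall x₀ R, m ≤ u x := fun x hx =>
    h.le_of_nonneg hκ₀ hα (fun x => (hu x).le) hp hA0 hA₂ hR0 hΓ hx
  have hm1 : m ≤ 1 := by rw [← hp]; exact hlow p hpR
  have hint := h.integrableOn_fderiv_div hκ₀ h₁ hκ₁ hα hm0 hlow
  refine ⟨hint, ?_⟩
  have hsR : 1 ≤ √R := Real.one_le_sqrt.2 hR1
  -- Then the Hölder bound `A √R · d` on a disc of radius `d²` equals `m / 4`.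
  set d := m / (4 * A * √R) with hd
  have hd0 : 0 < d := by positivity
  have hAR : 1 ≤ A * √R := one_le_mul_of_one_le_of_one_le hA hsR
  have hd1 : d ≤ 1 := by
    rw [hd, div_le_one (by positivity)]
    linarith
  have hr1 : d ^ 2 ≤ 1 := pow_le_one₀ hd0.le hd1
  have hML := Γ.injConst_mul_length_le hΓ
  have hhold : ∀ x y : Plane, x ∈ Metric.closedBall y (d ^ 2) → |v x - v y| ≤ m / 4 := by
    intro x y hxy
    rw [Metric.mem_closedBall, dist_eq_norm] at hxy
    have h2 : √‖x - y‖ ≤ d := Real.sqrt_le_iff.2 ⟨hd0.le, hxy⟩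
    calc |v x - v y| ≤ 16 * α / Γ.injConst * √R * √‖x - y‖ := h₁.abs_sub_le hκ₁ hα hML x y
      _ ≤ A * √R * d := by gcongr
      _ = m / 4 := by rw [hd]; field_simp
  have hball : ∀ y ∈ Γ.carrier, Metric.closedBall y (d ^ 2) ⊆ Metric.closedBall x₀ R := fun y hy =>
    (Metric.closedBall_subset_closedBall hr1).trans (PlaneCurve.closedBall_subset_of_hull_subset hR hy)
  have hmain := Γ.le_lintegral_fderiv (f := fun y => v y / u y)
    (h₁.continuous.div h.continuous fun x => (hu x).ne')
    (fun x hx => h.differentiableAt_div hκ₀ h₁ hκ₁ hx (hu x).ne')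
    (convex_closedBall x₀ R) measurableSet_closedBall (p := x₁) (q := x₂) (r := d ^ 2)
    (a := 3 / 4) (b := 1 / 4) (by positivity) (hball x₁ hx₁) (hball x₂ hx₂)
    (fun x hx => by
      have h2 := abs_le.1 (hhold x x₁ hx)
      rw [le_div_iff₀ (hu x)]
      have h3 := (le_abs_self _).trans (h.le_one x)
      linarith [h2.1])
    (fun x hx => by
      have h2 := abs_le.1 (hhold x x₂ hx)
      rw [div_le_iff₀ (hu x)]
      have h3 := hlow x (hball x₂ hx₂ hx)
      linarith [h2.2]) (by norm_num)
  have hto : ∫⁻ x in Metric.closedBall x₀ R, ‖fderiv ℝ (fun y => v y / u y) x‖ₑ =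
      ENNReal.ofReal (∫ x in Metric.closedBall x₀ R, ‖fderiv ℝ (fun y => v y / u y) x‖) := by
    rw [ofReal_integral_eq_lintegral_ofReal hint (Eventually.of_forall fun x => norm_nonneg _)]
    simp only [ofReal_norm]
  rw [hto, ← ENNReal.ofReal_mul (by norm_num),
    ENNReal.ofReal_le_ofReal_iff (integral_nonneg fun x => norm_nonneg _)] at hmain
  refine le_trans (le_of_eq ?_) hmain
  have e1 : √(κ₀ / A) ^ 2 = κ₀ / A := Real.sq_sqrt (by positivity)
  have e2 : √R ^ 2 = R := Real.sq_sqrt hR0.le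
  have e3 : Real.exp (-(6 * (κ₀ * R))) = Real.exp (-(3 * (κ₀ * R))) ^ 2 := by
    rw [← Real.exp_nat_mul]
    congr 1
    push_cast
    ring
  rw [e3, hd, hm, div_pow, mul_pow, mul_pow, mul_pow, mul_pow, e1, e2]
  field_simp
  norm_num

/-! ### Comparison of the bounds -/

lemma one_le_zeta {κ : ℝ} (hκ : 0 < κ) : 1 ≤ zeta κ := by
  unfold zeta
  split_ifs with h
  · exact le_rfl
  · have h1 : Real.log κ ≤ Real.log (1 / 2) := Real.log_le_log hκ (not_le.1 h).le
    rw [one_div, Real.log_inv] at h1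
    rw [le_div_iff₀ (Real.log_pos one_lt_two)]
    linarith

/-- From `exp(Bρ) ≥ (Bρ)⁴ / 24`; the rate `B = 24 / c + 1` satisfies `B⁴ c ≥ B c ≥ 24`. -/
lemma pow_four_mul_exp_neg_le {ρ c : ℝ} (hρ : 0 ≤ ρ) (hc : 0 < c) :
    ρ ^ 4 * Real.exp (-((24 / c + 1) * ρ)) ≤ c := by
  set B := 24 / c + 1 with hB
  have hB1 : 1 ≤ B := by
    have : 0 < 24 / c := by positivity
    linarith
  have hBc : 24 ≤ B * c := by
    rw [hB, add_mul, div_mul_cancel₀ _ hc.ne']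
    linarith
  have h1 := Real.pow_div_factorial_le_exp (B * ρ) (by positivity) 4
  rw [Real.exp_neg, ← div_eq_mul_inv, div_le_iff₀ (Real.exp_pos _)]
  refine le_trans ?_ (mul_le_mul_of_nonneg_left h1 hc.le)
  have h2 : 24 ≤ B ^ 4 * c := by
    have : B ≤ B ^ 4 := le_self_pow₀ hB1 (by norm_num)
    nlinarith
  have h3 : ((Nat.factorial 4 : ℕ) : ℝ) = 24 := by norm_num [Nat.factorial]
  rw [h3, mul_pow]
  have h4 : 0 ≤ ρ ^ 4 := by positivity
  nlinarith

/-- The numerator is `(κ / R)(κR)⁴`; the larger rate of decay absorbs `(κR)⁴` and the constant `c`.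
The factors `A³`, `(κ² + 1)⁴` and `ζ`, all at least `1`, merely weaken the bound. -/
lemma bound_le {κ R A c ζ : ℝ} (hκ : 0 < κ) (hR : 0 < R) (hA : 1 ≤ A) (hc : 0 < c) (hζ : 1 ≤ ζ) :
    (κ * (κ * R)) ^ 2 * (κ * R) / (A ^ 6 * (κ ^ 2 + 1) ^ 4 * ζ) *
      Real.exp (-(6 + (24 / c + 1)) * (κ * R)) ≤
    c * (κ / (A ^ 3 * R)) * Real.exp (-(6 * (κ * R))) := by
  have hA0 : 0 < A := by linarith
  have h1 := pow_four_mul_exp_neg_le (ρ := κ * R) (by positivity) hc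
  have h2 : A ^ 3 ≤ A ^ 6 * (κ ^ 2 + 1) ^ 4 * ζ := by
    have e1 : A ^ 3 ≤ A ^ 6 := pow_le_pow_right₀ hA (by norm_num)
    have e2 : 1 ≤ (κ ^ 2 + 1) ^ 4 := one_le_pow₀ (by nlinarith)
    have e3 : A ^ 6 ≤ A ^ 6 * (κ ^ 2 + 1) ^ 4 := le_mul_of_one_le_right (by positivity) e2
    exact (e1.trans e3).trans (le_mul_of_one_le_right (by positivity) hζ)
  have h3 : Real.exp (-(6 + (24 / c + 1)) * (κ * R)) =
      Real.exp (-((24 / c + 1) * (κ * R))) * Real.exp (-(6 * (κ * R))) := by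
    rw [← Real.exp_add]
    congr 1
    ring
  rw [h3, ← mul_assoc]
  refine mul_le_mul_of_nonneg_right ?_ (Real.exp_pos _).le
  calc (κ * (κ * R)) ^ 2 * (κ * R) / (A ^ 6 * (κ ^ 2 + 1) ^ 4 * ζ) *
        Real.exp (-((24 / c + 1) * (κ * R)))
      ≤ (κ * (κ * R)) ^ 2 * (κ * R) / A ^ 3 * Real.exp (-((24 / c + 1) * (κ * R))) := by gcongr
    _ = κ / (A ^ 3 * R) * ((κ * R) ^ 4 * Real.exp (-((24 / c + 1) * (κ * R)))) := by field_simp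
    _ ≤ κ / (A ^ 3 * R) * c := by gcongr
    _ = _ := mul_comm _ _

/-! ### Sign changes -/

lemma pos_or_neg_of_ne_zero {ψ : Plane → ℝ} (hc : Continuous ψ) (h0 : ∀ x, ψ x ≠ 0) :
    (∀ x, |ψ x| = ψ x) ∨ ∀ x, |ψ x| = -ψ x := by
  by_contra! hcon
  obtain ⟨⟨x, hx⟩, y, hy⟩ := hcon
  have hx0 : ψ x ≤ 0 := by
    by_contra! h
    exact hx (abs_of_pos h)
  have hy0 : 0 ≤ ψ y := by
    by_contra! h
    exact hy (abs_of_neg h)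
  obtain ⟨z, hz⟩ := mem_range_of_exists_le_of_exists_ge hc ⟨x, hx0⟩ ⟨y, hy0⟩
  exact h0 z hz

/-- Otherwise `v` would be nonnegative everywhere by the Green representation. As `ψ` has constant
sign, orthogonality would force `v = 0`. -/
lemma IsDistSolution.exists_nonpos {κ : ℝ} {ψ v : Plane → ℝ} (h : IsDistSolution Γ α κ v)
    (hκ : 0 < κ) (hα : 0 < α) (hv : MemLp v 2 volume) {x₁ : Plane} (hx₁ : v x₁ ≠ 0)
    (hc : Continuous ψ) (hψ : MemLp ψ 2 volume) (h0 : ∀ x, ψ x ≠ 0)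
    (hort : ∫ x, ψ x * v x = 0) : ∃ x ∈ Γ.carrier, v x ≤ 0 := by
  by_contra! hcon
  have hv0 := h.nonneg_of_nonneg_on hκ hα fun x hx => (hcon x hx).le
  have hort' : ∫ x, |ψ x| * v x = 0 := by
    rcases pos_or_neg_of_ne_zero hc h0 with hs | hs
    · simpa only [hs] using hort
    · simp only [hs, neg_mul, integral_neg, hort, neg_zero]
  have hi : Integrable fun x => |ψ x| * v x := hψ.abs.integrable_mul hv
  rw [integral_eq_zero_iff_of_nonneg (fun x => mul_nonneg (abs_nonneg _) (hv0 x)) hi] at hort'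
  have := congrFun (((hc.abs.mul h.continuous).ae_eq_iff_eq volume
    (continuous_const (y := (0 : ℝ)))).1 hort') x₁
  simp [h0 x₁, hx₁] at this

end

end DeltaCurve

end

/-! ### The proposition -/

open DeltaCurve in
theorem proposition6p6 :
    ∃ (c₃ : ℝ → ℝ → ℝ) (c₄ : ℝ → ℝ), DeltaCurve.IsLogBound c₃ c₄ ∧
    ∃ β₀ : ℝ, 0 < β₀ ∧
    ∀ (Γ : DeltaCurve.PlaneCurve) (α E₀ E₁ : ℝ), 0 < α →
    DeltaCurve.TwoLowestEigenvalues Γ α E₀ E₁ →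
    ∀ ψ₀ ψ₁ : DeltaCurve.Plane → ℝ,
    -- the continuous representatives of real eigenfunctions, with supremum norm one
    Continuous ψ₀ → DeltaCurve.IsEigenfunction Γ α E₀ ψ₀ →
    IsLUB (Set.range fun x => |ψ₀ x|) 1 →
    Continuous ψ₁ → DeltaCurve.IsEigenfunction Γ α E₁ ψ₁ →
    IsLUB (Set.range fun x => |ψ₁ x|) 1 →
    ∀ x₀ : DeltaCurve.Plane, Γ.hull ⊆ Metric.closedBall x₀ Γ.radius →
    ∀ κ₀ ρ : ℝ, κ₀ = √(-E₀) → ρ = κ₀ * Γ.radius →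
    (∀ x, ψ₀ x ≠ 0) ∧
    (∀ x ∉ Γ.carrier, DifferentiableAt ℝ (fun y => ψ₁ y / ψ₀ y) x) ∧
    MeasureTheory.IntegrableOn (fun x => ‖gradient (fun y => ψ₁ y / ψ₀ y) x‖)
      (Metric.closedBall x₀ Γ.radius) MeasureTheory.volume ∧
    (κ₀ * ρ) ^ 2 * ρ /
        ((α * DeltaCurve.c5 c₃ c₄ Γ + 1) ^ 6 * (κ₀ ^ 2 + 1) ^ 4 * DeltaCurve.zeta κ₀) *
        Real.exp (-β₀ * ρ) ≤
      ∫ x in Metric.closedBall x₀ Γ.radius, ‖gradient (fun y => ψ₁ y / ψ₀ y) x‖ := by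
  have hG := greenConst_pos
  -- `16` serves the logarithmic bound and the Hölder constant; `12 * greenConst` is half of the
  -- constant `24 * greenConst` required by the lower bound for the ground state.
  set A₀ : ℝ := max 16 (12 * greenConst) with hA₀
  have hA₀1 : 16 ≤ A₀ := le_max_left _ _
  have hA₀2 : 12 * greenConst ≤ A₀ := le_max_right _ _
  set c : ℝ := ((16 * Real.pi * greenConst)⁻¹) ^ 2 / 16 with hc
  have hc0 : 0 < c := by positivity
  refine ⟨_, _, isLogBound_div hA₀1, 6 + (24 / c + 1), by positivity, ?_⟩
  intro Γ α E₀ E₁ hα hE ψ₀ ψ₁ hψ₀ he₀ hl₀ hψ₁ he₁ hl₁ x₀ hball κ₀ ρ hκ hρ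
  subst hρ
  have hM := Γ.injConst_pos
  have hE₁ := hE.neg
  have hE₀ : E₀ < 0 := hE.lt.trans hE₁
  have hκ₀ : 0 < κ₀ := by rw [hκ]; exact Real.sqrt_pos.2 (by linarith)
  have hκ₀2 : κ₀ ^ 2 = -E₀ := by rw [hκ]; exact Real.sq_sqrt (by linarith)
  have hκ₁ : 0 < √(-E₁) := Real.sqrt_pos.2 (by linarith)
  have hle₀ : ∀ x, |ψ₀ x| ≤ 1 := fun x => hl₀.1 ⟨x, rfl⟩
  have hle₁ : ∀ x, |ψ₁ x| ≤ 1 := fun x => hl₁.1 ⟨x, rfl⟩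
  have h₀ := he₀.isDistSolution_abs (hE.isFormLowerBound hα) hψ₀ hle₀ hκ₀2
  have h₁ := he₁.isDistSolution hψ₁ hle₁ (Real.sq_sqrt (by linarith : (0 : ℝ) ≤ -E₁))
  obtain ⟨p, hpΓ, hp⟩ := h₀.exists_abs_eq_one hκ₀ hα (by simpa only [abs_abs] using hl₀)
  rw [abs_abs] at hp
  have hpos : ∀ x, 0 < |ψ₀ x| := h₀.pos_of_nonneg hκ₀ hα (fun x => abs_nonneg _)
    (y := p) (by rw [hp]; exact one_ne_zero)
  have hne : ∀ x, ψ₀ x ≠ 0 := fun x => abs_pos.1 (hpos x)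
  have hort := integral_mul_eq_zero_of_isEigenfunction hE.lt.ne he₀ he₁
  obtain ⟨x₁, hx₁, hv₁⟩ := h₁.exists_abs_eq_one hκ₁ hα hl₁
  -- The sign of `ψ₁` is adjusted so that its modulus is attained as a positive maximum.
  obtain ⟨v, hv, hvs, hv1⟩ : ∃ v, IsDistSolution Γ α (√(-E₁)) v ∧
      ((v = ψ₁) ∨ v = fun x => -ψ₁ x) ∧ v x₁ = 1 := by
    rcases abs_eq zero_le_one |>.1 hv₁ with h | h
    · exact ⟨ψ₁, h₁, Or.inl rfl, h⟩
    · exact ⟨_, h₁.neg, Or.inr rfl, by simp [h]⟩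
  have hvmem : MeasureTheory.MemLp v 2 MeasureTheory.volume := by
    rcases hvs with rfl | rfl
    exacts [he₁.2.memLp, he₁.2.memLp.neg]
  have hvort : ∫ x, ψ₀ x * v x = 0 := by
    rcases hvs with rfl | rfl
    · exact hort
    · simp only [mul_neg, MeasureTheory.integral_neg, hort, neg_zero]
  obtain ⟨x₂, hx₂, hv2⟩ := hv.exists_nonpos hκ₁ hα hvmem (x₁ := x₁) (by rw [hv1]; exact one_ne_zero)
    hψ₀ he₀.2.memLp hne hvort
  -- Without zeros `ψ₀` has constant sign, so replacing `f` by `v / |ψ₀|` changes at most a global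
  -- sign and leaves the norm of the gradient alone.
  have hfg : (∀ y, v y / |ψ₀ y| = ψ₁ y / ψ₀ y) ∨ ∀ y, v y / |ψ₀ y| = -(ψ₁ y / ψ₀ y) := by
    rcases pos_or_neg_of_ne_zero hψ₀ hne with hs | hs <;> rcases hvs with rfl | rfl <;>
      simp only [hs, neg_div, div_neg, neg_neg] <;> simp
  have hfd : ∀ x, ‖fderiv ℝ (fun y => v y / |ψ₀ y|) x‖ =
      ‖gradient (fun y => ψ₁ y / ψ₀ y) x‖ := fun x => by
    rw [norm_gradient]
    rcases hfg with h | h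
    · simp only [h]
    · simp only [h]
      rw [fderiv_fun_neg, norm_neg]
  have hdiff : ∀ x ∉ Γ.carrier, DifferentiableAt ℝ (fun y => ψ₁ y / ψ₀ y) x := fun x hx => by
    have h := h₀.differentiableAt_div hκ₀ hv hκ₁ hx (hpos x).ne'
    rcases hfg with h' | h'
    · simpa only [h'] using h
    · simp only [h'] at h
      simpa using h.fun_neg
  set c₅ := c5 (fun M _ => 2 * A₀ / M) (fun M => A₀ / M) Γ with hc₅
  -- Of the maximum defining `c₅` only the entry `2 c₄` is needed.
  have hc₅M : 2 * (A₀ / Γ.injConst) ≤ c₅ := le_max_left _ _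
  have hAle : 2 * A₀ * α / Γ.injConst ≤ α * c₅ := by
    calc 2 * A₀ * α / Γ.injConst = α * (2 * (A₀ / Γ.injConst)) := by ring
      _ ≤ α * c₅ := by gcongr
  have hA0 : 0 ≤ α * c₅ := le_trans (by positivity) hAle
  have hA₁ : 16 * α / Γ.injConst ≤ α * c₅ + 1 := by
    have : 16 * α / Γ.injConst ≤ 2 * A₀ * α / Γ.injConst := by
      gcongr
      linarith
    linarith
  have hA₂ : 24 * greenConst * α / Γ.injConst ≤ α * c₅ + 1 := by
    have : 24 * greenConst * α / Γ.injConst ≤ 2 * A₀ * α / Γ.injConst :=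
      div_le_div_of_nonneg_right (mul_le_mul_of_nonneg_right (by linarith) hα.le) hM.le
    linarith
  obtain ⟨hint, hmain⟩ := h₀.le_integral_fderiv_div hκ₀ hv hκ₁ hα hpos hp hx₁ hv1 hx₂ hv2
    (by linarith) hA₁ hA₂ (PlaneCurve.carrier_subset_of_hull_subset hball hpΓ) hball
  simp only [hfd] at hint hmain
  have hR1 := PlaneCurve.one_le_of_hull_subset hball
  refine ⟨hne, hdiff, hint, le_trans ?_ hmain⟩
  exact bound_le hκ₀ (by linarith) (by linarith) hc0 (one_le_zeta hκ₀)
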